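/- For an integer $k\ge 1$ and $z=(z_1,\dots,z_{2k})$ near the origin of $\mathbb{C}^{2k}$ let $$A(z)=\prod_p\ \prod_{i,j=1}^k\bigl(1-p^{-1-z_i+z_{k+j}}\bigr)\int_0^1\prod_{j=1}^k\Bigl(1-\frac{e^{2\pi i\theta}}{p^{1/2+z_j}}\Bigr)^{-1}\Bigl(1-\frac{e^{-2\pi i\theta}}{p^{1/2-z_{k+j}}}\Bigr)^{-1}d\theta ,$$ the outer product being over all primes. The product converges and is holomorphic in a neighbourhood of the origin, and $A(0)\notin(-\infty,0]$. For $\alpha\in\mathbb{Z}_{\ge0}^{2k}$ let $a_\alpha$ be the coefficient of $z_1^{\alpha_1}\cdots z_{2k}^{\alpha_{2k}}$ in the Taylor expansion of $\log A(z)$ (principal branch) at the origin. Put $|\alpha|=\alpha_1+\cdots+\alpha_{2k}$, let $m(\alpha)$ be the number of non-zero entries of $\alpha$, and, when $m(\alpha)=1$, let $\mathrm{sgn}(\alpha)=(-1)^{|\alpha|+1}$ if $\alpha_{k+1}=\cdots=\alpha_{2k}=0$ and $\mathrm{sgn}(\alpha)=-1$ if $\alpha_1=\cdots=\alpha_k=0$.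 Let $$B_k=\sum_p\left(\frac{k\log p}{p-1}-k\,\frac{F(k+1,k+1;2;1/p)}{F(k,k;1;1/p)}\,\frac{\log p}{p}\right),\qquad \tau_k=2B_k+2\gamma k,$$ where $F$ is the Gauss hypergeometric function and $\gamma$ is Euler's constant; the series for $B_k$ converges absolutely for every $k\ge1$. **Theorem.** For fixed $|\alpha|$, as $k\to\infty$, all $\alpha\in\mathbb{Z}_{\ge0}^{2k}$ with $m(\alpha)=1$ satisfy $$a_\alpha=\mathrm{sgn}(\alpha)\,\frac{k}{|\alpha|!}\left(\sum_{p\le k^2}(\log p)^{|\alpha|}\sum_{n=1}^\infty\frac{n^{|\alpha|-1}}{p^n}\right)\left[1+O\!\left(\frac1{\log k}\right)\right]$$ and $$a_\alpha=\mathrm{sgn}(\alpha)\,\frac{k}{|\alpha|!}\left(\sum_{p\le k^2}\frac{(\log p)^{|\alpha|}}{p}\right)\left[1+O\!\left(\frac1{\log k}\right)\right],$$ where the implied constants and the lower bound on $k$ depend only on $|\alpha|$. Moreover $B_k=a_{(1,0,\dots,0)}$ for every $k\ge1$, and as $k\to\infty$ $$B_k\sim 2k\log k,\qquad \tau_k\sim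 4k\log k .$$ -/

import Mathlib

noncomputable section

namespace ZetaMoment

/-- The partial derivative `∂f/∂z_i` of a function on `ℂⁿ`. -/
def partialDeriv {n : ℕ} (i : Fin n) (f : (Fin n → ℂ) → ℂ) : (Fin n → ℂ) → ℂ :=
  fun z => deriv (fun t : ℂ => f (Function.update z i t)) (z i)

/-- The Taylor coefficient at the origin of the monomial `z^α`:
`(1 / (α_1! ⋯ α_n!)) (∂_1^{α_1} ⋯ ∂_n^{α_n} f)(0)`. -/
def taylorCoeff {n : ℕ} (f : (Fin n → ℂ) → ℂ) (α : Fin n → ℕ) : ℂ :=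
  (∏ i, ((α i).factorial : ℂ))⁻¹ *
    (List.finRange n).foldr (fun i g => (partialDeriv i)^[α i] g) f 0

/-- The factor at `p` of the arithmetic factor. The variables `z_1, …, z_k` are
`z (Fin.castAdd k i)`, the variables `z_{k+1}, …, z_{2k}` are `z (Fin.natAdd k j)`. -/
def eulerFactor (k : ℕ) (z : Fin (k + k) → ℂ) (p : ℕ) : ℂ :=
  (∏ i : Fin k, ∏ j : Fin k,
      (1 - (p : ℂ) ^ (-1 - z (Fin.castAdd k i) + z (Fin.natAdd k j)))) *
    ∫ θ in (0 : ℝ)..1, ∏ j : Fin k,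
      ((1 - Complex.exp (2 * Real.pi * Complex.I * θ) /
          (p : ℂ) ^ (1 / 2 + z (Fin.castAdd k j)))⁻¹ *
        (1 - Complex.exp (-(2 * Real.pi * Complex.I * θ)) /
          (p : ℂ) ^ (1 / 2 - z (Fin.natAdd k j)))⁻¹)

/-- The arithmetic factor `A(z_1, …, z_{2k})`, an Euler product. -/
def arithFactor (k : ℕ) (z : Fin (k + k) → ℂ) : ℂ :=
  ∏' p : Nat.Primes, eulerFactor k z (p : ℕ)

/-- The coefficient `a_α` of `z^α` in the Taylor expansion of `log A(z_1, …, z_{2k})`. -/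
def aCoeff (k : ℕ) (α : Fin (k + k) → ℕ) : ℂ :=
  taylorCoeff (fun z => Complex.log (arithFactor k z)) α

/-- The weight `|α| = α_1 + ⋯ + α_n`. -/
def weight {n : ℕ} (α : Fin n → ℕ) : ℕ := ∑ i, α i

/-- The number `m(α)` of non-zero entries of `α`. -/
def numNonzero {n : ℕ} (α : Fin n → ℕ) : ℕ := (Finset.univ.filter (fun i => α i ≠ 0)).card

open Classical in
/-- `sgn(α)`, meant for `m(α) = 1`: it is `(-1)^{|α|+1}` if `α_{k+1} = ⋯ = α_{2k} = 0`, and `-1`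
if `α_1 = ⋯ = α_k = 0`. -/
def sgn (k : ℕ) (α : Fin (k + k) → ℕ) : ℝ :=
  if ∀ j : Fin k, α (Fin.natAdd k j) = 0 then (-1) ^ (weight α + 1) else -1

/-- The multi-index `(1, 0, …, 0)`. -/
def firstIndex (k : ℕ) : Fin (k + k) → ℕ := fun j => if (j : ℕ) = 0 then 1 else 0

/-- The primes `p ≤ x`. -/
def primesUpTo (x : ℕ) : Finset ℕ := (Finset.range (x + 1)).filter Nat.Prime

/-- The term at `p` of the series that defines `B_k`. -/
def bTerm (k p : ℕ) : ℝ :=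
  k * Real.log p / (p - 1) -
    k * (ordinaryHypergeometric ((k : ℝ) + 1) ((k : ℝ) + 1) 2 (1 / (p : ℝ)) /
        ordinaryHypergeometric (k : ℝ) (k : ℝ) 1 (1 / (p : ℝ))) * (Real.log p / p)

/-- `B_k`. -/
def B (k : ℕ) : ℝ := ∑' p : Nat.Primes, bTerm k (p : ℕ)

/-- `τ_k = 2 B_k + 2 γ k`, with Euler's constant `γ`. -/
def tau (k : ℕ) : ℝ := 2 * B k + 2 * Real.eulerMascheroniConstant * k

end ZetaMoment

end

/-! Put s_i = p^(-1/2-z_i) and s'_j = p^(-1/2+z_{k+j}), and let h_n be the complete homogeneous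
symmetric polynomials. The integral over θ keeps the diagonal of a double series, so the Euler
factor is ∏(1 - s_i s'_j) · ∑ h_n(s) h_n(s') (`eulerFactor_eq_eulerSeries`). The terms ∓∑ s_i s'_j
of product and series cancel, so near the origin the factor is 1 + O_k(p^(-8/5)), and the logarithms
of the factors have a summable bound (`exists_ball_log_eulerFactor`). The factors are positive at
the origin, which fixes the branch; hence a coefficient with one non-zero index is a sum over primes
of Taylor coefficients in one variable t (`hasSum_aCoeff_single`).

Along the axis of some z_i write r = p^(-1/2), L = log p, w = e^(-Lt), κ = k - 1. The factor is a
constant times (1 - r²w)^k G(t) with G(t) = ∑ c_m (rw)^m, where c_m is the correlation at lag m of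
the sequences d_{k-1}(p^l) r^l and d_k(p^l) r^l (`eulerFactor_update_castAdd`). The term k log(1 -
r²w) produces exactly the summand of the main term with prime powers, so everything rests on two
bounds with explicit dependence on k. For every p, c_m ≤ c_0/(1-r) (`corr_le_div`), whence
log(G(t)/G(0)) = O(r) on |t| < 1/(1000L), and Cauchy's estimate gives an error O(p^(-1/2) log^|α| p)
free of k. If k r² ≤ 1/10, then c_1/c_0 = kr + O(k³r³), so k log(1 - r²w) and log(G/c_0) cancel to
first order and leave O(k³/p²) (`norm_log_add_log_corrGen_le`). The two bounds cross at p = k²,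
which is why the sums stop there. By Chebyshev's bound both errors sum to O(k log^(|α|-1) k), while
by Mertens' estimate the main sum is at least ½ log^|α| k; the quotient is O(1/log k). Prime powers
contribute O(1).

The axes of z_{k+j} follow from those of z_i by t ↦ -t, which explains sgn. For B_k the sums ∑ c_m
r^m and ∑ m c_m r^m are hypergeometric values, and Mertens' estimate up to k² gives 2k log k. -/

namespace ZetaMoment

/-! ### Complete homogeneous polynomials and the series form of the Euler factor -/

open PowerSeries in
/-- The power series `f` converges absolutely at `u`, with sum `φ`. -/
def AbsEval (f : PowerSeries ℂ) (u φ : ℂ) : Prop :=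
  Summable (fun n => ‖coeff n f * u ^ n‖) ∧ ∑' n, coeff n f * u ^ n = φ

theorem AbsEval.one (u : ℂ) : AbsEval 1 u 1 := by
  have h : ∀ n : ℕ, n ≠ 0 → PowerSeries.coeff n (1 : PowerSeries ℂ) * u ^ n = 0 := by
    intro n hn
    simp [PowerSeries.coeff_one, hn]
  refine ⟨summable_of_ne_finset_zero (s := {0}) ?_, ?_⟩
  · intro n hn
    rw [h n (by simpa using hn), norm_zero]
  · rw [tsum_eq_single 0 h]
    simp

theorem AbsEval.mul {f g : PowerSeries ℂ} {u φ ψ : ℂ} (hf : AbsEval f u φ) (hg : AbsEval g u ψ) :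
    AbsEval (f * g) u (φ * ψ) := by
  have h : ∀ n : ℕ, PowerSeries.coeff n (f * g) * u ^ n =
      ∑ kl ∈ Finset.HasAntidiagonal.antidiagonal n, (PowerSeries.coeff kl.1 f * u ^ kl.1) *
        (PowerSeries.coeff kl.2 g * u ^ kl.2) := by
    intro n
    rw [PowerSeries.coeff_mul, Finset.sum_mul]
    refine Finset.sum_congr rfl fun kl hkl => ?_
    rw [← Finset.HasAntidiagonal.mem_antidiagonal.mp hkl, pow_add]
    ring
  have h1 := summable_norm_sum_mul_antidiagonal_of_summable_norm
    (f := fun n => PowerSeries.coeff n f * u ^ n) (g := fun n => PowerSeries.coeff n g * u ^ n)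
    hf.1 hg.1
  have h2 := tsum_mul_tsum_eq_tsum_sum_antidiagonal_of_summable_norm
    (f := fun n => PowerSeries.coeff n f * u ^ n) (g := fun n => PowerSeries.coeff n g * u ^ n)
    hf.1 hg.1
  refine ⟨h1.congr fun n => by rw [h], ?_⟩
  rw [tsum_congr h, ← h2, hf.2, hg.2]

theorem AbsEval.geom {s u : ℂ} (h : ‖s * u‖ < 1) :
    AbsEval (PowerSeries.mk fun n => s ^ n) u (1 - u * s)⁻¹ := by
  simp only [AbsEval, PowerSeries.coeff_mk, ← mul_pow]
  refine ⟨by simpa using summable_geometric_of_lt_one (norm_nonneg _) h, ?_⟩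
  rw [tsum_geometric_of_norm_lt_one h, mul_comm]

theorem AbsEval.prod {ι : Type*} (S : Finset ι) {f : ι → PowerSeries ℂ} {φ : ι → ℂ} {u : ℂ}
    (h : ∀ j ∈ S, AbsEval (f j) u (φ j)) : AbsEval (∏ j ∈ S, f j) u (∏ j ∈ S, φ j) := by
  classical
  induction S using Finset.induction_on with
  | empty => simpa using AbsEval.one u
  | insert a S ha ih =>
    rw [Finset.prod_insert ha, Finset.prod_insert ha]
    exact (h a (Finset.mem_insert_self _ _)).mul
      (ih fun j hj => h j (Finset.mem_insert_of_mem hj))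

/-- The complete homogeneous symmetric polynomial of degree `n` in the variables `s j`, `j ∈ S`. -/
noncomputable def chs {ι : Type*} (S : Finset ι) (s : ι → ℂ) (n : ℕ) : ℂ :=
  PowerSeries.coeff n (∏ j ∈ S, PowerSeries.mk fun m => s j ^ m)

theorem chs_zero {ι : Type*} (S : Finset ι) (s : ι → ℂ) : chs S s 0 = 1 := by
  simp [chs]

theorem chs_empty_succ {ι : Type*} (s : ι → ℂ) (n : ℕ) : chs ∅ s (n + 1) = 0 := by
  simp [chs, PowerSeries.coeff_one]

theorem chs_insert {ι : Type*} [DecidableEq ι] {S : Finset ι} {a : ι} (ha : a ∉ S) (s : ι → ℂ)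
    (n : ℕ) : chs (insert a S) s n =
      ∑ kl ∈ Finset.HasAntidiagonal.antidiagonal n, s a ^ kl.1 * chs S s kl.2 := by
  rw [chs, Finset.prod_insert ha, PowerSeries.coeff_mul]
  simp [chs]

theorem chs_one {ι : Type*} (S : Finset ι) (s : ι → ℂ) : chs S s 1 = ∑ j ∈ S, s j := by
  classical
  induction S using Finset.induction_on with
  | empty => simpa using chs_empty_succ s 0
  | insert a S ha ih =>
    rw [chs_insert ha, Finset.sum_insert ha]
    simp [Finset.Nat.antidiagonal_succ, chs_zero, ih, add_comm]

theorem sum_antidiagonal_multichoose (k n : ℕ) :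
    ∑ kl ∈ Finset.HasAntidiagonal.antidiagonal n, Nat.multichoose k kl.2 = Nat.multichoose (k + 1) n := by
  induction n with
  | zero => simp
  | succ n ih =>
    rw [Finset.Nat.sum_antidiagonal_succ, ih, Nat.multichoose_succ_succ]

/-- There are `Nat.multichoose S.card n` monomials of degree n, each of size at most ρ^n.
`chs_const` is the case of equality. -/
theorem norm_chs_le {ι : Type*} (S : Finset ι) {s : ι → ℂ} {ρ : ℝ} (h : ∀ j ∈ S, ‖s j‖ ≤ ρ)
    (n : ℕ) : ‖chs S s n‖ ≤ Nat.multichoose S.card n * ρ ^ n := by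
  classical
  induction S using Finset.induction_on generalizing n with
  | empty =>
    cases n with
    | zero => simp [chs_zero]
    | succ n => simp [chs_empty_succ]
  | insert a S ha ih =>
    have hρ : 0 ≤ ρ := (norm_nonneg _).trans (h a (Finset.mem_insert_self _ _))
    rw [chs_insert ha, Finset.card_insert_of_notMem ha, ← sum_antidiagonal_multichoose]
    push_cast
    rw [Finset.sum_mul]
    refine (norm_sum_le _ _).trans (Finset.sum_le_sum fun kl hkl => ?_)
    rw [norm_mul, norm_pow, ← Finset.HasAntidiagonal.mem_antidiagonal.mp hkl, pow_add]
    calc ‖s a‖ ^ kl.1 * ‖chs S s kl.2‖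
        ≤ ρ ^ kl.1 * (Nat.multichoose S.card kl.2 * ρ ^ kl.2) := by
          gcongr
          · exact h a (Finset.mem_insert_self _ _)
          · exact ih (fun j hj => h j (Finset.mem_insert_of_mem hj)) _
      _ = _ := by ring

theorem chs_const {ι : Type*} (S : Finset ι) {s : ι → ℂ} {r : ℂ} (h : ∀ j ∈ S, s j = r)
    (n : ℕ) : chs S s n = Nat.multichoose S.card n * r ^ n := by
  classical
  induction S using Finset.induction_on generalizing n with
  | empty =>
    cases n with
    | zero => simp [chs_zero]
    | succ n => simp [chs_empty_succ]
  | insert a S ha ih =>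
    rw [chs_insert ha, Finset.card_insert_of_notMem ha, ← sum_antidiagonal_multichoose]
    push_cast
    rw [Finset.sum_mul]
    refine Finset.sum_congr rfl fun kl hkl => ?_
    rw [← Finset.HasAntidiagonal.mem_antidiagonal.mp hkl, pow_add, h a (Finset.mem_insert_self _ _),
      ih fun j hj => h j (Finset.mem_insert_of_mem hj)]
    ring

theorem absEval_chs {ι : Type*} (S : Finset ι) {s : ι → ℂ} {u : ℂ}
    (h : ∀ j ∈ S, ‖s j * u‖ < 1) :
    Summable (fun n => ‖chs S s n * u ^ n‖) ∧
      ∑' n, chs S s n * u ^ n = ∏ j ∈ S, (1 - u * s j)⁻¹ :=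
  AbsEval.prod S fun j hj => AbsEval.geom (h j hj)

theorem summable_norm_chs {ι : Type*} (S : Finset ι) {s : ι → ℂ} (h : ∀ j ∈ S, ‖s j‖ < 1) :
    Summable (fun n => ‖chs S s n‖) := by
  simpa using (absEval_chs S (s := s) (u := 1) (by simpa using h)).1

theorem summable_multichoose_mul_pow (k : ℕ) {r : ℝ} (h0 : 0 ≤ r) (h1 : r < 1) :
    Summable (fun n => (Nat.multichoose k n : ℝ) * r ^ n) := by
  have h := summable_norm_chs (Finset.univ : Finset (Fin k)) (s := fun _ => (r : ℂ))
    (by simp [abs_of_nonneg h0, h1])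
  simp_rw [chs_const Finset.univ (s := fun _ : Fin k => (r : ℂ)) (r := r) (fun _ _ => rfl)] at h
  simpa [abs_of_nonneg h0] using h

theorem integral_exp_int (m n : ℕ) :
    ∫ θ in (0 : ℝ)..1, Complex.exp (2 * Real.pi * Complex.I * θ) ^ m *
      Complex.exp (-(2 * Real.pi * Complex.I * θ)) ^ n = if m = n then 1 else 0 := by
  have h : ∀ θ : ℝ, Complex.exp (2 * Real.pi * Complex.I * θ) ^ m *
      Complex.exp (-(2 * Real.pi * Complex.I * θ)) ^ n =
      Complex.exp ((2 * Real.pi * Complex.I * ((m : ℂ) - n)) * θ) := by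
    intro θ
    rw [← Complex.exp_nat_mul, ← Complex.exp_nat_mul, ← Complex.exp_add]
    ring_nf
  simp_rw [h]
  split_ifs with hmn
  · simp [hmn]
  · have hc : (2 * Real.pi * Complex.I * ((m : ℂ) - n)) ≠ 0 := by
      refine mul_ne_zero Complex.two_pi_I_ne_zero (sub_ne_zero.mpr ?_)
      exact_mod_cast hmn
    rw [integral_exp_mul_complex hc]
    have : Complex.exp ((2 * Real.pi * Complex.I * ((m : ℂ) - n)) * ((1 : ℝ) : ℂ)) = 1 := by
      rw [Complex.exp_eq_one_iff]
      exact ⟨(m : ℤ) - n, by push_cast; ring⟩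
    rw [this]
    simp

theorem summable_norm_mul_diag {a b : ℕ → ℂ} (ha : Summable fun n => ‖a n‖)
    (hb : Summable fun n => ‖b n‖) : Summable fun n => ‖a n * b n‖ :=
  (ha.mul_norm hb).comp_injective (i := fun n : ℕ => (n, n)) fun _ _ h => congrArg Prod.fst h

/-- Absolute convergence allows termwise integration of the double series, and orthogonality of the
exponentials leaves only the diagonal. -/
theorem integral_mul_tsum_exp {a b : ℕ → ℂ} (ha : Summable fun n => ‖a n‖)
    (hb : Summable fun n => ‖b n‖) :
    ∫ θ in (0 : ℝ)..1, (∑' n, a n * Complex.exp (2 * Real.pi * Complex.I * θ) ^ n) *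
      (∑' n, b n * Complex.exp (-(2 * Real.pi * Complex.I * θ)) ^ n) = ∑' n, a n * b n := by
  have hE : ∀ θ : ℝ, ‖Complex.exp (2 * Real.pi * Complex.I * θ)‖ = 1 := by
    intro θ
    rw [Complex.norm_exp]
    simp
  have hE' : ∀ θ : ℝ, ‖Complex.exp (-(2 * Real.pi * Complex.I * θ))‖ = 1 := by
    intro θ
    rw [Complex.norm_exp]
    simp
  have hF : ∀ θ : ℝ, (∑' n, a n * Complex.exp (2 * Real.pi * Complex.I * θ) ^ n) *
      (∑' n, b n * Complex.exp (-(2 * Real.pi * Complex.I * θ)) ^ n) =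
      ∑' mn : ℕ × ℕ, (a mn.1 * b mn.2) * (Complex.exp (2 * Real.pi * Complex.I * θ) ^ mn.1 *
        Complex.exp (-(2 * Real.pi * Complex.I * θ)) ^ mn.2) := by
    intro θ
    rw [tsum_mul_tsum_of_summable_norm]
    · exact tsum_congr fun mn => by ring
    · simpa [hE] using ha
    · simpa [hE'] using hb
  simp_rw [hF, intervalIntegral.integral_of_le zero_le_one]
  have hs : Summable fun mn : ℕ × ℕ => ‖a mn.1 * b mn.2‖ := ha.mul_norm hb
  have key := MeasureTheory.hasSum_integral_of_summable_integral_norm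
    (μ := MeasureTheory.volume.restrict (Set.Ioc (0 : ℝ) 1))
    (F := fun (mn : ℕ × ℕ) (θ : ℝ) => (a mn.1 * b mn.2) *
      (Complex.exp (2 * Real.pi * Complex.I * θ) ^ mn.1 *
        Complex.exp (-(2 * Real.pi * Complex.I * θ)) ^ mn.2))
    (fun mn => by
      have hc : Continuous fun θ : ℝ => (a mn.1 * b mn.2) *
        (Complex.exp (2 * Real.pi * Complex.I * θ) ^ mn.1 *
        Complex.exp (-(2 * Real.pi * Complex.I * θ)) ^ mn.2) := by fun_prop
      exact (hc.intervalIntegrable 0 1).1)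
    (by
      simp only [norm_mul, norm_pow, hE, hE', one_pow, mul_one]
      simpa using hs)
  rw [← key.tsum_eq]
  have hterm : ∀ mn : ℕ × ℕ, ∫ θ in Set.Ioc (0 : ℝ) 1, (a mn.1 * b mn.2) *
      (Complex.exp (2 * Real.pi * Complex.I * θ) ^ mn.1 *
        Complex.exp (-(2 * Real.pi * Complex.I * θ)) ^ mn.2) =
      if mn.1 = mn.2 then a mn.1 * b mn.2 else 0 := by
    intro mn
    rw [← intervalIntegral.integral_of_le zero_le_one, intervalIntegral.integral_const_mul,
      integral_exp_int]
    simp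
  simp_rw [hterm]
  symm
  have hinj : Function.Injective fun n : ℕ => (n, n) := fun _ _ h => congrArg Prod.fst h
  rw [← hinj.tsum_eq (f := fun mn : ℕ × ℕ => if mn.1 = mn.2 then a mn.1 * b mn.2 else 0)]
  · simp
  · intro mn hmn
    by_cases h : mn.1 = mn.2
    · exact ⟨mn.1, by ext <;> simp [h]⟩
    · simp [h] at hmn

/-- The Euler factor as a series, in the variables `s i = p^(-1/2 - z_i)` and
`s' j = p^(-1/2 + z_{k+j})`. -/
noncomputable def eulerSeries {k : ℕ} (s s' : Fin k → ℂ) : ℂ :=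
  (∏ i, ∏ j, (1 - s i * s' j)) * ∑' n, chs Finset.univ s n * chs Finset.univ s' n

theorem eulerSeries_comm {k : ℕ} (s s' : Fin k → ℂ) : eulerSeries s s' = eulerSeries s' s := by
  unfold eulerSeries
  rw [Finset.prod_comm]
  simp_rw [mul_comm]

/-- The variables `p^(-1/2 - z_i)`. -/
noncomputable def leftVar {k : ℕ} (z : Fin (k + k) → ℂ) (p : ℕ) (i : Fin k) : ℂ :=
  (p : ℂ) ^ (-(1 / 2) - z (Fin.castAdd k i))

/-- The variables `p^(-1/2 + z_{k+j})`. -/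
noncomputable def rightVar {k : ℕ} (z : Fin (k + k) → ℂ) (p : ℕ) (j : Fin k) : ℂ :=
  (p : ℂ) ^ (-(1 / 2) + z (Fin.natAdd k j))

/-- The two products in the integrand are the generating functions of h_n(s) and h_n(s') at e(θ) and
e(-θ). The series form replaces the integral in all later estimates. -/
theorem eulerFactor_eq_eulerSeries {k : ℕ} {z : Fin (k + k) → ℂ} {p : ℕ} (hp : p ≠ 0)
    (hl : ∀ i, ‖leftVar z p i‖ < 1) (hr : ∀ j, ‖rightVar z p j‖ < 1) :
    eulerFactor k z p = eulerSeries (leftVar z p) (rightVar z p) := by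
  have hp' : (p : ℂ) ≠ 0 := Nat.cast_ne_zero.mpr hp
  have hE : ∀ θ : ℝ, ‖Complex.exp (2 * Real.pi * Complex.I * θ)‖ = 1 := by
    intro θ
    rw [Complex.norm_exp]
    simp
  have hE' : ∀ θ : ℝ, ‖Complex.exp (-(2 * Real.pi * Complex.I * θ))‖ = 1 := by
    intro θ
    rw [Complex.norm_exp]
    simp
  unfold eulerFactor eulerSeries
  congr 1
  · refine Finset.prod_congr rfl fun i _ => Finset.prod_congr rfl fun j _ => ?_
    rw [leftVar, rightVar, ← Complex.cpow_add _ _ hp']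
    congr 2
    ring
  · rw [← integral_mul_tsum_exp (summable_norm_chs _ fun i _ => hl i)
      (summable_norm_chs _ fun i _ => hr i)]
    refine intervalIntegral.integral_congr fun θ _ => ?_
    rw [(absEval_chs _ fun i _ => by simpa [hE] using hl i).2,
      (absEval_chs _ fun i _ => by simpa [hE'] using hr i).2, ← Finset.prod_mul_distrib]
    refine Finset.prod_congr rfl fun j _ => ?_
    have h1 : ∀ E : ℂ, E / (p : ℂ) ^ (1 / 2 + z (Fin.castAdd k j)) = E * leftVar z p j := by
      intro E
      rw [div_eq_mul_inv, ← Complex.cpow_neg, leftVar]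
      ring_nf
    have h2 : ∀ E : ℂ, E / (p : ℂ) ^ (1 / 2 - z (Fin.natAdd k j)) = E * rightVar z p j := by
      intro E
      rw [div_eq_mul_inv, ← Complex.cpow_neg, rightVar]
      ring_nf
    rw [h1, h2]

end ZetaMoment

/-! ### Holomorphic series, one-variable Taylor coefficients, and the Euler factor near 1 -/

namespace ZetaMoment

open Filter Topology Metric

/-- A summable bound on the terms gives one on their derivatives by Cauchy's estimate on smaller
balls. The general normed space is needed because z lives in ℂ^(2k). -/
theorem differentiableAt_tsum_of_norm_le {E ι : Type*} [NormedAddCommGroup E] [NormedSpace ℂ E]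
    {f : ι → E → ℂ} {u : ι → ℝ} (hu : Summable u) {R : ℝ}
    (hf : ∀ i, DifferentiableOn ℂ (f i) (ball 0 R)) (hb : ∀ i, ∀ z ∈ ball (0 : E) R, ‖f i z‖ ≤ u i)
    {z : E} (hz : z ∈ ball (0 : E) R) : DifferentiableAt ℂ (fun y => ∑' i, f i y) z := by
  set ε : ℝ := (R - ‖z‖) / 2 with hε
  have hz' : ‖z‖ < R := by simpa using hz
  have hε0 : 0 < ε := by rw [hε]; linarith
  have hsub : ∀ y ∈ ball z ε, ball y ε ⊆ ball (0 : E) R := by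
    intro y hy w hw
    rw [mem_ball, dist_eq_norm] at hy hw
    rw [mem_ball_zero_iff]
    calc ‖w‖ = ‖(w - y) + (y - z) + z‖ := by congr 1; abel
      _ ≤ ‖w - y‖ + ‖y - z‖ + ‖z‖ := norm_add₃_le
      _ < ε + ε + ‖z‖ := by linarith
      _ = R := by rw [hε]; ring
  have hmem : ∀ y ∈ ball z ε, y ∈ ball (0 : E) R := fun y hy => hsub y hy (mem_ball_self hε0)
  -- Cauchy's estimate on balls of radius ε; the 2 appears because the i-th term oscillates by at
  -- most 2 u_i there.
  refine (hasFDerivAt_tsum_of_isPreconnected (u := fun i => 2 * u i / ε)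
    (f' := fun i y => fderiv ℂ (f i) y) (s := ball z ε) (x₀ := z)
    ((hu.mul_left 2).div_const ε) isOpen_ball ?_ ?_ ?_
    (mem_ball_self hε0) ?_ (mem_ball_self hε0)).differentiableAt
  · let _ : NormedSpace ℝ E := NormedSpace.restrictScalars ℝ ℂ E
    exact (convex_ball z ε).isPreconnected
  · intro i y hy
    exact ((hf i).differentiableAt (isOpen_ball.mem_nhds (hmem y hy))).hasFDerivAt
  · intro i y hy
    refine Complex.norm_fderiv_le_div_of_mapsTo_ball ((hf i).mono (hsub y hy)) ?_ hε0
    intro w hw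
    rw [mem_closedBall, dist_eq_norm]
    have h1 := hb i w (hsub y hy hw)
    have h2 := hb i y (hmem y hy)
    linarith [norm_sub_le (f i w) (f i y)]
  · exact Summable.of_norm_bounded hu fun i => hb i z hz

/-- Each differentiation halves the radius, so that Cauchy's estimate supplies a new summable bound
for the derivatives. -/
theorem hasSum_iteratedDeriv_of_norm_le {ι : Type*} (N : ℕ) {f : ι → ℂ → ℂ} {u : ι → ℝ}
    (hu : Summable u) {R : ℝ} (hR : 0 < R) (hf : ∀ i, DifferentiableOn ℂ (f i) (ball 0 R))
    (hb : ∀ i, ∀ z ∈ ball (0 : ℂ) R, ‖f i z‖ ≤ u i) :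
    HasSum (fun i => iteratedDeriv N (f i) 0) (iteratedDeriv N (fun z => ∑' i, f i z) 0) := by
  induction N generalizing f u R with
  | zero =>
    simp only [iteratedDeriv_zero]
    exact (Summable.of_norm_bounded hu fun i => hb i 0 (mem_ball_self hR)).hasSum
  | succ N ih =>
    have hsub : ∀ y ∈ ball (0 : ℂ) (R / 2), ball y (R / 2) ⊆ ball (0 : ℂ) R := by
      intro y hy
      refine ball_subset_ball' ?_
      rw [mem_ball] at hy
      linarith
    have hd : ∀ z ∈ ball (0 : ℂ) R,
        HasSum (fun i => deriv (f i) z) (deriv (fun w => ∑' i, f i w) z) := fun z hz =>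
      Complex.hasSum_deriv_of_summable_norm hu hf isOpen_ball hb hz
    simp only [iteratedDeriv_succ']
    have heq : deriv (fun w => ∑' i, f i w) =ᶠ[𝓝 0] fun z => ∑' i, deriv (f i) z := by
      filter_upwards [ball_mem_nhds (0 : ℂ) hR] with z hz
      exact (hd z hz).tsum_eq.symm
    rw [heq.iteratedDeriv_eq]
    refine ih (u := fun i => 2 * u i / (R / 2)) ((hu.mul_left 2).div_const _)
      (half_pos hR) ?_ ?_
    · intro i
      exact ((hf i).deriv isOpen_ball).mono (ball_subset_ball (by linarith))
    · intro i z hz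
      refine Complex.norm_deriv_le_div_of_mapsTo_ball ((hf i).mono (hsub z hz)) ?_ (half_pos hR)
      intro w hw
      rw [mem_closedBall, dist_eq_norm]
      have h1 := hb i w (hsub z hz hw)
      have h2 := hb i z (hsub z hz (mem_ball_self (half_pos hR)))
      linarith [norm_sub_le (f i w) (f i z)]

/-- Since f x is real, continuity keeps the imaginary part of f in (-π, π) near x, where the
principal logarithm inverts the exponential. -/
theorem eventually_log_eq {E : Type*} [TopologicalSpace E] {f g : E → ℂ} {x : E}
    (hf : ContinuousAt f x) (him : (f x).im = 0) (h : ∀ᶠ y in 𝓝 x, g y = Complex.exp (f y)) :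
    ∀ᶠ y in 𝓝 x, Complex.log (g y) = f y := by
  have hc : ContinuousAt (fun y => (f y).im) x := Complex.continuous_im.continuousAt.comp hf
  have h1 : ∀ᶠ y in 𝓝 x, -Real.pi < (f y).im :=
    hc.eventually_const_lt (by simp [him, Real.pi_pos])
  have h2 : ∀ᶠ y in 𝓝 x, (f y).im < Real.pi :=
    hc.eventually_lt_const (by simp [him, Real.pi_pos])
  filter_upwards [h, h1, h2] with y hy hy1 hy2
  rw [hy, Complex.log_exp hy1 hy2.le]

theorem partialDeriv_iterate {n : ℕ} (i : Fin n) (f : (Fin n → ℂ) → ℂ) (N : ℕ) (z : Fin n → ℂ) :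
    (partialDeriv i)^[N] f z =
      iteratedDeriv N (fun t => f (Function.update z i t)) (z i) := by
  induction N generalizing z with
  | zero => simp
  | succ N ih =>
    rw [Function.iterate_succ_apply', partialDeriv, iteratedDeriv_succ]
    simp [ih]

/-- All indices other than i contribute a zeroth iterate, and i occurs at most once in a list
without repetition. -/
theorem foldr_partialDeriv {n : ℕ} {α : Fin n → ℕ} {i : Fin n} (h : ∀ j, j ≠ i → α j = 0)
    (f : (Fin n → ℂ) → ℂ) (l : List (Fin n)) (hl : l.Nodup) :
    l.foldr (fun i g => (partialDeriv i)^[α i] g) f =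
      if i ∈ l then (partialDeriv i)^[α i] f else f := by
  induction l with
  | nil => simp
  | cons j l ih =>
    rw [List.nodup_cons] at hl
    rw [List.foldr_cons, ih hl.2]
    by_cases hj : j = i
    · subst hj
      simp [hl.1]
    · simp [h j hj, Ne.symm hj]

theorem taylorCoeff_single {n : ℕ} {α : Fin n → ℕ} {i : Fin n} (h : ∀ j, j ≠ i → α j = 0)
    (f : (Fin n → ℂ) → ℂ) :
    taylorCoeff f α = ((α i).factorial : ℂ)⁻¹ *
      iteratedDeriv (α i) (fun t => f (Function.update 0 i t)) 0 := by
  rw [taylorCoeff, foldr_partialDeriv h f _ (List.nodup_finRange n), if_pos (List.mem_finRange i),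
    partialDeriv_iterate]
  congr 2
  rw [Finset.prod_eq_single i]
  · intro j _ hj
    simp [h j hj]
  · simp

/-- The remainder after the linear term is quadratic. The constant 4^card is crude, chosen so that
2·4^n + n ≤ 4^(n+1) closes the induction. -/
theorem norm_prod_one_sub_le {ι : Type*} (S : Finset ι) {a : ι → ℂ} {M : ℝ} (hM0 : 0 ≤ M)
    (hM : M ≤ 1) (ha : ∀ i ∈ S, ‖a i‖ ≤ M) :
    ‖∏ i ∈ S, (1 - a i) - 1 + ∑ i ∈ S, a i‖ ≤ 4 ^ S.card * M ^ 2 := by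
  classical
  induction S using Finset.induction_on with
  | empty => simpa using sq_nonneg M
  | insert b S hb ih =>
    have ih' := ih fun i hi => ha i (Finset.mem_insert_of_mem hi)
    have hbM := ha b (Finset.mem_insert_self _ _)
    have hsum : ‖∑ i ∈ S, a i‖ ≤ S.card * M := by
      refine (norm_sum_le _ _).trans ?_
      rw [← nsmul_eq_mul]
      exact Finset.sum_le_card_nsmul _ _ _ fun i hi => ha i (Finset.mem_insert_of_mem hi)
    rw [Finset.prod_insert hb, Finset.sum_insert hb, Finset.card_insert_of_notMem hb]
    have h1 : (1 - a b) * ∏ i ∈ S, (1 - a i) - 1 + (a b + ∑ i ∈ S, a i) =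
        (1 - a b) * (∏ i ∈ S, (1 - a i) - 1 + ∑ i ∈ S, a i) + a b * ∑ i ∈ S, a i := by ring
    have h2 : ‖1 - a b‖ ≤ 2 := by
      have := norm_sub_le (1 : ℂ) (a b)
      rw [norm_one] at this
      linarith
    have h3 : (S.card : ℝ) ≤ 4 ^ S.card := by
      exact_mod_cast (Nat.lt_pow_self (by norm_num : 1 < 4)).le
    rw [h1]
    calc _ ≤ ‖1 - a b‖ * ‖∏ i ∈ S, (1 - a i) - 1 + ∑ i ∈ S, a i‖ + ‖a b‖ * ‖∑ i ∈ S, a i‖ := by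
          refine (norm_add_le _ _).trans ?_
          rw [norm_mul, norm_mul]
      _ ≤ 2 * (4 ^ S.card * M ^ 2) + M * (S.card * M) := by gcongr
      _ ≤ 2 * (4 ^ S.card * M ^ 2) + M * (4 ^ S.card * M) := by gcongr
      _ ≤ 4 ^ (S.card + 1) * M ^ 2 := by
          have : 0 ≤ (4 : ℝ) ^ S.card * M ^ 2 := by positivity
          rw [pow_succ (4 : ℝ) S.card]
          nlinarith

/-- With T = ∑ s_i s'_j the product is 1 - T + O(ρ⁴) and the series is 1 + T + O(ρ⁴), because h_1(s)
h_1(s') = T. The constant may depend on k: the bound serves only convergence. -/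
theorem exists_norm_eulerSeries_sub_one_le (k : ℕ) {ρ₀ : ℝ} (h0 : 0 ≤ ρ₀) (h1 : ρ₀ < 1) :
    ∃ C : ℝ, ∀ ρ : ℝ, 0 ≤ ρ → ρ ≤ ρ₀ → ∀ s s' : Fin k → ℂ, (∀ i, ‖s i‖ ≤ ρ) →
      (∀ i, ‖s' i‖ ≤ ρ) → ‖eulerSeries s s' - 1‖ ≤ C * ρ ^ 4 := by
  have hd := summable_multichoose_mul_pow k h0 h1
  have hd2 : Summable fun n => (Nat.multichoose k (n + 2) : ℝ) ^ 2 * ρ₀ ^ (2 * n) := by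
    rcases h0.eq_or_lt with h | h
    · subst h
      refine summable_of_ne_finset_zero (s := {0}) fun n hn => ?_
      have : n ≠ 0 := by simpa using hn
      simp [this]
    · have h2 : Summable fun n => ((Nat.multichoose k n : ℝ) * ρ₀ ^ n) ^ 2 := by
        have hc : Summable fun n => ‖(((Nat.multichoose k n : ℝ) * ρ₀ ^ n : ℝ) : ℂ)‖ := by
          simpa [abs_of_nonneg h0] using hd
        have := summable_norm_mul_diag hc hc
        refine this.congr fun n => ?_
        rw [norm_mul, ← sq, Complex.norm_real, Real.norm_eq_abs, sq_abs]
      have h3 := ((summable_nat_add_iff 2).mpr h2).mul_left (ρ₀ ^ 4)⁻¹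
      refine h3.congr fun n => ?_
      field_simp
      ring
  set D : ℝ := ∑' n, (Nat.multichoose k (n + 2) : ℝ) ^ 2 * ρ₀ ^ (2 * n) with hD
  have hD0 : 0 ≤ D := tsum_nonneg fun n => by positivity
  refine ⟨k ^ 4 + (1 + k ^ 2) * D + 4 ^ (k * k) * (1 + k ^ 2 + D), ?_⟩
  intro ρ hρ0 hρ s s' hs hs'
  have hρ1 : ρ ≤ 1 := hρ.trans h1.le
  set T : ℂ := ∑ i, ∑ j, s i * s' j with hT
  have hTle : ‖T‖ ≤ k ^ 2 * ρ ^ 2 := by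
    calc ‖T‖ ≤ ∑ i : Fin k, ∑ j : Fin k, ρ * ρ := by
          refine (norm_sum_le _ _).trans (Finset.sum_le_sum fun i _ =>
            (norm_sum_le _ _).trans (Finset.sum_le_sum fun j _ => ?_))
          rw [norm_mul]
          exact mul_le_mul (hs i) (hs' j) (norm_nonneg _) hρ0
      _ = k ^ 2 * ρ ^ 2 := by simp; ring
  set P : ℂ := ∏ i, ∏ j, (1 - s i * s' j) with hP
  have hPle : ‖P - 1 + T‖ ≤ 4 ^ (k * k) * ρ ^ 4 := by
    have h := norm_prod_one_sub_le ((Finset.univ : Finset (Fin k)) ×ˢ (Finset.univ : Finset (Fin k)))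
      (a := fun ij => s ij.1 * s' ij.2) (M := ρ ^ 2) (by positivity)
      (pow_le_one₀ hρ0 hρ1) (fun ij _ => by
        rw [norm_mul, sq]
        exact mul_le_mul (hs _) (hs' _) (norm_nonneg _) hρ0)
    rw [Finset.prod_product, Finset.sum_product] at h
    simpa [← pow_mul] using h
  have hlt : ∀ i ∈ (Finset.univ : Finset (Fin k)), ‖s i‖ < 1 := fun i _ =>
    (hs i).trans_lt (hρ.trans_lt h1)
  have hlt' : ∀ i ∈ (Finset.univ : Finset (Fin k)), ‖s' i‖ < 1 := fun i _ =>
    (hs' i).trans_lt (hρ.trans_lt h1)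
  have hsum := summable_norm_mul_diag (summable_norm_chs _ hlt) (summable_norm_chs _ hlt')
  set Q : ℂ := ∑' n, chs Finset.univ s n * chs Finset.univ s' n with hQ
  have hQeq : Q = 1 + T + ∑' n, chs Finset.univ s (n + 2) * chs Finset.univ s' (n + 2) := by
    rw [hQ, ← hsum.of_norm.sum_add_tsum_nat_add 2]
    congr 1
    simp [Finset.sum_range_succ, chs_zero, chs_one, hT, Finset.sum_mul_sum]
  have hR2 : ‖Q - 1 - T‖ ≤ D * ρ ^ 4 := by
    rw [hQeq]
    have : (1 + T + ∑' n, chs Finset.univ s (n + 2) * chs Finset.univ s' (n + 2)) - 1 - T =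
      ∑' n, chs Finset.univ s (n + 2) * chs Finset.univ s' (n + 2) := by ring
    rw [this, hD, ← tsum_mul_right]
    refine tsum_of_norm_bounded (hd2.mul_right _).hasSum fun n => ?_
    have e1 := norm_chs_le Finset.univ (fun i _ => hs i) (n + 2)
    have e2 := norm_chs_le Finset.univ (fun i _ => hs' i) (n + 2)
    rw [Finset.card_univ, Fintype.card_fin] at e1 e2
    rw [norm_mul]
    calc _ ≤ (Nat.multichoose k (n + 2) * ρ ^ (n + 2)) * (Nat.multichoose k (n + 2) * ρ ^ (n + 2)) :=
          mul_le_mul e1 e2 (norm_nonneg _) (by positivity)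
      _ = (Nat.multichoose k (n + 2) : ℝ) ^ 2 * ρ ^ (2 * n) * ρ ^ 4 := by ring
      _ ≤ _ := by gcongr
  have hQle : ‖Q‖ ≤ 1 + k ^ 2 + D := by
    have e : Q = 1 + T + (Q - 1 - T) := by ring
    rw [e]
    refine (norm_add₃_le).trans ?_
    rw [norm_one]
    have : ρ ^ 2 ≤ 1 := pow_le_one₀ hρ0 hρ1
    have h4 : ρ ^ 4 ≤ 1 := pow_le_one₀ hρ0 hρ1
    have e1 : ‖T‖ ≤ k ^ 2 := hTle.trans (mul_le_of_le_one_right (by positivity) this)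
    have e2 : ‖Q - 1 - T‖ ≤ D := hR2.trans (mul_le_of_le_one_right hD0 h4)
    linarith
  have hT1 : ‖1 - T‖ ≤ 1 + k ^ 2 := by
    have e1 : ‖T‖ ≤ k ^ 2 := hTle.trans (mul_le_of_le_one_right (by positivity)
      (pow_le_one₀ hρ0 hρ1))
    have := norm_sub_le (1 : ℂ) T
    rw [norm_one] at this
    linarith
  -- The product of P = 1 - T + (P - 1 + T) and Q = 1 + T + (Q - 1 - T), arranged so that each
  -- summand is visibly O(ρ⁴).
  have hmain : eulerSeries s s' - 1 = -(T * T) + (1 - T) * (Q - 1 - T) + (P - 1 + T) * Q := by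
    rw [eulerSeries, ← hP, ← hQ]
    ring
  rw [hmain]
  refine norm_add₃_le.trans ?_
  rw [norm_neg, norm_mul, norm_mul, norm_mul]
  calc _ ≤ (k ^ 2 * ρ ^ 2) * (k ^ 2 * ρ ^ 2) + (1 + k ^ 2) * (D * ρ ^ 4) +
        (4 ^ (k * k) * ρ ^ 4) * (1 + k ^ 2 + D) := by gcongr
    _ = _ := by ring

theorem differentiableAt_chs {E ι : Type*} [NormedAddCommGroup E] [NormedSpace ℂ E] (S : Finset ι)
    {s : E → ι → ℂ} {z : E} (h : ∀ j ∈ S, DifferentiableAt ℂ (fun w => s w j) z) (n : ℕ) :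
    DifferentiableAt ℂ (fun w => chs S (s w) n) z := by
  classical
  induction S using Finset.induction_on generalizing n with
  | empty =>
    cases n with
    | zero => simp [chs_zero]
    | succ n => simp [chs_empty_succ]
  | insert a S ha ih =>
    simp_rw [chs_insert ha]
    refine DifferentiableAt.fun_sum fun kl _ => ?_
    exact ((h a (Finset.mem_insert_self _ _)).pow _).mul
      (ih (fun j hj => h j (Finset.mem_insert_of_mem hj)) _)

end ZetaMoment

/-! ### Convergence and holomorphy of the Euler product, and its logarithm as a sum over primes -/

namespace ZetaMoment

open Filter Topology Metric

/-- The bound `p^(-2/5)` for the variables `p^(-1/2 ∓ z_i)` with `‖z‖ < 1/10`. -/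
noncomputable def varBound (p : ℕ) : ℝ := (p : ℝ) ^ (-(2 / 5) : ℝ)

theorem varBound_nonneg (p : ℕ) : 0 ≤ varBound p := by unfold varBound; positivity

theorem varBound_two_lt_one : varBound 2 < 1 :=
  Real.rpow_lt_one_of_one_lt_of_neg (by norm_num) (by norm_num)

theorem varBound_le {p : ℕ} (hp : 2 ≤ p) : varBound p ≤ varBound 2 :=
  Real.rpow_le_rpow_of_nonpos (by norm_num) (by exact_mod_cast hp) (by norm_num)

/-- The radius 1/10 gives the exponent 2/5 for the variables, and 4 · 2/5 = 8/5 exceeds 1. -/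
theorem summable_varBound_pow : Summable fun p : Nat.Primes => varBound p ^ 4 := by
  have h := Nat.Primes.summable_rpow.mpr (by norm_num : (-(8 / 5) : ℝ) < -1)
  refine h.congr fun p => ?_
  rw [varBound, ← Real.rpow_natCast, ← Real.rpow_mul (by positivity)]
  norm_num

theorem norm_leftVar_le {k p : ℕ} (hp : 2 ≤ p) {z : Fin (k + k) → ℂ}
    (hz : z ∈ ball (0 : Fin (k + k) → ℂ) (1 / 10)) (i : Fin k) :
    ‖leftVar z p i‖ ≤ varBound p := by
  have h1 : |(z (Fin.castAdd k i)).re| ≤ 1 / 10 :=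
    (Complex.abs_re_le_norm _).trans ((norm_le_pi_norm z _).trans (mem_ball_zero_iff.mp hz).le)
  rw [leftVar, Complex.norm_natCast_cpow_of_pos (by omega), varBound]
  refine Real.rpow_le_rpow_of_exponent_le (by exact_mod_cast (by omega : 1 ≤ p)) ?_
  have := (abs_le.mp h1).1
  have hre : (-(1 / 2) - z (Fin.castAdd k i)).re = -(1 / 2) - (z (Fin.castAdd k i)).re := by
    rw [Complex.sub_re]
    norm_num
  rw [hre]
  linarith

theorem norm_rightVar_le {k p : ℕ} (hp : 2 ≤ p) {z : Fin (k + k) → ℂ}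
    (hz : z ∈ ball (0 : Fin (k + k) → ℂ) (1 / 10)) (i : Fin k) :
    ‖rightVar z p i‖ ≤ varBound p := by
  have h1 : |(z (Fin.natAdd k i)).re| ≤ 1 / 10 :=
    (Complex.abs_re_le_norm _).trans ((norm_le_pi_norm z _).trans (mem_ball_zero_iff.mp hz).le)
  rw [rightVar, Complex.norm_natCast_cpow_of_pos (by omega), varBound]
  refine Real.rpow_le_rpow_of_exponent_le (by exact_mod_cast (by omega : 1 ≤ p)) ?_
  have := (abs_le.mp h1).2
  have hre : (-(1 / 2) + z (Fin.natAdd k i)).re = -(1 / 2) + (z (Fin.natAdd k i)).re := by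
    rw [Complex.add_re]
    norm_num
  rw [hre]
  linarith

theorem eulerFactor_eq_of_mem_ball {k p : ℕ} (hp : 2 ≤ p) {z : Fin (k + k) → ℂ}
    (hz : z ∈ ball (0 : Fin (k + k) → ℂ) (1 / 10)) :
    eulerFactor k z p = eulerSeries (leftVar z p) (rightVar z p) :=
  eulerFactor_eq_eulerSeries (by omega)
    (fun i => (norm_leftVar_le hp hz i).trans_lt ((varBound_le hp).trans_lt varBound_two_lt_one))
    (fun i => (norm_rightVar_le hp hz i).trans_lt ((varBound_le hp).trans_lt varBound_two_lt_one))

theorem differentiableAt_leftVar {k p : ℕ} (hp : 2 ≤ p) (i : Fin k) (z : Fin (k + k) → ℂ) :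
    DifferentiableAt ℂ (fun w => leftVar w p i) z := by
  have hp' : (p : ℂ) ≠ 0 := by exact_mod_cast (by omega : p ≠ 0)
  unfold leftVar
  exact DifferentiableAt.const_cpow (by fun_prop) (Or.inl hp')

theorem differentiableAt_rightVar {k p : ℕ} (hp : 2 ≤ p) (i : Fin k) (z : Fin (k + k) → ℂ) :
    DifferentiableAt ℂ (fun w => rightVar w p i) z := by
  have hp' : (p : ℂ) ≠ 0 := by exact_mod_cast (by omega : p ≠ 0)
  unfold rightVar
  exact DifferentiableAt.const_cpow (by fun_prop) (Or.inl hp')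

theorem differentiableAt_finset_prod {E ι : Type*} [NormedAddCommGroup E] [NormedSpace ℂ E]
    (S : Finset ι) {f : ι → E → ℂ} {z : E} (h : ∀ i ∈ S, DifferentiableAt ℂ (f i) z) :
    DifferentiableAt ℂ (fun w => ∏ i ∈ S, f i w) z := by
  classical
  exact (HasFDerivAt.finsetProd fun i hi => (h i hi).hasFDerivAt).differentiableAt

theorem differentiableAt_eulerFactor {k p : ℕ} (hp : 2 ≤ p) {z : Fin (k + k) → ℂ}
    (hz : z ∈ ball (0 : Fin (k + k) → ℂ) (1 / 10)) :
    DifferentiableAt ℂ (fun w => eulerFactor k w p) z := by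
  have heq : (fun w => eulerFactor k w p) =ᶠ[𝓝 z]
      fun w => eulerSeries (leftVar w p) (rightVar w p) := by
    filter_upwards [isOpen_ball.mem_nhds hz] with w hw
    exact eulerFactor_eq_of_mem_ball hp hw
  rw [heq.differentiableAt_iff]
  unfold eulerSeries
  have hl := fun i => differentiableAt_leftVar (k := k) hp i
  have hr := fun i => differentiableAt_rightVar (k := k) hp i
  refine DifferentiableAt.mul ?_ ?_
  · have hij : ∀ i j, DifferentiableAt ℂ
        (fun w : Fin (k + k) → ℂ => 1 - leftVar w p i * rightVar w p j) z := fun i j =>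
      (differentiableAt_const _).sub ((hl i z).mul (hr j z))
    exact differentiableAt_finset_prod _ fun i _ => differentiableAt_finset_prod _ fun j _ => hij i j
  · have hv0 := varBound_nonneg p
    have hs := summable_multichoose_mul_pow k hv0
      ((varBound_le hp).trans_lt varBound_two_lt_one)
    have hc : Summable fun n => ‖(((Nat.multichoose k n : ℝ) * varBound p ^ n : ℝ) : ℂ)‖ := by
      simpa [abs_of_nonneg hv0] using hs
    have hc2 := summable_norm_mul_diag hc hc
    refine differentiableAt_tsum_of_norm_le hc2 ?_ ?_ hz
    · intro n w _
      exact ((differentiableAt_chs _ (fun i _ => hl i w) n).mul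
        (differentiableAt_chs _ (fun i _ => hr i w) n)).differentiableWithinAt
    · intro n w hw
      have e1 := norm_chs_le Finset.univ (fun i _ => norm_leftVar_le hp hw i) n
      have e2 := norm_chs_le Finset.univ (fun i _ => norm_rightVar_le hp hw i) n
      rw [Finset.card_univ, Fintype.card_fin] at e1 e2
      rw [norm_mul, norm_mul, Complex.norm_real, Real.norm_of_nonneg (by positivity)]
      exact mul_le_mul e1 e2 (norm_nonneg _) (by positivity)

/-- At z = 0 all variables equal p^(-1/2), so the factor is a product of positive numbers times a
series of nonnegative terms that starts with 1. Its principal logarithm is therefore real. -/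
theorem exists_eulerFactor_zero_eq (k : ℕ) {p : ℕ} (hp : 2 ≤ p) :
    ∃ c : ℝ, 0 < c ∧ eulerFactor k 0 p = c := by
  rw [eulerFactor_eq_of_mem_ball hp (mem_ball_self (by norm_num))]
  have hp0 : (0 : ℝ) ≤ p := by positivity
  set r : ℝ := (p : ℝ) ^ (-(1 / 2) : ℝ) with hr
  have hr0 : 0 ≤ r := by positivity
  have hr1 : r < 1 := Real.rpow_lt_one_of_one_lt_of_neg (by exact_mod_cast (by omega : 1 < p))
    (by norm_num)
  have hl : leftVar (0 : Fin (k + k) → ℂ) p = fun _ => (r : ℂ) := by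
    funext i
    rw [leftVar, hr, Complex.ofReal_cpow hp0]
    simp
  have hr' : rightVar (0 : Fin (k + k) → ℂ) p = fun _ => (r : ℂ) := by
    funext i
    rw [rightVar, hr, Complex.ofReal_cpow hp0]
    simp
  have hs : Summable fun n => ((Nat.multichoose k n : ℝ) * r ^ n) * (Nat.multichoose k n * r ^ n) := by
    have hc : Summable fun n => ‖(((Nat.multichoose k n : ℝ) * r ^ n : ℝ) : ℂ)‖ := by
      simpa [abs_of_nonneg hr0] using summable_multichoose_mul_pow k hr0 hr1
    refine (summable_norm_mul_diag hc hc).congr fun n => ?_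
    rw [norm_mul, Complex.norm_real, Real.norm_of_nonneg (by positivity)]
  refine ⟨(∏ _i : Fin k, ∏ _j : Fin k, (1 - r * r)) *
    ∑' n, ((Nat.multichoose k n : ℝ) * r ^ n) * (Nat.multichoose k n * r ^ n), ?_, ?_⟩
  · refine mul_pos (Finset.prod_pos fun i _ => Finset.prod_pos fun j _ => ?_) ?_
    · nlinarith
    · refine hs.tsum_pos (fun n => by positivity) 0 ?_
      simp
  · rw [eulerSeries, hl, hr']
    simp_rw [chs_const (Finset.univ : Finset (Fin k)) (s := fun _ => (r : ℂ)) (r := r)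
      (fun _ _ => rfl)]
    rw [Finset.card_univ, Fintype.card_fin]
    push_cast
    rfl

/-- For all but finitely many p the factor is within 1/2 of 1 on the whole ball of radius 1/10, and
its logarithm inherits the summable bound. For the finitely many others, continuity at the origin
suffices after shrinking δ. -/
theorem exists_ball_log_eulerFactor (k : ℕ) :
    ∃ δ : ℝ, 0 < δ ∧ δ ≤ 1 / 10 ∧ ∃ u : Nat.Primes → ℝ, Summable u ∧
      ∀ p : Nat.Primes, ∀ z ∈ ball (0 : Fin (k + k) → ℂ) δ,
        eulerFactor k z p ∈ Complex.slitPlane ∧ ‖Complex.log (eulerFactor k z p)‖ ≤ u p := by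
  obtain ⟨C, hC⟩ := exists_norm_eulerSeries_sub_one_le k (varBound_nonneg 2) varBound_two_lt_one
  have hE : ∀ p : Nat.Primes, ∀ z ∈ ball (0 : Fin (k + k) → ℂ) (1 / 10),
      ‖eulerFactor k z p - 1‖ ≤ C * varBound p ^ 4 := by
    intro p z hz
    rw [eulerFactor_eq_of_mem_ball p.2.two_le hz]
    exact hC _ (varBound_nonneg _) (varBound_le p.2.two_le) _ _ (norm_leftVar_le p.2.two_le hz)
      (norm_rightVar_le p.2.two_le hz)
  have hsum : Summable fun p : Nat.Primes => C * varBound p ^ 4 := summable_varBound_pow.mul_left C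
  have hfin : {p : Nat.Primes | ¬ C * varBound p ^ 4 < 1 / 2}.Finite := by
    have := hsum.tendsto_cofinite_zero.eventually_lt_const (by norm_num : (0 : ℝ) < 1 / 2)
    rwa [eventually_cofinite] at this
  have hev : ∀ᶠ z in 𝓝 (0 : Fin (k + k) → ℂ), ∀ p ∈ {p : Nat.Primes | ¬ C * varBound p ^ 4 < 1 / 2},
      eulerFactor k z p ∈ Complex.slitPlane ∧
        ‖Complex.log (eulerFactor k z p)‖ ≤ ‖Complex.log (eulerFactor k 0 p)‖ + 1 := by
    rw [eventually_all_finite hfin]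
    intro p _
    have hc : ContinuousAt (fun z => eulerFactor k z p) 0 :=
      (differentiableAt_eulerFactor p.2.two_le (mem_ball_self (by norm_num))).continuousAt
    obtain ⟨c, hc0, hceq⟩ := exists_eulerFactor_zero_eq k p.2.two_le
    have hmem : eulerFactor k 0 p ∈ Complex.slitPlane := by
      rw [hceq]
      exact Complex.ofReal_mem_slitPlane.mpr hc0
    have h1 := hc.eventually (Complex.isOpen_slitPlane.mem_nhds hmem)
    have h2 : ContinuousAt (fun z => ‖Complex.log (eulerFactor k z p)‖) 0 := (hc.clog hmem).norm
    have h3 := h2.eventually_lt_const (lt_add_one _)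
    filter_upwards [h1, h3] with z hz1 hz3
    exact ⟨hz1, hz3.le⟩
  obtain ⟨δ, hδ0, hδ⟩ := Metric.eventually_nhds_iff_ball.mp hev
  classical
  refine ⟨min δ (1 / 10), lt_min hδ0 (by norm_num), min_le_right _ _,
    fun p => if C * varBound p ^ 4 < 1 / 2 then 3 / 2 * (C * varBound p ^ 4) else
      ‖Complex.log (eulerFactor k 0 p)‖ + 1, ?_, ?_⟩
  · have h1 := hsum.mul_left (3 / 2)
    refine h1.congr_cofinite ?_
    have : ∀ᶠ p in cofinite, C * varBound (p : Nat.Primes) ^ 4 < 1 / 2 := by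
      rwa [eventually_cofinite]
    filter_upwards [this] with p hp
    rw [if_pos hp]
  · intro p z hz
    have hz1 : z ∈ ball (0 : Fin (k + k) → ℂ) δ := ball_subset_ball (min_le_left _ _) hz
    have hz2 : z ∈ ball (0 : Fin (k + k) → ℂ) (1 / 10) := ball_subset_ball (min_le_right _ _) hz
    beta_reduce
    split_ifs with hp
    · have h := hE p z hz2
      have hlt : ‖eulerFactor k z p - 1‖ < 1 := by linarith
      have e : eulerFactor k z p = 1 + (eulerFactor k z p - 1) := by ring
      rw [e]
      refine ⟨Complex.mem_slitPlane_of_norm_lt_one hlt, ?_⟩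
      refine (Complex.norm_log_one_add_half_le_self (by linarith)).trans ?_
      gcongr
    · exact hδ z hz1 p hp

/-- The sum over the primes of the logarithms of the Euler factors. -/
noncomputable def logSum (k : ℕ) (z : Fin (k + k) → ℂ) : ℂ :=
  ∑' p : Nat.Primes, Complex.log (eulerFactor k z p)

theorem arithFactor_eq_exp_logSum {k : ℕ} {z : Fin (k + k) → ℂ}
    (h0 : ∀ p : Nat.Primes, eulerFactor k z p ≠ 0)
    (h : Summable fun p : Nat.Primes => Complex.log (eulerFactor k z p)) :
    arithFactor k z = Complex.exp (logSum k z) :=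
  (Complex.cexp_tsum_eq_tprod h0 h).symm

theorem logSum_zero_im (k : ℕ) : (logSum k 0).im = 0 := by
  have h : ∀ p : Nat.Primes, ∃ c : ℝ, Complex.log (eulerFactor k 0 p) = c := by
    intro p
    obtain ⟨c, hc, hceq⟩ := exists_eulerFactor_zero_eq k p.2.two_le
    exact ⟨Real.log c, by rw [hceq, Complex.ofReal_log hc.le]⟩
  choose c hc using h
  rw [logSum]
  simp_rw [hc]
  rw [← Complex.ofReal_tsum, Complex.ofReal_im]

/-- On the ball of `exists_ball_log_eulerFactor` the product is the exponential of the holomorphic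
`logSum`. That sum is real at the origin, so near it no branch of the logarithm is crossed. -/
theorem arithFactor_regular (k : ℕ) :
    (∀ᶠ z in 𝓝 (0 : Fin (k + k) → ℂ),
        Multipliable (fun p : Nat.Primes => eulerFactor k z (p : ℕ))) ∧
      (∀ᶠ z in 𝓝 (0 : Fin (k + k) → ℂ), DifferentiableAt ℂ (arithFactor k) z) ∧
      arithFactor k 0 ∈ Complex.slitPlane ∧
      ∀ᶠ z in 𝓝 (0 : Fin (k + k) → ℂ), Complex.log (arithFactor k z) = logSum k z := by
  obtain ⟨δ, hδ0, hδ1, u, hu, h⟩ := exists_ball_log_eulerFactor k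
  have hball := ball_mem_nhds (0 : Fin (k + k) → ℂ) hδ0
  have hsum : ∀ z ∈ ball (0 : Fin (k + k) → ℂ) δ,
      Summable fun p : Nat.Primes => Complex.log (eulerFactor k z p) := fun z hz =>
    Summable.of_norm_bounded hu fun p => (h p z hz).2
  have hexp : ∀ z ∈ ball (0 : Fin (k + k) → ℂ) δ, arithFactor k z = Complex.exp (logSum k z) :=
    fun z hz => arithFactor_eq_exp_logSum
      (fun p => Complex.slitPlane_ne_zero (h p z hz).1) (hsum z hz)
  have hdiff : ∀ z ∈ ball (0 : Fin (k + k) → ℂ) δ, DifferentiableAt ℂ (logSum k) z := by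
    intro z hz
    refine differentiableAt_tsum_of_norm_le hu (R := δ) ?_ (fun p z hz => (h p z hz).2) hz
    intro p w hw
    exact ((differentiableAt_eulerFactor p.2.two_le (ball_subset_ball hδ1 hw)).clog
      (h p w hw).1).differentiableWithinAt
  refine ⟨?_, ?_, ?_, ?_⟩
  · filter_upwards [hball] with z hz
    exact Complex.multipliable_of_summable_log (hsum z hz)
  · filter_upwards [isOpen_ball.mem_nhds (mem_ball_self hδ0)] with z hz
    have heq : arithFactor k =ᶠ[𝓝 z] fun w => Complex.exp (logSum k w) := by
      filter_upwards [isOpen_ball.mem_nhds hz] with w hw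
      exact hexp w hw
    rw [heq.differentiableAt_iff]
    exact (hdiff z hz).cexp
  · rw [hexp 0 (mem_ball_self hδ0)]
    have : logSum k 0 = ((logSum k 0).re : ℂ) := by
      apply Complex.ext <;> simp [logSum_zero_im]
    rw [this, ← Complex.ofReal_exp]
    exact Complex.ofReal_mem_slitPlane.mpr (Real.exp_pos _)
  · refine eventually_log_eq (hdiff 0 (mem_ball_self hδ0)).continuousAt (logSum_zero_im k) ?_
    filter_upwards [hball] with z hz
    exact hexp z hz

theorem norm_update_zero {n : ℕ} (i : Fin n) (t : ℂ) :
    ‖Function.update (0 : Fin n → ℂ) i t‖ = ‖t‖ := by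
  have : Function.update (0 : Fin n → ℂ) i t = Pi.single i t := rfl
  rw [this, Pi.norm_single]

/-- The coefficient `a_α` with one nonzero entry is the sum over the primes of the Taylor
coefficients of the logarithms of the Euler factors. -/
theorem hasSum_aCoeff_single {k : ℕ} {α : Fin (k + k) → ℕ} {i : Fin (k + k)}
    (h : ∀ j, j ≠ i → α j = 0) :
    HasSum (fun p : Nat.Primes => ((α i).factorial : ℂ)⁻¹ * iteratedDeriv (α i)
      (fun t => Complex.log (eulerFactor k (Function.update 0 i t) p)) 0) (aCoeff k α) := by
  obtain ⟨δ, hδ0, hδ1, u, hu, hE⟩ := exists_ball_log_eulerFactor k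
  have hmem : ∀ t ∈ ball (0 : ℂ) δ, Function.update (0 : Fin (k + k) → ℂ) i t ∈
      ball (0 : Fin (k + k) → ℂ) δ := by
    intro t ht
    rw [mem_ball_zero_iff, norm_update_zero]
    simpa using ht
  rw [aCoeff, taylorCoeff_single h]
  refine HasSum.mul_left _ ?_
  have hcont : Continuous fun t : ℂ => Function.update (0 : Fin (k + k) → ℂ) i t :=
    continuous_const.update i continuous_id
  have heq : (fun t => Complex.log (arithFactor k (Function.update 0 i t))) =ᶠ[𝓝 0]
      fun t => ∑' p : Nat.Primes, Complex.log (eulerFactor k (Function.update 0 i t) p) := by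
    have h1 := (arithFactor_regular k).2.2.2
    have h2 : Tendsto (fun t : ℂ => Function.update (0 : Fin (k + k) → ℂ) i t) (𝓝 0) (𝓝 0) := by
      have := hcont.tendsto 0
      have h0 : Function.update (0 : Fin (k + k) → ℂ) i 0 = 0 := Function.update_eq_self i 0
      rwa [h0] at this
    exact h2.eventually h1
  rw [heq.iteratedDeriv_eq]
  refine hasSum_iteratedDeriv_of_norm_le _ hu hδ0 ?_ (fun p t ht => (hE p _ (hmem t ht)).2)
  intro p t ht
  have hd : DifferentiableAt ℂ (fun t : ℂ => Function.update (0 : Fin (k + k) → ℂ) i t) t := by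
    rw [differentiableAt_pi]
    intro j
    by_cases hj : j = i
    · subst hj; simp
    · simp [hj]
  refine DifferentiableAt.differentiableWithinAt ?_
  refine DifferentiableAt.clog ?_ (hE p _ (hmem t ht)).1
  exact (differentiableAt_eulerFactor p.2.two_le
    (ball_subset_ball hδ1 (hmem t ht))).comp t hd

end ZetaMoment

/-! ### Correlations of divisor sequences, with bounds explicit in k -/

namespace ZetaMoment

theorem succ_mul_multichoose_succ (k n : ℕ) :
    (n + 1) * Nat.multichoose k (n + 1) = (n + k) * Nat.multichoose k n := by
  cases k with
  | zero => cases n <;> simp [Nat.multichoose_zero_succ]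
  | succ k =>
    rw [Nat.multichoose_eq, Nat.multichoose_eq]
    have h1 : k + 1 + (n + 1) - 1 = k + n + 1 := by omega
    have h2 : k + 1 + n - 1 = k + n := by omega
    rw [h1, h2, mul_comm, ← Nat.add_one_mul_choose_eq]
    ring

theorem multichoose_succ_le (k n : ℕ) {K : ℕ} (hk : k ≤ K) (hK : 1 ≤ K) :
    Nat.multichoose k (n + 1) ≤ K * Nat.multichoose k n := by
  have h := succ_mul_multichoose_succ k n
  have h2 : n + k ≤ (n + 1) * K := by nlinarith
  refine Nat.le_of_mul_le_mul_left (c := n + 1) ?_ (Nat.succ_pos n)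
  calc (n + 1) * Nat.multichoose k (n + 1) = (n + k) * Nat.multichoose k n := h
    _ ≤ ((n + 1) * K) * Nat.multichoose k n := Nat.mul_le_mul_right _ h2
    _ = _ := by ring

/-- The sequence `n ↦ d_k(n) r^n`, where `d_k(n)` is the `k`-fold divisor function at `p^n`. -/
noncomputable def mseq (k : ℕ) (r : ℝ) (n : ℕ) : ℝ := Nat.multichoose k n * r ^ n

/-- The correlations of the sequences `mseq κ r` and `mseq (κ + 1) r`. -/
noncomputable def corr (κ : ℕ) (r : ℝ) (m : ℕ) : ℝ := ∑' l, mseq κ r l * mseq (κ + 1) r (m + l)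

section

variable {r : ℝ}

theorem mseq_nonneg (h0 : 0 ≤ r) (k n : ℕ) : 0 ≤ mseq k r n := by unfold mseq; positivity

theorem mseq_zero (k : ℕ) : mseq k r 0 = 1 := by simp [mseq]

theorem summable_mseq (h0 : 0 ≤ r) (h1 : r < 1) (k : ℕ) : Summable (mseq k r) :=
  summable_multichoose_mul_pow k h0 h1

theorem mseq_succ_succ (κ n : ℕ) :
    mseq (κ + 1) r (n + 1) = mseq κ r (n + 1) + r * mseq (κ + 1) r n := by
  simp only [mseq, Nat.multichoose_succ_succ]
  push_cast
  ring

theorem mseq_le_mseq_succ (h0 : 0 ≤ r) (κ n : ℕ) : mseq κ r n ≤ mseq (κ + 1) r n := by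
  cases n with
  | zero => simp [mseq]
  | succ n =>
    rw [mseq_succ_succ]
    exact le_add_of_nonneg_right (mul_nonneg h0 (mseq_nonneg h0 _ _))

theorem mseq_succ_le (h0 : 0 ≤ r) {k K : ℕ} (hk : k ≤ K) (hK : 1 ≤ K) (n : ℕ) :
    mseq k r (n + 1) ≤ K * r * mseq k r n := by
  have h : (Nat.multichoose k (n + 1) : ℝ) ≤ K * Nat.multichoose k n := by
    exact_mod_cast multichoose_succ_le k n hk hK
  unfold mseq
  calc (Nat.multichoose k (n + 1) : ℝ) * r ^ (n + 1)
      ≤ (K * Nat.multichoose k n) * r ^ (n + 1) := by gcongr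
    _ = _ := by ring

theorem summable_mul_of_nonneg {a b : ℕ → ℝ} (ha : Summable a) (hb : Summable b)
    (ha0 : ∀ n, 0 ≤ a n) (hb0 : ∀ n, 0 ≤ b n) : Summable fun n => a n * b n :=
  (ha.mul_of_nonneg hb ha0 hb0).comp_injective (i := fun n : ℕ => (n, n))
    fun _ _ h => congrArg Prod.fst h

theorem summable_mseq_shift (h0 : 0 ≤ r) (h1 : r < 1) (k m : ℕ) :
    Summable fun l => mseq k r (m + l) := by
  simp_rw [add_comm m]
  exact (summable_nat_add_iff m).mpr (summable_mseq h0 h1 k)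

theorem summable_corr (h0 : 0 ≤ r) (h1 : r < 1) (κ m : ℕ) :
    Summable fun l => mseq κ r l * mseq (κ + 1) r (m + l) :=
  summable_mul_of_nonneg (summable_mseq h0 h1 κ) (summable_mseq_shift h0 h1 _ m)
    (mseq_nonneg h0 κ) fun _ => mseq_nonneg h0 _ _

theorem corr_nonneg (h0 : 0 ≤ r) (κ m : ℕ) : 0 ≤ corr κ r m :=
  tsum_nonneg fun _ => mul_nonneg (mseq_nonneg h0 _ _) (mseq_nonneg h0 _ _)

theorem one_le_corr_zero (h0 : 0 ≤ r) (h1 : r < 1) (κ : ℕ) : 1 ≤ corr κ r 0 := by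
  have := (summable_corr h0 h1 κ 0).le_tsum 0
    fun _ _ => mul_nonneg (mseq_nonneg h0 _ _) (mseq_nonneg h0 _ _)
  simpa [mseq_zero, corr] using this

/-- An autocorrelation is largest at lag zero: apply 2xy ≤ x² + y² termwise, and note that the
shifted sum of squares only omits terms. -/
theorem tsum_mseq_mul_shift_le (h0 : 0 ≤ r) (h1 : r < 1) (κ m : ℕ) :
    ∑' l, mseq κ r l * mseq κ r (m + l) ≤ ∑' l, mseq κ r l * mseq κ r l := by
  have hs := summable_mul_of_nonneg (summable_mseq h0 h1 κ) (summable_mseq h0 h1 κ)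
    (mseq_nonneg h0 κ) (mseq_nonneg h0 κ)
  have hs' : Summable fun l => mseq κ r (m + l) * mseq κ r (m + l) := by
    simp_rw [add_comm m]
    exact (summable_nat_add_iff (f := fun l => mseq κ r l * mseq κ r l) m).mpr hs
  have hx := summable_mul_of_nonneg (summable_mseq h0 h1 κ) (summable_mseq_shift h0 h1 κ m)
    (mseq_nonneg h0 κ) fun _ => mseq_nonneg h0 _ _
  have hle : ∑' l, mseq κ r (m + l) * mseq κ r (m + l) ≤ ∑' l, mseq κ r l * mseq κ r l := by
    have := hs.sum_add_tsum_nat_add m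
    simp_rw [add_comm m]
    rw [← this]
    exact le_add_of_nonneg_left (Finset.sum_nonneg fun l _ => mul_self_nonneg _)
  have h := hx.tsum_le_tsum (g := fun l => (1 / 2) * (mseq κ r l * mseq κ r l) +
    (1 / 2) * (mseq κ r (m + l) * mseq κ r (m + l))) (fun l => by
      nlinarith [sq_nonneg (mseq κ r l - mseq κ r (m + l))]) ((hs.mul_left _).add (hs'.mul_left _))
  rw [(hs.mul_left _).tsum_add (hs'.mul_left _), tsum_mul_left, tsum_mul_left] at h
  linarith

/-- The decisive bound, with no loss in κ. Pascal's rule gives c_{m+1} = (autocorrelation of `mseq κ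
r` at lag m+1) + r c_m, and the autocorrelation is at most c_0; the fixed point of x ↦ c_0 + r x is
c_0/(1-r). -/
theorem corr_le_div (h0 : 0 ≤ r) (h1 : r < 1) (κ m : ℕ) :
    corr κ r m ≤ corr κ r 0 / (1 - r) := by
  have hr : 0 < 1 - r := by linarith
  have hc0 := corr_nonneg h0 κ 0
  induction m with
  | zero =>
    rw [le_div_iff₀ hr]
    nlinarith
  | succ m ih =>
    have hx := summable_mul_of_nonneg (summable_mseq h0 h1 κ) (summable_mseq_shift h0 h1 κ (m + 1))
      (mseq_nonneg h0 κ) fun _ => mseq_nonneg h0 _ _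
    have e : corr κ r (m + 1) =
        ∑' l, mseq κ r l * mseq κ r (m + 1 + l) + r * corr κ r m := by
      rw [corr, corr, ← tsum_mul_left, ← hx.tsum_add ((summable_corr h0 h1 κ m).mul_left r)]
      refine tsum_congr fun l => ?_
      rw [show m + 1 + l = m + l + 1 by ring, mseq_succ_succ]
      ring
    have hle : ∑' l, mseq κ r l * mseq κ r (m + 1 + l) ≤ corr κ r 0 := by
      refine (tsum_mseq_mul_shift_le h0 h1 κ (m + 1)).trans ?_
      refine (summable_mul_of_nonneg (summable_mseq h0 h1 κ) (summable_mseq h0 h1 κ)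
        (mseq_nonneg h0 κ) (mseq_nonneg h0 κ)).tsum_le_tsum (fun l => ?_) (summable_corr h0 h1 κ 0)
      rw [zero_add]
      exact mul_le_mul_of_nonneg_left (mseq_le_mseq_succ h0 _ _) (mseq_nonneg h0 _ _)
    rw [e]
    calc _ ≤ corr κ r 0 + r * (corr κ r 0 / (1 - r)) := by gcongr
      _ = _ := by field_simp; ring

theorem corr_succ_le (h0 : 0 ≤ r) (h1 : r < 1) (κ m : ℕ) :
    corr κ r (m + 1) ≤ (κ + 1) * r * corr κ r m := by
  rw [corr, corr, ← tsum_mul_left]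
  refine (summable_corr h0 h1 κ (m + 1)).tsum_le_tsum (fun l => ?_)
    ((summable_corr h0 h1 κ m).mul_left _)
  have h := mseq_succ_le h0 (le_refl (κ + 1)) (by omega) (m + l)
  rw [show m + 1 + l = m + l + 1 by ring]
  push_cast at h
  calc _ ≤ mseq κ r l * ((κ + 1) * r * mseq (κ + 1) r (m + l)) :=
        mul_le_mul_of_nonneg_left h (mseq_nonneg h0 _ _)
    _ = _ := by ring

/-- Complements `corr_le_div`: it depends on κ, but makes the generating function a geometric series
in k r², which is efficient for p much larger than k. -/
theorem corr_le_pow (h0 : 0 ≤ r) (h1 : r < 1) (κ m : ℕ) :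
    corr κ r m ≤ ((κ + 1) * r) ^ m * corr κ r 0 := by
  induction m with
  | zero => simp
  | succ m ih =>
    calc _ ≤ (κ + 1) * r * corr κ r m := corr_succ_le h0 h1 κ m
      _ ≤ (κ + 1) * r * (((κ + 1) * r) ^ m * corr κ r 0) := by gcongr
      _ = _ := by ring

/-- The lag-one correlation is kr c_0 to leading order. The terms l = 0 agree exactly since d_k(p) =
k; each further term loses k²r² from the second sequence and a factor kr from the step l+1 → l in
the first. -/
theorem sub_corr_one_le (h0 : 0 ≤ r) (h1 : r < 1) (κ : ℕ) :
    (κ + 1) * r * corr κ r 0 - corr κ r 1 ≤ (κ + 1) ^ 3 * r ^ 3 * corr κ r 0 := by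
  have hs0 := summable_corr h0 h1 κ 0
  have hs1 := summable_corr h0 h1 κ 1
  have hterm : ∀ l, (κ + 1) * r * mseq (κ + 1) r (l + 1) - mseq (κ + 1) r (l + 2) ≤
      (κ + 1) ^ 2 * r ^ 2 * mseq (κ + 1) r l := by
    intro l
    have h := mseq_succ_le h0 (le_refl (κ + 1)) (by omega) l
    push_cast at h
    calc _ ≤ (κ + 1) * r * mseq (κ + 1) r (l + 1) := sub_le_self _ (mseq_nonneg h0 _ _)
      _ ≤ (κ + 1) * r * ((κ + 1) * r * mseq (κ + 1) r l) := by gcongr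
      _ = _ := by ring
  have hd : Summable fun l => mseq κ r l *
      ((κ + 1) * r * mseq (κ + 1) r l - mseq (κ + 1) r (l + 1)) := by
    refine ((hs0.mul_left ((κ + 1) * r)).sub hs1).congr fun l => ?_
    rw [zero_add, add_comm 1 l]
    ring
  have e : (κ + 1) * r * corr κ r 0 - corr κ r 1 = ∑' l, mseq κ r l *
      ((κ + 1) * r * mseq (κ + 1) r l - mseq (κ + 1) r (l + 1)) := by
    rw [corr, corr, ← tsum_mul_left, ← (hs0.mul_left ((κ + 1) * r)).tsum_sub hs1]
    refine tsum_congr fun l => ?_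
    rw [zero_add, add_comm 1 l]
    ring
  have hz : mseq κ r 0 * ((κ + 1) * r * mseq (κ + 1) r 0 - mseq (κ + 1) r (0 + 1)) = 0 := by
    simp [mseq]
  rw [e, hd.tsum_eq_zero_add, hz, zero_add, corr, ← tsum_mul_left]
  refine ((summable_nat_add_iff 1).mpr hd).tsum_le_tsum (fun l => ?_) (hs0.mul_left _)
  have h2 := mseq_succ_le h0 (Nat.le_succ κ) (by omega) l
  push_cast at h2
  rw [zero_add]
  have h3 : 0 ≤ (κ + 1) ^ 2 * r ^ 2 * mseq (κ + 1) r l :=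
    mul_nonneg (by positivity) (mseq_nonneg h0 _ _)
  calc _ ≤ mseq κ r (l + 1) * ((κ + 1) ^ 2 * r ^ 2 * mseq (κ + 1) r l) :=
        mul_le_mul_of_nonneg_left (hterm l) (mseq_nonneg h0 _ _)
    _ ≤ ((κ + 1) * r * mseq κ r l) * ((κ + 1) ^ 2 * r ^ 2 * mseq (κ + 1) r l) :=
        mul_le_mul_of_nonneg_right h2 h3
    _ = _ := by ring

/-- A weighted sum of the correlations, rearranged along the antidiagonals. -/
theorem tsum_corr_mul (h0 : 0 ≤ r) (h1 : r < 1) (κ : ℕ) {g : ℕ → ℂ}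
    (hg : Summable fun m => ‖g m‖) :
    ∑' n, (∑ ml ∈ Finset.HasAntidiagonal.antidiagonal n, g ml.1 * mseq κ r ml.2) *
      mseq (κ + 1) r n = ∑' m, corr κ r m * g m := by
  -- A uniform bound for the second sequence makes the double series over (m, l) absolutely
  -- convergent, so it may be summed along antidiagonals.
  obtain ⟨M, hM⟩ : ∃ M, ∀ n, mseq (κ + 1) r n ≤ M :=
    ⟨_, fun n => (summable_mseq h0 h1 (κ + 1)).le_tsum n fun _ _ => mseq_nonneg h0 _ _⟩
  set F : ℕ × ℕ → ℂ := fun ml => (g ml.1 * mseq κ r ml.2) * mseq (κ + 1) r (ml.1 + ml.2) with hF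
  have hsF : Summable F := by
    have h2 : Summable fun n => ‖(mseq κ r n : ℂ)‖ := by
      refine (summable_mseq h0 h1 κ).congr fun n => ?_
      rw [Complex.norm_real, Real.norm_of_nonneg (mseq_nonneg h0 _ _)]
    refine Summable.of_norm_bounded ((hg.mul_norm h2).mul_right M) fun ml => ?_
    rw [hF]
    simp only
    rw [norm_mul, Complex.norm_real (mseq (κ + 1) r _), Real.norm_of_nonneg (mseq_nonneg h0 _ _)]
    exact mul_le_mul_of_nonneg_left (hM _) (norm_nonneg _)
  have hL : ∀ n, (∑ ml ∈ Finset.HasAntidiagonal.antidiagonal n, g ml.1 * mseq κ r ml.2) *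
      mseq (κ + 1) r n = ∑' ml : Finset.HasAntidiagonal.antidiagonal n, F ml := by
    intro n
    rw [tsum_fintype, Finset.sum_coe_sort (Finset.HasAntidiagonal.antidiagonal n) F,
      Finset.sum_mul]
    refine Finset.sum_congr rfl fun ml hml => ?_
    rw [hF]
    simp only
    rw [Finset.HasAntidiagonal.mem_antidiagonal.mp hml]
  have hR : ∀ m, (corr κ r m : ℂ) * g m = ∑' l, F (m, l) := by
    intro m
    rw [corr, Complex.ofReal_tsum, ← tsum_mul_right]
    refine tsum_congr fun l => ?_
    rw [hF]
    push_cast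
    ring
  simp_rw [hL, hR]
  rw [← hsF.tsum_prod, ← Finset.HasAntidiagonal.sigmaAntidiagonalEquivProd.tsum_eq F]
  exact ((Finset.HasAntidiagonal.sigmaAntidiagonalEquivProd.summable_iff.mpr hsF).tsum_sigma'
    fun n => (hasSum_fintype _).summable).symm

end

end ZetaMoment

/-! ### The generating function of the correlations on the disc |t| < 1/(1000L) -/

namespace ZetaMoment

open Filter Topology Metric

/-- The generating function of the correlations, `t ↦ ∑ m, c_m (r e^{-Lt})^m`. -/
noncomputable def corrGen (κ : ℕ) (r L : ℝ) (t : ℂ) : ℂ :=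
  ∑' m, corr κ r m * (r * Complex.exp (-(L * t))) ^ m

/-- Cauchy's estimate on the circle of radius R/2; with R = 1/(1000L) it is the source of the factor
(2000L)^N. -/
theorem norm_iteratedDeriv_le_of_ball {f : ℂ → ℂ} {R C : ℝ} (N : ℕ) (hR : 0 < R)
    (hf : DifferentiableOn ℂ f (ball 0 R)) (hC : ∀ z ∈ ball (0 : ℂ) R, ‖f z‖ ≤ C) :
    ‖iteratedDeriv N f 0‖ ≤ N.factorial * C / (R / 2) ^ N := by
  have hsub : closedBall (0 : ℂ) (R / 2) ⊆ ball 0 R := closedBall_subset_ball (by linarith)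
  refine Complex.norm_iteratedDeriv_le_of_forall_mem_sphere_norm_le N (half_pos hR) ?_ ?_
  · refine DifferentiableOn.diffContOnCl ?_
    rw [closure_ball _ (half_pos hR).ne']
    exact hf.mono hsub
  · exact fun z hz => hC z (hsub (sphere_subset_closedBall hz))

theorem contDiffAt_of_differentiableOn_ball {f : ℂ → ℂ} {R : ℝ} (hR : 0 < R)
    (hf : DifferentiableOn ℂ f (ball 0 R)) (N : ℕ) : ContDiffAt ℂ N f 0 :=
  (hf.analyticAt (ball_mem_nhds 0 hR)).contDiffAt

section

variable {r L : ℝ}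

theorem norm_exp_neg_le (hL : 0 < L) {t : ℂ} (ht : t ∈ ball (0 : ℂ) (1 / 1000 / L)) :
    ‖Complex.exp (-(L * t))‖ ≤ 1002 / 1000 := by
  have h1 : ‖-(L * t : ℂ)‖ ≤ 1 / 1000 := by
    rw [norm_neg, norm_mul, Complex.norm_real, Real.norm_of_nonneg hL.le]
    rw [mem_ball_zero_iff, lt_div_iff₀ hL] at ht
    linarith
  have h2 := Complex.norm_exp_sub_one_le (h1.trans (by norm_num))
  have h3 := norm_sub_norm_le (Complex.exp (-(L * t))) 1
  rw [norm_one] at h3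
  linarith

theorem norm_exp_neg_pow_sub_one_le (hL : 0 < L) {t : ℂ} (ht : t ∈ ball (0 : ℂ) (1 / 1000 / L))
    (m : ℕ) : ‖Complex.exp (-(L * t)) ^ m - 1‖ ≤ 2 / 1000 * (m * (1002 / 1000) ^ m) := by
  have h0 := norm_exp_neg_le hL ht
  have h1 : ‖-(L * t : ℂ)‖ ≤ 1 / 1000 := by
    rw [norm_neg, norm_mul, Complex.norm_real, Real.norm_of_nonneg hL.le]
    rw [mem_ball_zero_iff, lt_div_iff₀ hL] at ht
    linarith
  have h2 := Complex.norm_exp_sub_one_le (h1.trans (by norm_num))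
  set w := Complex.exp (-(L * t))
  induction m with
  | zero => simp
  | succ m ih =>
    have e : w ^ (m + 1) - 1 = w * (w ^ m - 1) + (w - 1) := by ring
    rw [e]
    have h3 : (1 : ℝ) ≤ (1002 / 1000) ^ (m + 1) := one_le_pow₀ (by norm_num)
    calc _ ≤ ‖w‖ * ‖w ^ m - 1‖ + ‖w - 1‖ := by
          refine (norm_add_le _ _).trans ?_
          rw [norm_mul]
      _ ≤ 1002 / 1000 * (2 / 1000 * (m * (1002 / 1000) ^ m)) + 2 / 1000 * 1 := by
          gcongr
          linarith
      _ ≤ 1002 / 1000 * (2 / 1000 * (m * (1002 / 1000) ^ m)) +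
          2 / 1000 * (1002 / 1000) ^ (m + 1) := by gcongr
      _ = _ := by push_cast; ring

theorem le_of_sq_le_half (hr : r ^ 2 ≤ 1 / 2) : r ≤ 7072 / 10000 := by
  by_contra! h
  nlinarith

/-- The disc is so small that even for p = 2, where r = 1/√2 < 0.7072, the argument stays below
0.7072 · 1.002 < 0.71. -/
theorem norm_corrGen_arg_le (h0 : 0 ≤ r) (hr : r ^ 2 ≤ 1 / 2) (hL : 0 < L) {t : ℂ}
    (ht : t ∈ ball (0 : ℂ) (1 / 1000 / L)) :
    ‖(r * Complex.exp (-(L * t)) : ℂ)‖ ≤ 71 / 100 := by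
  rw [norm_mul, Complex.norm_real, Real.norm_of_nonneg h0]
  calc _ ≤ 7072 / 10000 * (1002 / 1000) :=
        mul_le_mul (le_of_sq_le_half hr) (norm_exp_neg_le hL ht) (norm_nonneg _) (by norm_num)
    _ ≤ _ := by norm_num

theorem lt_one_of_sq_le_half (hr : r ^ 2 ≤ 1 / 2) : r < 1 :=
  (le_of_sq_le_half hr).trans_lt (by norm_num)

theorem norm_corrGen_term_le (h0 : 0 ≤ r) (hr : r ^ 2 ≤ 1 / 2) (hL : 0 < L) (κ m : ℕ) {t : ℂ}
    (ht : t ∈ ball (0 : ℂ) (1 / 1000 / L)) :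
    ‖(corr κ r m : ℂ) * (r * Complex.exp (-(L * t))) ^ m‖ ≤
      corr κ r 0 / (1 - r) * (71 / 100) ^ m := by
  rw [norm_mul, Complex.norm_real, Real.norm_of_nonneg (corr_nonneg h0 _ _), norm_pow]
  have h1 := lt_one_of_sq_le_half hr
  have h2 : 0 ≤ corr κ r 0 / (1 - r) := div_nonneg (corr_nonneg h0 _ _) (by linarith)
  exact mul_le_mul (corr_le_div h0 h1 κ m)
    (pow_le_pow_left₀ (norm_nonneg _) (norm_corrGen_arg_le h0 hr hL ht) m) (by positivity) h2

theorem summable_corrGen_bound (κ : ℕ) (r : ℝ) :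
    Summable fun m : ℕ => corr κ r 0 / (1 - r) * (71 / 100 : ℝ) ^ m :=
  (summable_geometric_of_lt_one (by norm_num) (by norm_num)).mul_left _

theorem summable_corrGen (h0 : 0 ≤ r) (hr : r ^ 2 ≤ 1 / 2) (hL : 0 < L) (κ : ℕ) {t : ℂ}
    (ht : t ∈ ball (0 : ℂ) (1 / 1000 / L)) :
    Summable fun m => (corr κ r m : ℂ) * (r * Complex.exp (-(L * t))) ^ m :=
  Summable.of_norm_bounded (summable_corrGen_bound κ r)
    fun m => norm_corrGen_term_le h0 hr hL κ m ht

theorem differentiableOn_corrGen (h0 : 0 ≤ r) (hr : r ^ 2 ≤ 1 / 2) (hL : 0 < L) (κ : ℕ) :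
    DifferentiableOn ℂ (corrGen κ r L) (ball 0 (1 / 1000 / L)) := by
  intro t ht
  refine DifferentiableAt.differentiableWithinAt ?_
  refine differentiableAt_tsum_of_norm_le (summable_corrGen_bound κ r) ?_
    (fun m t ht => norm_corrGen_term_le h0 hr hL κ m ht) ht
  intro m
  fun_prop

theorem corrGen_zero (κ : ℕ) : corrGen κ r L 0 = ((∑' m, corr κ r m * r ^ m : ℝ) : ℂ) := by
  simp [corrGen, Complex.ofReal_tsum]

theorem corr_zero_le_tsum (h0 : 0 ≤ r) (hr : r ^ 2 ≤ 1 / 2) (κ : ℕ) :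
    corr κ r 0 ≤ ∑' m, corr κ r m * r ^ m := by
  have hs := summable_corrGen h0 hr one_pos κ (t := 0) (mem_ball_self (by norm_num))
  have hs' : Summable fun m => corr κ r m * r ^ m := by
    have : Summable fun m => ((corr κ r m * r ^ m : ℝ) : ℂ) := by simpa using hs
    exact_mod_cast this
  have := hs'.le_tsum 0 fun m _ => mul_nonneg (corr_nonneg h0 _ _) (pow_nonneg h0 m)
  simpa using this

theorem tsum_corr_mul_pow_pos (h0 : 0 ≤ r) (hr : r ^ 2 ≤ 1 / 2) (κ : ℕ) :
    0 < ∑' m, corr κ r m * r ^ m :=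
  (zero_lt_one.trans_le (one_le_corr_zero h0 (lt_one_of_sq_le_half hr) κ)).trans_le
    (corr_zero_le_tsum h0 hr κ)

/-- Each difference carries |w^m - 1| = O(m · 1.002^m / 1000), and `corr_le_div` reduces the sum to
∑ m q^m = q/(1-q)² with q = 1.002 r. The gain is the factor r; the dependence on κ is confined to
c_0. -/
theorem norm_corrGen_sub_le (h0 : 0 ≤ r) (hr : r ^ 2 ≤ 1 / 2) (hL : 0 < L) (κ : ℕ) {t : ℂ}
    (ht : t ∈ ball (0 : ℂ) (1 / 1000 / L)) :
    ‖corrGen κ r L t - corrGen κ r L 0‖ ≤ corr κ r 0 * (r / 2) := by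
  have hrle := le_of_sq_le_half hr
  have h1 := lt_one_of_sq_le_half hr
  have hR : 0 < 1 / 1000 / L := by positivity
  have hc0 := corr_nonneg h0 κ 0
  set q : ℝ := r * (1002 / 1000) with hq
  have hq0 : 0 ≤ q := by positivity
  have hq1 : q ≤ 71 / 100 := by rw [hq]; nlinarith
  have hqn : ‖q‖ < 1 := by
    rw [Real.norm_of_nonneg hq0]
    linarith
  rw [corrGen, corrGen, ← (summable_corrGen h0 hr hL κ ht).tsum_sub
    (summable_corrGen h0 hr hL κ (mem_ball_self hR))]
  have hsq : HasSum (fun m : ℕ => corr κ r 0 / (1 - r) * (2 / 1000) * (m * q ^ m))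
      (corr κ r 0 / (1 - r) * (2 / 1000) * (q / (1 - q) ^ 2)) :=
    (hasSum_coe_mul_geometric_of_norm_lt_one hqn).mul_left _
  refine (tsum_of_norm_bounded hsq fun m => ?_).trans ?_
  · have e : (corr κ r m : ℂ) * (r * Complex.exp (-(L * t))) ^ m -
        corr κ r m * (r * Complex.exp (-(L * 0))) ^ m =
        corr κ r m * (r ^ m * (Complex.exp (-(L * t)) ^ m - 1)) := by
      simp
      ring
    rw [e, norm_mul, norm_mul, norm_pow, Complex.norm_real, Complex.norm_real,
      Real.norm_of_nonneg (corr_nonneg h0 _ _), Real.norm_of_nonneg h0]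
    have h2 : 0 ≤ corr κ r 0 / (1 - r) := div_nonneg hc0 (by linarith)
    calc _ ≤ corr κ r 0 / (1 - r) * (r ^ m * (2 / 1000 * (m * (1002 / 1000) ^ m))) := by
          refine mul_le_mul (corr_le_div h0 h1 κ m) ?_ (by positivity) h2
          exact mul_le_mul_of_nonneg_left (norm_exp_neg_pow_sub_one_le hL ht m) (by positivity)
      _ = _ := by rw [hq, mul_pow]; ring
  -- From r ≤ 0.7072 and q ≤ 0.71: 1/(1-r) ≤ 3.42 and 1/(1-q)² ≤ 12. The small radius keeps the
  -- resulting constant below 1/2.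
  · have h3 : corr κ r 0 / (1 - r) ≤ corr κ r 0 * (342 / 100) := by
      rw [div_le_iff₀ (by linarith)]
      nlinarith
    have h4 : q / (1 - q) ^ 2 ≤ q * 12 := by
      rw [div_le_iff₀ (by nlinarith)]
      have : 1 ≤ 12 * (1 - q) ^ 2 := by nlinarith
      nlinarith
    calc _ ≤ corr κ r 0 * (342 / 100) * (2 / 1000) * (q * 12) := by gcongr
      _ ≤ _ := by
        rw [hq]
        nlinarith [mul_nonneg hc0 h0]

/-- Dividing by G(0) ≥ c_0 removes the last dependence on κ. -/
theorem norm_corrGen_div_sub_one_le (h0 : 0 ≤ r) (hr : r ^ 2 ≤ 1 / 2) (hL : 0 < L) (κ : ℕ) {t : ℂ}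
    (ht : t ∈ ball (0 : ℂ) (1 / 1000 / L)) :
    ‖corrGen κ r L t / (∑' m, corr κ r m * r ^ m : ℝ) - 1‖ ≤ r / 2 := by
  have hpos := tsum_corr_mul_pow_pos h0 hr κ
  have hne : ((∑' m, corr κ r m * r ^ m : ℝ) : ℂ) ≠ 0 := Complex.ofReal_ne_zero.mpr hpos.ne'
  rw [div_sub_one hne, norm_div, Complex.norm_real, Real.norm_of_nonneg hpos.le,
    div_le_iff₀ hpos, ← corrGen_zero (L := L)]
  refine (norm_corrGen_sub_le h0 hr hL κ ht).trans ?_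
  rw [mul_comm]
  exact mul_le_mul_of_nonneg_left (corr_zero_le_tsum h0 hr κ) (by positivity)

theorem corrGen_div_mem_slitPlane (h0 : 0 ≤ r) (hr : r ^ 2 ≤ 1 / 2) (hL : 0 < L) (κ : ℕ) {t : ℂ}
    (ht : t ∈ ball (0 : ℂ) (1 / 1000 / L)) :
    corrGen κ r L t / (∑' m, corr κ r m * r ^ m : ℝ) ∈ Complex.slitPlane := by
  have h := norm_corrGen_div_sub_one_le h0 hr hL κ ht
  have h1 := lt_one_of_sq_le_half hr
  have := Complex.mem_slitPlane_of_norm_lt_one (z := corrGen κ r L t /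
    (∑' m, corr κ r m * r ^ m : ℝ) - 1) (by linarith)
  simpa using this

/-- The error for small primes. It does not involve κ, although the number of variables grows. -/
theorem norm_iteratedDeriv_log_corrGen_le (h0 : 0 ≤ r) (hr : r ^ 2 ≤ 1 / 2) (hL : 0 < L)
    (κ N : ℕ) :
    ‖iteratedDeriv N
      (fun t => Complex.log (corrGen κ r L t / (∑' m, corr κ r m * r ^ m : ℝ))) 0‖ ≤
      N.factorial * r * (2000 * L) ^ N := by
  have h1 := lt_one_of_sq_le_half hr
  have h := norm_iteratedDeriv_le_of_ball (C := r) N (R := 1 / 1000 / L)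
    (f := fun t => Complex.log (corrGen κ r L t / (∑' m, corr κ r m * r ^ m : ℝ)))
    (by positivity) ?_ ?_
  · refine h.trans_eq ?_
    rw [div_eq_mul_inv, ← inv_pow]
    congr 2
    field_simp
    norm_num
  · exact ((differentiableOn_corrGen h0 hr hL κ).div_const _).clog
      fun t ht => corrGen_div_mem_slitPlane h0 hr hL κ ht
  · intro t ht
    have hle := norm_corrGen_div_sub_one_le h0 hr hL κ ht
    have := Complex.norm_log_one_add_half_le_self (hle.trans (by linarith))
    rw [add_sub_cancel] at this
    linarith

theorem norm_sq_mul_exp_le (hL : 0 < L) {t : ℂ}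
    (ht : t ∈ ball (0 : ℂ) (1 / 1000 / L)) :
    ‖(r ^ 2 * Complex.exp (-(L * t)) : ℂ)‖ ≤ 1002 / 1000 * r ^ 2 := by
  rw [norm_mul, norm_pow, Complex.norm_real, Real.norm_eq_abs, sq_abs, mul_comm]
  exact mul_le_mul_of_nonneg_right (norm_exp_neg_le hL ht) (sq_nonneg _)

theorem one_sub_mem_slitPlane (hr : r ^ 2 ≤ 1 / 2) (hL : 0 < L) {t : ℂ}
    (ht : t ∈ ball (0 : ℂ) (1 / 1000 / L)) :
    1 - r ^ 2 * Complex.exp (-(L * t)) ∈ Complex.slitPlane := by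
  rw [sub_eq_add_neg]
  refine Complex.mem_slitPlane_of_norm_lt_one ?_
  rw [norm_neg]
  linarith [norm_sq_mul_exp_le (r := r) hL ht]

theorem differentiableOn_log_one_sub (hr : r ^ 2 ≤ 1 / 2) (hL : 0 < L) :
    DifferentiableOn ℂ (fun t => Complex.log (1 - r ^ 2 * Complex.exp (-(L * t))))
      (ball 0 (1 / 1000 / L)) :=
  DifferentiableOn.clog (by fun_prop) fun _ ht => one_sub_mem_slitPlane hr hL ht

/-- The Taylor coefficients of `log (1 - r² e^{-Lt})`. -/
theorem iteratedDeriv_log_one_sub (hr : r ^ 2 ≤ 1 / 2) (hL : 0 < L) (N : ℕ) :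
    iteratedDeriv (N + 1) (fun t => Complex.log (1 - r ^ 2 * Complex.exp (-(L * t)))) 0 =
      (((-1) ^ N * L ^ (N + 1) * ∑' n : ℕ, ((n : ℝ) + 1) ^ N * (r ^ 2) ^ (n + 1) : ℝ) : ℂ) := by
  have hR : 0 < 1 / 1000 / L := by positivity
  have heq : (fun t => Complex.log (1 - r ^ 2 * Complex.exp (-(L * t)))) =ᶠ[𝓝 0]
      fun t => ∑' n : ℕ, -((r ^ 2 * Complex.exp (-(L * t))) ^ (n + 1) / (n + 1)) := by
    filter_upwards [ball_mem_nhds (0 : ℂ) hR] with t ht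
    have h := Complex.hasSum_taylorSeries_neg_log' (z := r ^ 2 * Complex.exp (-(L * t)))
      (by linarith [norm_sq_mul_exp_le (r := r) hL ht])
    rw [tsum_neg, h.tsum_eq, neg_neg]
  rw [heq.iteratedDeriv_eq, ← (hasSum_iteratedDeriv_of_norm_le (N + 1)
    (u := fun n => (501 / 1000 : ℝ) ^ (n + 1)) ?_ hR ?_ ?_).tsum_eq]
  · push_cast
    rw [← tsum_mul_left]
    refine tsum_congr fun n => ?_
    have hn : ((n : ℂ) + 1) ≠ 0 := by exact_mod_cast Nat.succ_ne_zero n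
    have e : (fun t : ℂ => -(((r : ℂ) ^ 2 * Complex.exp (-(L * t))) ^ (n + 1) / (n + 1))) =
        fun t => (-(((r : ℂ) ^ 2) ^ (n + 1) / (n + 1))) *
          Complex.exp ((-(((n : ℂ) + 1) * L)) * t) := by
      funext t
      rw [mul_pow, ← Complex.exp_nat_mul]
      push_cast
      ring_nf
    rw [e, iteratedDeriv_const_mul_field, iteratedDeriv_cexp_const_mul]
    simp only [mul_zero, Complex.exp_zero, mul_one]
    rw [neg_pow, mul_pow, pow_succ ((n : ℂ) + 1) N, pow_succ (-1 : ℂ) N]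
    field_simp
  · exact (summable_nat_add_iff 1).mpr
      (summable_geometric_of_lt_one (by norm_num) (by norm_num))
  · intro n
    fun_prop
  · intro n t ht
    have h1 : ‖(r ^ 2 * Complex.exp (-(L * t)) : ℂ)‖ ≤ 501 / 1000 := by
      linarith [norm_sq_mul_exp_le (r := r) hL ht]
    rw [norm_neg, norm_div, norm_pow]
    have h2 : (1 : ℝ) ≤ ‖((n : ℂ) + 1)‖ := by
      have : ((n : ℂ) + 1) = ((n + 1 : ℕ) : ℂ) := by push_cast; rfl
      rw [this, Complex.norm_natCast]
      exact_mod_cast Nat.succ_le_succ (Nat.zero_le n)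
    exact (div_le_self (by positivity) h2).trans (pow_le_pow_left₀ (norm_nonneg _) h1 _)

/-- For small `k r²` the logarithm of the Euler factor is small. -/
theorem norm_log_add_log_corrGen_le (h0 : 0 ≤ r) (hL : 0 < L) {κ : ℕ}
    (hy : ((κ : ℝ) + 1) * r ^ 2 ≤ 1 / 10) {t : ℂ} (ht : t ∈ ball (0 : ℂ) (1 / 1000 / L)) :
    ‖corrGen κ r L t / corr κ r 0 - 1‖ ≤ 1 / 2 ∧
    ‖(κ + 1) * Complex.log (1 - r ^ 2 * Complex.exp (-(L * t))) +
      Complex.log (corrGen κ r L t / corr κ r 0)‖ ≤ 6 * ((κ + 1) ^ 3 * r ^ 4) := by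
  have hk : (1 : ℝ) ≤ (κ : ℝ) + 1 := by
    have : (0 : ℝ) ≤ κ := Nat.cast_nonneg κ
    linarith
  have hr2 : r ^ 2 ≤ 1 / 10 := by nlinarith [sq_nonneg r]
  have hr : r ^ 2 ≤ 1 / 2 := by linarith
  have h1 := lt_one_of_sq_le_half hr
  have hc := one_le_corr_zero h0 h1 κ
  have hcpos : 0 < corr κ r 0 := by linarith
  have hcne : (corr κ r 0 : ℂ) ≠ 0 := Complex.ofReal_ne_zero.mpr hcpos.ne'
  have hw := norm_exp_neg_le hL ht
  have hs := summable_corrGen h0 hr hL κ ht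
  have hx := norm_sq_mul_exp_le (r := r) hL ht
  set w := Complex.exp (-(L * t)) with hwdef
  set k : ℝ := (κ : ℝ) + 1 with hkdef
  set y : ℝ := k * r ^ 2 with hydef
  have hy0 : 0 ≤ y := by positivity
  have hyk : y ^ 2 ≤ k ^ 3 * r ^ 4 := by
    rw [hydef, mul_pow, ← pow_mul]
    have : k ^ 2 ≤ k ^ 3 := pow_le_pow_right₀ hk (by norm_num)
    gcongr
  have hkr : 0 ≤ k ^ 3 * r ^ 4 := by positivity
  set v : ℂ := corr κ r 1 / corr κ r 0 * (r * w) with hv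
  have hdecomp : corrGen κ r L t / corr κ r 0 = 1 + v +
      (∑' m, (corr κ r (m + 2) : ℂ) * (r * w) ^ (m + 2)) / corr κ r 0 := by
    rw [corrGen, ← hs.sum_add_tsum_nat_add 2, Finset.sum_range_succ, Finset.sum_range_one, hv]
    field_simp
  set T : ℂ := (∑' m, (corr κ r (m + 2) : ℂ) * (r * w) ^ (m + 2)) / corr κ r 0 with hT
  -- By `corr_le_pow` the terms with m ≥ 2 are dominated by a geometric series with first term of
  -- order y² and ratio 1.002 y ≤ 0.1002.
  have hTle : ‖T‖ ≤ 12 / 10 * y ^ 2 := by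
    rw [hT, norm_div, Complex.norm_real, Real.norm_of_nonneg hcpos.le, div_le_iff₀ hcpos]
    have hg : HasSum (fun m : ℕ => (1002 / 1000 * y) ^ 2 * corr κ r 0 * (1002 / 10000 : ℝ) ^ m)
        ((1002 / 1000 * y) ^ 2 * corr κ r 0 * (1 - 1002 / 10000)⁻¹) :=
      (hasSum_geometric_of_lt_one (by norm_num) (by norm_num)).mul_left _
    refine (tsum_of_norm_bounded hg fun m => ?_).trans ?_
    · rw [norm_mul, norm_pow, norm_mul, Complex.norm_real, Complex.norm_real,
        Real.norm_of_nonneg (corr_nonneg h0 _ _), Real.norm_of_nonneg h0]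
      calc _ ≤ ((k * r) ^ (m + 2) * corr κ r 0) * (r * (1002 / 1000)) ^ (m + 2) := by
            refine mul_le_mul (corr_le_pow h0 h1 κ _) ?_ (by positivity) (by positivity)
            gcongr
        _ = (1002 / 1000 * y) ^ 2 * corr κ r 0 * (1002 / 1000 * y) ^ m := by rw [hydef]; ring_nf
        _ ≤ _ := by
          gcongr
          linarith
    · have hyc : 0 ≤ y ^ 2 * corr κ r 0 := by positivity
      have hinv : (1 - 1002 / 10000 : ℝ)⁻¹ ≤ 112 / 100 := by norm_num
      calc _ ≤ (1002 / 1000 * y) ^ 2 * corr κ r 0 * (112 / 100) := by gcongr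
        _ ≤ _ := by nlinarith
  have hvle : ‖v‖ ≤ 1002 / 1000 * y := by
    rw [hv, norm_mul, norm_mul, norm_div, Complex.norm_real, Complex.norm_real, Complex.norm_real,
      Real.norm_of_nonneg hcpos.le, Real.norm_of_nonneg (corr_nonneg h0 _ _),
      Real.norm_of_nonneg h0]
    have : corr κ r 1 / corr κ r 0 ≤ k * r := by
      rw [div_le_iff₀ hcpos]
      simpa using corr_le_pow h0 h1 κ 1
    calc _ ≤ (k * r) * (r * (1002 / 1000)) := by gcongr
      _ = _ := by rw [hydef]; ring
  -- `sub_corr_one_le` enters here: replacing c_1/c_0 by kr costs k³r³, and v has one more factor r.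
  have hvy : ‖v - y * w‖ ≤ 1002 / 1000 * (k ^ 3 * r ^ 4) := by
    have e : v - y * w = -((((k * r * corr κ r 0 - corr κ r 1) / corr κ r 0 * r : ℝ) : ℂ) * w) := by
      rw [hv, hydef]
      push_cast
      field_simp
      ring
    have hle := sub_corr_one_le h0 h1 κ
    have hge : 0 ≤ k * r * corr κ r 0 - corr κ r 1 := by
      have := corr_le_pow h0 h1 κ 1
      simp only [pow_one] at this
      linarith
    rw [e, norm_neg, norm_mul, Complex.norm_real, Real.norm_of_nonneg (by positivity)]
    have : (k * r * corr κ r 0 - corr κ r 1) / corr κ r 0 ≤ k ^ 3 * r ^ 3 := by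
      rw [div_le_iff₀ hcpos]
      exact hle
    calc _ ≤ (k ^ 3 * r ^ 3) * r * (1002 / 1000) := by gcongr
      _ = _ := by ring
  have hu : corrGen κ r L t / corr κ r 0 = 1 + (v + T) := by rw [hdecomp]; ring
  have hule : ‖v + T‖ ≤ 113 / 100 * y := by
    refine (norm_add_le _ _).trans ?_
    nlinarith
  have huhalf : ‖v + T‖ ≤ 1 / 2 := by linarith
  refine ⟨by rw [hu, add_sub_cancel_left]; exact huhalf, ?_⟩
  have hlog : ‖Complex.log (1 + (v + T)) - (v + T)‖ ≤ 13 / 10 * y ^ 2 := by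
    refine (Complex.norm_log_one_add_sub_self_le (by linarith)).trans ?_
    have hinv : (1 - ‖v + T‖)⁻¹ ≤ 2 := by
      rw [inv_le_comm₀ (by linarith) (by norm_num)]
      linarith
    have hinv0 : 0 ≤ (1 - ‖v + T‖)⁻¹ := inv_nonneg.mpr (by linarith)
    calc _ ≤ (113 / 100 * y) ^ 2 * 2 / 2 := by gcongr
      _ ≤ _ := by nlinarith [sq_nonneg y]
  have hlog2 : ‖Complex.log (1 - r ^ 2 * w) + r ^ 2 * w‖ ≤ 11 / 10 * r ^ 4 := by
    have hx' : ‖-(r ^ 2 * w : ℂ)‖ ≤ 1002 / 1000 * r ^ 2 := by rwa [norm_neg]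
    have h := Complex.norm_log_one_add_sub_self_le (z := -(r ^ 2 * w)) (by linarith)
    rw [sub_neg_eq_add, ← sub_eq_add_neg] at h
    refine h.trans ?_
    have hinv : (1 - ‖-(r ^ 2 * w : ℂ)‖)⁻¹ ≤ 2 := by
      rw [inv_le_comm₀ (by linarith) (by norm_num)]
      linarith
    have hinv0 : 0 ≤ (1 - ‖-(r ^ 2 * w : ℂ)‖)⁻¹ := inv_nonneg.mpr (by linarith)
    calc _ ≤ (1002 / 1000 * r ^ 2) ^ 2 * 2 / 2 := by gcongr
      _ ≤ _ := by nlinarith [sq_nonneg (r ^ 2)]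
  -- The first-order terms -k r² w and y w cancel because y = k r². What remains is second order,
  -- and y² ≤ k³r⁴.
  have hfinal : (κ + 1) * Complex.log (1 - r ^ 2 * w) + Complex.log (corrGen κ r L t / corr κ r 0) =
      (k : ℂ) * (Complex.log (1 - r ^ 2 * w) + r ^ 2 * w) +
        (Complex.log (1 + (v + T)) - (v + T)) + (v - y * w) + T := by
    rw [hu, hydef, hkdef]
    push_cast
    ring
  rw [hfinal]
  have hkn : ‖(k : ℂ)‖ = k := by rw [Complex.norm_real, Real.norm_of_nonneg (by linarith)]
  have hk3 : k * r ^ 4 ≤ k ^ 3 * r ^ 4 := by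
    have : k ≤ k ^ 3 := le_self_pow₀ hk (by norm_num)
    gcongr
  calc _ ≤ ‖(k : ℂ) * (Complex.log (1 - r ^ 2 * w) + r ^ 2 * w)‖ +
        ‖Complex.log (1 + (v + T)) - (v + T)‖ + ‖v - y * w‖ + ‖T‖ := norm_add₄_le
    _ ≤ k * (11 / 10 * r ^ 4) + 13 / 10 * y ^ 2 + 1002 / 1000 * (k ^ 3 * r ^ 4) +
        12 / 10 * y ^ 2 := by
        rw [norm_mul, hkn]
        gcongr
    _ ≤ _ := by linarith

theorem norm_iteratedDeriv_log_add_log_corrGen_le (h0 : 0 ≤ r) (hL : 0 < L) {κ : ℕ}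
    (hy : ((κ : ℝ) + 1) * r ^ 2 ≤ 1 / 10) (N : ℕ) :
    ‖iteratedDeriv N (fun t => (κ + 1) * Complex.log (1 - r ^ 2 * Complex.exp (-(L * t))) +
      Complex.log (corrGen κ r L t / corr κ r 0)) 0‖ ≤
      N.factorial * (6 * ((κ + 1) ^ 3 * r ^ 4)) * (2000 * L) ^ N := by
  have hk : (1 : ℝ) ≤ (κ : ℝ) + 1 := by
    have : (0 : ℝ) ≤ κ := Nat.cast_nonneg κ
    linarith
  have hr2 : r ^ 2 ≤ 1 / 10 := by nlinarith [sq_nonneg r]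
  have hr : r ^ 2 ≤ 1 / 2 := by linarith
  have h := norm_iteratedDeriv_le_of_ball (C := 6 * ((κ + 1) ^ 3 * r ^ 4)) N (R := 1 / 1000 / L)
    (f := fun t => (κ + 1) * Complex.log (1 - r ^ 2 * Complex.exp (-(L * t))) +
      Complex.log (corrGen κ r L t / corr κ r 0))
    (by positivity) ?_ ?_
  · refine h.trans_eq ?_
    rw [div_eq_mul_inv, ← inv_pow]
    congr 2
    field_simp
    norm_num
  · refine ((differentiableOn_log_one_sub hr hL).const_mul _).add ?_
    refine ((differentiableOn_corrGen h0 hr hL κ).div_const _).clog fun t ht => ?_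
    have := Complex.mem_slitPlane_of_norm_lt_one (z := corrGen κ r L t / corr κ r 0 - 1)
      ((norm_log_add_log_corrGen_le h0 hL hy ht).1.trans_lt (by norm_num))
    simpa using this
  · exact fun t ht => (norm_log_add_log_corrGen_le h0 hL hy ht).2

end

end ZetaMoment

/-! ### The Euler factor along a coordinate axis -/

namespace ZetaMoment

open Filter Topology Metric

/-- `p^(-1/2)`. -/
noncomputable def primeRoot (p : ℕ) : ℝ := (p : ℝ) ^ (-(1 / 2) : ℝ)

theorem primeRoot_nonneg (p : ℕ) : 0 ≤ primeRoot p := by unfold primeRoot; positivity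

theorem primeRoot_sq (p : ℕ) : primeRoot p ^ 2 = 1 / (p : ℝ) := by
  rw [primeRoot, ← Real.rpow_natCast, ← Real.rpow_mul (by positivity)]
  norm_num [Real.rpow_neg_one]

theorem primeRoot_sq_le {p : ℕ} (hp : 2 ≤ p) : primeRoot p ^ 2 ≤ 1 / 2 := by
  rw [primeRoot_sq]
  have : (2 : ℝ) ≤ p := by exact_mod_cast hp
  gcongr

theorem log_pos_of_two_le {p : ℕ} (hp : 2 ≤ p) : 0 < Real.log p :=
  Real.log_pos (by exact_mod_cast (by omega : 1 < p))

theorem natCast_cpow_primeRoot {p : ℕ} (hp : 2 ≤ p) (t : ℂ) :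
    (p : ℂ) ^ (-(1 / 2) - t) = primeRoot p * Complex.exp (-(Real.log p * t)) := by
  have hp' : (p : ℂ) ≠ 0 := by exact_mod_cast (by omega : p ≠ 0)
  rw [sub_eq_add_neg, Complex.cpow_add _ _ hp', primeRoot, Complex.ofReal_cpow (by positivity),
    Complex.cpow_def_of_ne_zero hp' (-t), Complex.natCast_log]
  push_cast
  ring_nf

theorem leftVar_update_castAdd {k p : ℕ} (hp : 2 ≤ p) (i : Fin k) (t : ℂ) :
    leftVar (Function.update 0 (Fin.castAdd k i) t) p =
      Function.update (fun _ => (primeRoot p : ℂ)) i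
        (primeRoot p * Complex.exp (-(Real.log p * t))) := by
  funext j
  rw [leftVar]
  by_cases hj : j = i
  · subst hj
    simp only [Function.update_self]
    rw [natCast_cpow_primeRoot hp]
  · have : Fin.castAdd k j ≠ Fin.castAdd k i := fun h => hj (Fin.castAdd_injective _ _ h)
    rw [Function.update_of_ne hj, Function.update_of_ne this]
    simpa using natCast_cpow_primeRoot hp 0

theorem rightVar_update_castAdd {k p : ℕ} (hp : 2 ≤ p) (i : Fin k) (t : ℂ) :
    rightVar (Function.update 0 (Fin.castAdd k i) t) p = fun _ => (primeRoot p : ℂ) := by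
  funext j
  have : Fin.natAdd k j ≠ Fin.castAdd k i := by
    intro h
    have := congrArg Fin.val h
    simp at this
    omega
  rw [rightVar, Function.update_of_ne this]
  simpa using natCast_cpow_primeRoot hp 0

theorem leftVar_update_natAdd {k p : ℕ} (hp : 2 ≤ p) (i : Fin k) (t : ℂ) :
    leftVar (Function.update 0 (Fin.natAdd k i) t) p = fun _ => (primeRoot p : ℂ) := by
  funext j
  have : Fin.castAdd k j ≠ Fin.natAdd k i := by
    intro h
    have := congrArg Fin.val h
    simp at this
    omega
  rw [leftVar, Function.update_of_ne this]
  simpa using natCast_cpow_primeRoot hp 0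

theorem rightVar_update_natAdd {k p : ℕ} (hp : 2 ≤ p) (i : Fin k) (t : ℂ) :
    rightVar (Function.update 0 (Fin.natAdd k i) t) p =
      Function.update (fun _ => (primeRoot p : ℂ)) i
        (primeRoot p * Complex.exp (-(Real.log p * -t))) := by
  funext j
  rw [rightVar]
  by_cases hj : j = i
  · subst hj
    simp only [Function.update_self]
    rw [← natCast_cpow_primeRoot hp, sub_neg_eq_add]
  · have : Fin.natAdd k j ≠ Fin.natAdd k i := fun h => hj (Fin.natAdd_injective _ _ h)
    rw [Function.update_of_ne hj, Function.update_of_ne this]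
    simpa using natCast_cpow_primeRoot hp 0

theorem update_mem_ball {n : ℕ} (i : Fin n) {t : ℂ} {R : ℝ} (ht : t ∈ ball (0 : ℂ) R) :
    Function.update (0 : Fin n → ℂ) i t ∈ ball (0 : Fin n → ℂ) R := by
  rw [mem_ball_zero_iff, norm_update_zero]
  simpa using ht

/-- The symmetry between the two halves of the variables. -/
theorem eulerFactor_update_natAdd {k p : ℕ} (hp : 2 ≤ p) (i : Fin k) {t : ℂ}
    (ht : t ∈ ball (0 : ℂ) (1 / 10)) :
    eulerFactor k (Function.update 0 (Fin.natAdd k i) t) p =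
      eulerFactor k (Function.update 0 (Fin.castAdd k i) (-t)) p := by
  have ht' : -t ∈ ball (0 : ℂ) (1 / 10) := by simpa using ht
  rw [eulerFactor_eq_of_mem_ball hp (update_mem_ball _ ht),
    eulerFactor_eq_of_mem_ball hp (update_mem_ball _ ht'), eulerSeries_comm,
    leftVar_update_natAdd hp, rightVar_update_natAdd hp, leftVar_update_castAdd hp,
    rightVar_update_castAdd hp]

/-- Only one left variable differs from r. Splitting it off writes h_n(s) as a convolution of powers
of rw with h_l of κ variables equal to r, so `tsum_corr_mul` applies; the product has κ+1 factors
with w and (κ+1)κ without. -/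
theorem eulerSeries_update {κ : ℕ} (i : Fin (κ + 1)) {r : ℝ} (h0 : 0 ≤ r) (h1 : r < 1) {w : ℂ}
    (hw : ‖(r * w : ℂ)‖ < 1) :
    eulerSeries (Function.update (fun _ => (r : ℂ)) i (r * w)) (fun _ => (r : ℂ)) =
      (1 - r ^ 2 * w) ^ (κ + 1) * ((1 - (r : ℂ) ^ 2) ^ (κ + 1)) ^ κ *
        ∑' m, corr κ r m * (r * w) ^ m := by
  have hcard : (Finset.univ.erase i).card = κ := by
    rw [Finset.card_erase_of_mem (Finset.mem_univ i), Finset.card_univ, Fintype.card_fin]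
    rfl
  rw [eulerSeries]
  congr 1
  · simp only [Finset.prod_const, Finset.card_univ, Fintype.card_fin]
    rw [← Finset.mul_prod_erase Finset.univ _ (Finset.mem_univ i), Function.update_self]
    congr 1
    · ring
    · rw [Finset.prod_congr rfl (g := fun _ => (1 - (r : ℂ) ^ 2) ^ (κ + 1))]
      · rw [Finset.prod_const, hcard]
      · intro j hj
        rw [Function.update_of_ne (Finset.ne_of_mem_erase hj), sq]
  · have hg : Summable fun m => ‖(r * w : ℂ) ^ m‖ := by
      simpa using summable_geometric_of_lt_one (norm_nonneg _) hw
    rw [← tsum_corr_mul h0 h1 κ hg]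
    refine tsum_congr fun n => ?_
    congr 1
    · rw [← Finset.insert_erase (Finset.mem_univ i), chs_insert (Finset.notMem_erase i _)]
      refine Finset.sum_congr rfl fun ml _ => ?_
      rw [Function.update_self, chs_const (r := (r : ℂ)), hcard, mseq]
      · push_cast
        rfl
      · intro j hj
        rw [Function.update_of_ne (Finset.ne_of_mem_erase hj)]
    · rw [chs_const (r := (r : ℂ)) _ fun _ _ => rfl, Finset.card_univ, Fintype.card_fin, mseq]
      push_cast
      rfl

theorem eulerFactor_update_castAdd {κ p : ℕ} (hp : 2 ≤ p) (i : Fin (κ + 1)) {t : ℂ}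
    (ht : t ∈ ball (0 : ℂ) (1 / 10)) :
    eulerFactor (κ + 1) (Function.update 0 (Fin.castAdd (κ + 1) i) t) p =
      (1 - (primeRoot p : ℂ) ^ 2 * Complex.exp (-(Real.log p * t))) ^ (κ + 1) *
        ((1 - (primeRoot p : ℂ) ^ 2) ^ (κ + 1)) ^ κ * corrGen κ (primeRoot p) (Real.log p) t := by
  rw [eulerFactor_eq_of_mem_ball hp (update_mem_ball _ ht), leftVar_update_castAdd hp,
    rightVar_update_castAdd hp, eulerSeries_update i (primeRoot_nonneg p)
    (lt_one_of_sq_le_half (primeRoot_sq_le hp))]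
  · rfl
  · rw [← natCast_cpow_primeRoot hp]
    have h := norm_leftVar_le hp (update_mem_ball (Fin.castAdd (κ + 1) i) ht) i
    rw [leftVar, Function.update_self] at h
    exact h.trans_lt ((varBound_le hp).trans_lt varBound_two_lt_one)

/-- A logarithm of the Euler factor along a coordinate axis. -/
theorem eventually_log_eulerFactor_eq {κ p : ℕ} (hp : 2 ≤ p) (i : Fin (κ + 1)) {c : ℝ}
    (hc : 0 < c) :
    ∃ b : ℝ, (fun t : ℂ => Complex.log
        (eulerFactor (κ + 1) (Function.update 0 (Fin.castAdd (κ + 1) i) t) p)) =ᶠ[𝓝 0]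
      fun t => b + ((κ + 1) * Complex.log
          (1 - (primeRoot p : ℂ) ^ 2 * Complex.exp (-(Real.log p * t))) +
        Complex.log (corrGen κ (primeRoot p) (Real.log p) t / c)) := by
  set r := primeRoot p
  set L := Real.log p
  have h0 : 0 ≤ r := primeRoot_nonneg p
  have hr : r ^ 2 ≤ 1 / 2 := primeRoot_sq_le hp
  have hL : 0 < L := log_pos_of_two_le hp
  have hR : 0 < 1 / 1000 / L := by positivity
  have hball := ball_mem_nhds (0 : ℂ) hR
  have hS := tsum_corr_mul_pow_pos h0 hr κ
  have hcne : (c : ℂ) ≠ 0 := Complex.ofReal_ne_zero.mpr hc.ne'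
  have hb : 0 < ((1 - r ^ 2) ^ (κ + 1)) ^ κ * c := by
    have : 0 < 1 - r ^ 2 := by linarith
    positivity
  -- The normalisation c is free, since b absorbs it. Later c = c_0 serves the large primes and c =
  -- G(0) all primes.
  refine ⟨Real.log (((1 - r ^ 2) ^ (κ + 1)) ^ κ * c), ?_⟩
  have hG : ContinuousAt (corrGen κ r L) 0 :=
    ((differentiableOn_corrGen h0 hr hL κ).differentiableAt hball).continuousAt
  have hmem : corrGen κ r L 0 / c ∈ Complex.slitPlane := by
    rw [corrGen_zero, ← Complex.ofReal_div]
    exact Complex.ofReal_mem_slitPlane.mpr (div_pos hS hc)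
  have hlog : ContinuousAt (fun t => Complex.log (1 - (r : ℂ) ^ 2 * Complex.exp (-(L * t)))) 0 :=
    ((differentiableOn_log_one_sub hr hL).differentiableAt hball).continuousAt
  refine eventually_log_eq ?_ ?_ ?_
  · exact continuousAt_const.add ((continuousAt_const.mul hlog).add
      ((hG.div_const _).clog hmem))
  · have e1 : (1 - (r : ℂ) ^ 2 * Complex.exp (-(L * 0))) = ((1 - r ^ 2 : ℝ) : ℂ) := by simp
    rw [e1, corrGen_zero, ← Complex.ofReal_div, ← Complex.ofReal_log (by linarith),
      ← Complex.ofReal_log (div_pos hS hc).le]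
    simp
  · have hne : ∀ᶠ t in 𝓝 (0 : ℂ), corrGen κ r L t / c ≠ 0 :=
      (hG.div_const _).eventually_ne (Complex.slitPlane_ne_zero hmem)
    filter_upwards [hball, hne, ball_mem_nhds (0 : ℂ) (by norm_num : (0 : ℝ) < 1 / 10)]
      with t ht htne ht'
    rw [eulerFactor_update_castAdd hp i ht', Complex.exp_add, Complex.exp_add,
      Complex.ofReal_log hb.le, Complex.exp_log (Complex.ofReal_ne_zero.mpr hb.ne'),
      Complex.exp_log htne]
    have e2 : ((κ : ℂ) + 1) = ((κ + 1 : ℕ) : ℂ) := by push_cast; rfl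
    rw [e2, Complex.exp_nat_mul, Complex.exp_log
      (Complex.slitPlane_ne_zero (one_sub_mem_slitPlane hr hL ht))]
    change (1 - (r : ℂ) ^ 2 * Complex.exp (-(L * t))) ^ (κ + 1) * ((1 - (r : ℂ) ^ 2) ^ (κ + 1)) ^ κ *
      corrGen κ r L t = _
    simp only [Complex.ofReal_mul, Complex.ofReal_pow, Complex.ofReal_sub, Complex.ofReal_one]
    field_simp

/-- The derivatives at the origin of the logarithm of the Euler factor along the axis of
the variable with index `i`. -/
noncomputable def primeCoeff (k p N : ℕ) (i : Fin (k + k)) : ℂ :=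
  iteratedDeriv N (fun t => Complex.log (eulerFactor k (Function.update 0 i t) p)) 0

/-- The reflection t ↦ -t exchanges the two kinds of axes; this is where the two cases of `sgn` come
from. -/
theorem primeCoeff_natAdd {k p : ℕ} (hp : 2 ≤ p) (N : ℕ) (i : Fin k) :
    primeCoeff k p N (Fin.natAdd k i) = (-1) ^ N * primeCoeff k p N (Fin.castAdd k i) := by
  have heq : (fun t => Complex.log (eulerFactor k (Function.update 0 (Fin.natAdd k i) t) p))
      =ᶠ[𝓝 0] fun t =>
        Complex.log (eulerFactor k (Function.update 0 (Fin.castAdd k i) (-t)) p) := by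
    filter_upwards [ball_mem_nhds (0 : ℂ) (by norm_num : (0 : ℝ) < 1 / 10)] with t ht
    rw [eulerFactor_update_natAdd hp i ht]
  rw [primeCoeff, heq.iteratedDeriv_eq, iteratedDeriv_comp_neg N
    (fun t => Complex.log (eulerFactor k (Function.update 0 (Fin.castAdd k i) t) p)), neg_zero,
    smul_eq_mul, primeCoeff]

theorem primeCoeff_castAdd {κ p : ℕ} (hp : 2 ≤ p) (N : ℕ) (i : Fin (κ + 1)) {c : ℝ}
    (hc : 0 < c) :
    primeCoeff (κ + 1) p (N + 1) (Fin.castAdd (κ + 1) i) =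
      iteratedDeriv (N + 1) (fun t => (κ + 1) * Complex.log
          (1 - (primeRoot p : ℂ) ^ 2 * Complex.exp (-(Real.log p * t))) +
        Complex.log (corrGen κ (primeRoot p) (Real.log p) t / c)) 0 := by
  obtain ⟨b, hb⟩ := eventually_log_eulerFactor_eq hp i hc
  rw [primeCoeff, hb.iteratedDeriv_eq, iteratedDeriv_const_add (Nat.succ_pos N)]

/-- The bound for large primes: 10k ≤ p says k r² ≤ 1/10, where the logarithm of the Euler factor
cancels to first order. -/
theorem norm_primeCoeff_le {k p : ℕ} (hp : 2 ≤ p) (hk : 1 ≤ k) (hkp : 10 * k ≤ p) (N : ℕ)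
    (i : Fin k) :
    ‖primeCoeff k p (N + 1) (Fin.castAdd k i)‖ ≤
      (N + 1).factorial * (6 * ((k : ℝ) ^ 3 / (p : ℝ) ^ 2)) * (2000 * Real.log p) ^ (N + 1) := by
  obtain ⟨κ, rfl⟩ : ∃ κ, k = κ + 1 := ⟨k - 1, by omega⟩
  have hr1 := lt_one_of_sq_le_half (primeRoot_sq_le hp)
  rw [primeCoeff_castAdd hp N i
    (zero_lt_one.trans_le (one_le_corr_zero (primeRoot_nonneg p) hr1 κ))]
  have hp0 : (0 : ℝ) < p := by exact_mod_cast (by omega : 0 < p)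
  have h := norm_iteratedDeriv_log_add_log_corrGen_le (primeRoot_nonneg p) (log_pos_of_two_le hp)
    (κ := κ) ?_ (N + 1)
  · refine h.trans_eq ?_
    rw [show primeRoot p ^ 4 = (primeRoot p ^ 2) ^ 2 by ring, primeRoot_sq]
    push_cast
    ring
  · rw [primeRoot_sq, mul_one_div, div_le_iff₀ hp0]
    have : (10 * ((κ + 1 : ℕ) : ℝ)) ≤ p := by exact_mod_cast hkp
    push_cast at this
    linarith

/-- The Taylor coefficients of k log(1 - r²w) are the main term exactly, so the whole error is the
contribution of log G. -/
theorem norm_primeCoeff_sub_le {k p : ℕ} (hp : 2 ≤ p) (hk : 1 ≤ k) (N : ℕ) (i : Fin k) :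
    ‖primeCoeff k p (N + 1) (Fin.castAdd k i) - (((-1) ^ N * k * (Real.log p ^ (N + 1) *
      ∑' n : ℕ, ((n : ℝ) + 1) ^ N / (p : ℝ) ^ (n + 1)) : ℝ) : ℂ)‖ ≤
      (N + 1).factorial * primeRoot p * (2000 * Real.log p) ^ (N + 1) := by
  obtain ⟨κ, rfl⟩ : ∃ κ, k = κ + 1 := ⟨k - 1, by omega⟩
  have h0 := primeRoot_nonneg p
  have hr := primeRoot_sq_le hp
  have hL := log_pos_of_two_le hp
  have hR : 0 < 1 / 1000 / Real.log p := by positivity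
  have hS := tsum_corr_mul_pow_pos h0 hr κ
  rw [primeCoeff_castAdd hp N i hS, iteratedDeriv_fun_add, iteratedDeriv_const_mul_field,
    iteratedDeriv_log_one_sub hr hL]
  · have e : ((κ : ℂ) + 1) * (((-1) ^ N * Real.log p ^ (N + 1) *
        ∑' n : ℕ, ((n : ℝ) + 1) ^ N * (primeRoot p ^ 2) ^ (n + 1) : ℝ) : ℂ) =
        (((-1) ^ N * (κ + 1 : ℕ) * (Real.log p ^ (N + 1) *
          ∑' n : ℕ, ((n : ℝ) + 1) ^ N / (p : ℝ) ^ (n + 1)) : ℝ) : ℂ) := by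
      rw [primeRoot_sq]
      simp_rw [one_div, inv_pow, ← div_eq_mul_inv]
      push_cast
      ring
    rw [e, add_sub_cancel_left]
    exact norm_iteratedDeriv_log_corrGen_le h0 hr hL κ (N + 1)
  · exact contDiffAt_of_differentiableOn_ball hR
      ((differentiableOn_log_one_sub hr hL).const_mul _) _
  · exact contDiffAt_of_differentiableOn_ball hR
      (((differentiableOn_corrGen h0 hr hL κ).div_const _).clog
        fun t ht => corrGen_div_mem_slitPlane h0 hr hL κ ht) _

end ZetaMoment

/-! ### The linear coefficient and the hypergeometric function -/

namespace ZetaMoment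

open Filter Topology Metric

theorem succ_mul_multichoose_succ' (k n : ℕ) :
    (n + 1) * Nat.multichoose k (n + 1) = k * Nat.multichoose (k + 1) n := by
  induction n with
  | zero => simp
  | succ n ih =>
    rw [succ_mul_multichoose_succ, Nat.multichoose_succ_succ, mul_add, ← ih]
    ring

/-- The coefficient of x^(n+1) in x(1-x)^(-2) · (1-x)^(-κ). -/
theorem sum_antidiagonal_mul_multichoose (κ n : ℕ) :
    ∑ ml ∈ Finset.HasAntidiagonal.antidiagonal (n + 1), ml.1 * Nat.multichoose κ ml.2 =
      Nat.multichoose (κ + 2) n := by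
  induction n with
  | zero => simp [Finset.Nat.antidiagonal_succ]
  | succ n ih =>
    rw [Finset.Nat.sum_antidiagonal_succ]
    simp only [zero_mul, zero_add, add_mul, one_mul, Finset.sum_add_distrib]
    rw [ih, sum_antidiagonal_multichoose, Nat.multichoose_succ_succ (κ + 1) n, add_comm]

theorem eval_ascPochhammer_natCast (k n : ℕ) :
    (ascPochhammer ℝ n).eval (k : ℝ) = n.factorial * Nat.multichoose k n := by
  rw [← ascPochhammer_eval_cast, ascPochhammer_nat_eq_ascFactorial,
    Nat.ascFactorial_eq_factorial_mul_choose', Nat.multichoose_eq]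
  push_cast
  rfl

section

variable {r : ℝ}

/-- At w = 1 the convolution turns d_κ back into d_{κ+1}, so the sum is ∑ d_k(p^n)² r^(2n), which is
F(k, k; 1; r²). -/
theorem tsum_corr_mul_pow_eq (h0 : 0 ≤ r) (h1 : r < 1) (κ : ℕ) :
    ∑' m, corr κ r m * r ^ m =
      ordinaryHypergeometric ((κ : ℝ) + 1) ((κ : ℝ) + 1) 1 (r ^ 2) := by
  have hg : Summable fun m => ‖((r : ℂ)) ^ m‖ := by
    simpa [abs_of_nonneg h0] using summable_geometric_of_lt_one h0 h1
  have h := tsum_corr_mul h0 h1 κ hg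
  have h' : ∑' m, corr κ r m * r ^ m = ∑' n, mseq (κ + 1) r n * mseq (κ + 1) r n := by
    have : ((∑' m, corr κ r m * r ^ m : ℝ) : ℂ) =
        ((∑' n, mseq (κ + 1) r n * mseq (κ + 1) r n : ℝ) : ℂ) := by
      rw [Complex.ofReal_tsum, Complex.ofReal_tsum]
      push_cast
      rw [← h]
      refine tsum_congr fun n => ?_
      congr 1
      rw [mseq, ← sum_antidiagonal_multichoose]
      push_cast
      rw [Finset.sum_mul]
      refine Finset.sum_congr rfl fun ml hml => ?_
      rw [mseq, ← Finset.HasAntidiagonal.mem_antidiagonal.mp hml]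
      push_cast
      ring
    exact_mod_cast this
  rw [h', ordinaryHypergeometric_eq_tsum]
  refine tsum_congr fun n => ?_
  have e1 : (κ : ℝ) + 1 = ((κ + 1 : ℕ) : ℝ) := by push_cast; rfl
  have e2 := eval_ascPochhammer_natCast 1 n
  rw [Nat.cast_one] at e2
  rw [e1, e2, eval_ascPochhammer_natCast, Nat.multichoose_one, mseq, smul_eq_mul]
  have : (n.factorial : ℝ) ≠ 0 := by exact_mod_cast n.factorial_ne_zero
  field_simp
  push_cast
  ring

/-- The weight m turns the convolution into d_{k+1}(p^n) at index n+1. The relation (n+1)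
d_k(p^(n+1)) = k d_{k+1}(p^n) makes the series k ∑ d_{k+1}(p^n)² r^(2n+2)/(n+1), and the Pochhammer
symbol (2)_n = (n+1)! accounts for the parameter 2. -/
theorem tsum_corr_mul_natCast_mul_pow_eq (h0 : 0 ≤ r) (h1 : r < 1) (κ : ℕ) :
    ∑' m : ℕ, corr κ r m * (m * r ^ m) = (κ + 1) * r ^ 2 *
      ordinaryHypergeometric ((κ : ℝ) + 1 + 1) ((κ : ℝ) + 1 + 1) 2 (r ^ 2) := by
  have hg : Summable fun m : ℕ => ‖(m * (r : ℂ) ^ m : ℂ)‖ := by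
    have : ‖r‖ < 1 := by rwa [Real.norm_of_nonneg h0]
    have := (hasSum_coe_mul_geometric_of_norm_lt_one this).summable
    simpa [abs_of_nonneg h0] using this
  have h := tsum_corr_mul h0 h1 κ hg
  have hk : Summable fun n => (∑ ml ∈ Finset.HasAntidiagonal.antidiagonal n,
      ml.1 * r ^ ml.1 * mseq κ r ml.2) * mseq (κ + 1) r n := by
    obtain ⟨M, hM⟩ : ∃ M, ∀ n, mseq (κ + 1) r n ≤ M :=
      ⟨_, fun n => (summable_mseq h0 h1 (κ + 1)).le_tsum n fun _ _ => mseq_nonneg h0 _ _⟩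
    have hg' : Summable fun m : ℕ => ‖(m * r ^ m : ℝ)‖ := by
      refine hg.congr fun m => ?_
      rw [← Complex.norm_real]
      push_cast
      rfl
    have hm : Summable fun m : ℕ => ‖mseq κ r m‖ := (summable_mseq h0 h1 κ).norm
    have hs := (summable_norm_sum_mul_antidiagonal_of_summable_norm hg' hm).of_norm
    refine Summable.of_nonneg_of_le (fun n => ?_) (fun n => ?_) (hs.mul_right M)
    · exact mul_nonneg (Finset.sum_nonneg fun ml _ => mul_nonneg (by positivity)
        (mseq_nonneg h0 _ _)) (mseq_nonneg h0 _ _)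
    · exact mul_le_mul_of_nonneg_left (hM n) (Finset.sum_nonneg fun ml _ =>
        mul_nonneg (by positivity) (mseq_nonneg h0 _ _))
  have h' : ∑' m : ℕ, corr κ r m * (m * r ^ m) =
      ∑' n, (∑ ml ∈ Finset.HasAntidiagonal.antidiagonal n,
      ml.1 * r ^ ml.1 * mseq κ r ml.2) * mseq (κ + 1) r n := by
    have : ((∑' m : ℕ, corr κ r m * (m * r ^ m) : ℝ) : ℂ) =
        ((∑' n, (∑ ml ∈ Finset.HasAntidiagonal.antidiagonal n,
      ml.1 * r ^ ml.1 * mseq κ r ml.2) * mseq (κ + 1) r n : ℝ) : ℂ) := by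
      rw [Complex.ofReal_tsum, Complex.ofReal_tsum]
      push_cast
      exact h.symm
    exact_mod_cast this
  rw [h', hk.tsum_eq_zero_add, ordinaryHypergeometric_eq_tsum, ← tsum_mul_left]
  rw [Finset.HasAntidiagonal.antidiagonal_zero, Finset.sum_singleton]
  simp only [Nat.cast_zero, zero_mul, zero_add]
  refine tsum_congr fun n => ?_
  have hin : (∑ ml ∈ Finset.HasAntidiagonal.antidiagonal (n + 1),
      ml.1 * r ^ ml.1 * mseq κ r ml.2) = Nat.multichoose (κ + 2) n * r ^ (n + 1) := by
    rw [← sum_antidiagonal_mul_multichoose]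
    push_cast
    rw [Finset.sum_mul]
    refine Finset.sum_congr rfl fun ml hml => ?_
    rw [mseq, ← Finset.HasAntidiagonal.mem_antidiagonal.mp hml]
    ring
  have e1 : (κ : ℝ) + 1 + 1 = ((κ + 2 : ℕ) : ℝ) := by push_cast; ring
  have e2 := eval_ascPochhammer_natCast 2 n
  rw [Nat.cast_ofNat] at e2
  rw [hin, e1, e2, eval_ascPochhammer_natCast, Nat.multichoose_two, mseq, smul_eq_mul]
  have : (n.factorial : ℝ) ≠ 0 := by exact_mod_cast n.factorial_ne_zero
  have hn : ((n : ℝ) + 1) ≠ 0 := by positivity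
  have hrel : ((n : ℝ) + 1) * Nat.multichoose (κ + 1) (n + 1) =
      (κ + 1) * Nat.multichoose (κ + 2) n := by
    exact_mod_cast succ_mul_multichoose_succ' (κ + 1) n
  have hrel' : (Nat.multichoose (κ + 1) (n + 1) : ℝ) =
      (κ + 1) * Nat.multichoose (κ + 2) n / (n + 1) := by
    rw [eq_div_iff hn, ← hrel]
    ring
  rw [hrel']
  push_cast
  field_simp
  ring

theorem deriv_corrGen_zero {L : ℝ} (h0 : 0 ≤ r) (hr : r ^ 2 ≤ 1 / 2) (hL : 0 < L) (κ : ℕ) :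
    deriv (corrGen κ r L) 0 = ((-L * ∑' m : ℕ, corr κ r m * (m * r ^ m) : ℝ) : ℂ) := by
  have hR : 0 < 1 / 1000 / L := by positivity
  have h := Complex.hasSum_deriv_of_summable_norm (U := ball (0 : ℂ) (1 / 1000 / L))
    (F := fun m t => (corr κ r m : ℂ) * (r * Complex.exp (-(L * t))) ^ m)
    (summable_corrGen_bound κ r) (fun m => by fun_prop) isOpen_ball
    (fun m t ht => norm_corrGen_term_le h0 hr hL κ m ht) (mem_ball_self hR)
  have e : corrGen κ r L = fun t => ∑' m, (corr κ r m : ℂ) * (r * Complex.exp (-(L * t))) ^ m := rfl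
  rw [e, ← h.tsum_eq]
  push_cast
  rw [← tsum_mul_left]
  refine tsum_congr fun m => ?_
  have hd : HasDerivAt (fun t : ℂ => (corr κ r m : ℂ) * (r * Complex.exp (-(L * t))) ^ m)
      ((corr κ r m : ℂ) * (m * (r * Complex.exp (-(L * 0))) ^ (m - 1) *
        (r * (Complex.exp (-(L * 0)) * -(L * 1))))) 0 :=
    ((((((hasDerivAt_id (0 : ℂ)).const_mul (L : ℂ)).neg).cexp).const_mul (r : ℂ)).pow m).const_mul _
  rw [hd.deriv]
  cases m with
  | zero => simp
  | succ m =>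
    simp
    ring

end

/-- The first part of `bTerm` is the derivative of k log(1 - r²w) at 0, a geometric series; the
second is G'(0)/G(0). -/
theorem primeCoeff_one_eq_bTerm {k p : ℕ} (hp : 2 ≤ p) (hk : 1 ≤ k) (i : Fin k) :
    primeCoeff k p 1 (Fin.castAdd k i) = (bTerm k p : ℂ) := by
  obtain ⟨κ, rfl⟩ : ∃ κ, k = κ + 1 := ⟨k - 1, by omega⟩
  have h0 := primeRoot_nonneg p
  have hr := primeRoot_sq_le hp
  have hr1 := lt_one_of_sq_le_half hr
  have hL := log_pos_of_two_le hp
  have hR : 0 < 1 / 1000 / Real.log p := by positivity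
  have hS := tsum_corr_mul_pow_pos h0 hr κ
  have hSne : ((∑' m, corr κ (primeRoot p) m * primeRoot p ^ m : ℝ) : ℂ) ≠ 0 :=
    Complex.ofReal_ne_zero.mpr hS.ne'
  have hp1 : (1 : ℝ) < p := by exact_mod_cast (by omega : 1 < p)
  refine (primeCoeff_castAdd hp 0 i hS).trans ?_
  rw [iteratedDeriv_fun_add,
    iteratedDeriv_const_mul_field, iteratedDeriv_log_one_sub hr hL]
  · have hdG := ((differentiableOn_corrGen h0 hr hL κ).differentiableAt
      (ball_mem_nhds (0 : ℂ) hR)).hasDerivAt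
    have hdlog := (hdG.div_const ((∑' m, corr κ (primeRoot p) m * primeRoot p ^ m : ℝ) : ℂ)).clog
      (corrGen_div_mem_slitPlane h0 hr hL κ (mem_ball_self hR))
    rw [zero_add, iteratedDeriv_one, hdlog.deriv, corrGen_zero, div_self hSne, div_one,
      deriv_corrGen_zero h0 hr hL κ]
    have hgeo : ∑' n : ℕ, ((n : ℝ) + 1) ^ 0 * (primeRoot p ^ 2) ^ (n + 1) = 1 / ((p : ℝ) - 1) := by
      have hx : ‖(1 / (p : ℝ))‖ < 1 := by
        rw [Real.norm_of_nonneg (by positivity), div_lt_one (by linarith)]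
        exact hp1
      simp only [pow_zero, one_mul, primeRoot_sq]
      simp only [pow_succ]
      rw [tsum_mul_right, tsum_geometric_of_norm_lt_one hx]
      have : (p : ℝ) ≠ 0 := by linarith
      have : (p : ℝ) - 1 ≠ 0 := by linarith
      field_simp
    rw [hgeo, tsum_corr_mul_pow_eq h0 hr1, tsum_corr_mul_natCast_mul_pow_eq h0 hr1, primeRoot_sq,
      bTerm]
    push_cast
    ring
  · exact contDiffAt_of_differentiableOn_ball hR
      ((differentiableOn_log_one_sub hr hL).const_mul _) _
  · exact contDiffAt_of_differentiableOn_ball hR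
      (((differentiableOn_corrGen h0 hr hL κ).div_const _).clog
        fun t ht => corrGen_div_mem_slitPlane h0 hr hL κ ht) _

end ZetaMoment

/-! ### Chebyshev's bound and sums over small and large primes -/

namespace ZetaMoment

/-- The function that is `log p` at the primes `p` and zero elsewhere. -/
noncomputable def primeLog (n : ℕ) : ℝ := if n.Prime then Real.log n else 0

theorem primeLog_nonneg (n : ℕ) : 0 ≤ primeLog n := by
  unfold primeLog
  split_ifs
  · exact Real.log_natCast_nonneg n
  · exact le_rfl

theorem sum_range_primeLog_le (n : ℕ) : ∑ i ∈ Finset.range n, primeLog i ≤ 2 * n := by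
  have h : ∑ i ∈ Finset.range n, primeLog i ≤ Chebyshev.theta n := by
    rw [Chebyshev.theta_eq_sum_Icc, Nat.floor_natCast, Finset.sum_filter]
    refine Finset.sum_le_sum_of_subset_of_nonneg ?_ fun i _ _ => primeLog_nonneg i
    intro i hi
    rw [Finset.mem_range] at hi
    exact Finset.mem_Icc.mpr ⟨Nat.zero_le _, hi.le⟩
  have h4 : Real.log 4 ≤ 2 := by
    rw [show (4 : ℝ) = 2 ^ 2 by norm_num, Real.log_pow]
    have := Real.log_two_lt_d9
    push_cast
    linarith
  calc _ ≤ Real.log 4 * n := h.trans (Chebyshev.theta_le_log4_mul_x (Nat.cast_nonneg n))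
    _ ≤ _ := by gcongr

/-- Summation by parts: domination of partial sums passes to antitone weights. -/
theorem sum_mul_le_sum_mul_of_antitone {a b g : ℕ → ℝ} (hg0 : ∀ n, 0 ≤ g n) (hg : Antitone g)
    (h : ∀ n, ∑ i ∈ Finset.range n, a i ≤ ∑ i ∈ Finset.range n, b i) (n : ℕ) :
    ∑ i ∈ Finset.range n, a i * g i ≤ ∑ i ∈ Finset.range n, b i * g i := by
  have key : ∀ n, (∑ i ∈ Finset.range (n + 1), b i - ∑ i ∈ Finset.range (n + 1), a i) * g n ≤
      ∑ i ∈ Finset.range (n + 1), b i * g i - ∑ i ∈ Finset.range (n + 1), a i * g i := by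
    intro n
    induction n with
    | zero => simp [sub_mul]
    | succ n ih =>
      rw [Finset.sum_range_succ _ (n + 1), Finset.sum_range_succ _ (n + 1),
        Finset.sum_range_succ _ (n + 1), Finset.sum_range_succ _ (n + 1)]
      have h1 := mul_le_mul_of_nonneg_left (hg (Nat.le_succ n)) (sub_nonneg.mpr (h (n + 1)))
      simp only [Nat.succ_eq_add_one] at h1
      linarith
  cases n with
  | zero => simp
  | succ n =>
    have := mul_nonneg (sub_nonneg.mpr (h (n + 1))) (hg0 n)
    linarith [key n]

theorem sum_range_one_div_sqrt_le (n : ℕ) :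
    ∑ i ∈ Finset.range n, 1 / √((i : ℝ) + 1) ≤ 2 * √n := by
  induction n with
  | zero => simp
  | succ n ih =>
    rw [Finset.sum_range_succ]
    push_cast
    have h0 : 0 < √((n : ℝ) + 1) := Real.sqrt_pos.mpr (by positivity)
    have h1 : √((n : ℝ) + 1) ^ 2 = n + 1 := Real.sq_sqrt (by positivity)
    have h2 : √(n : ℝ) ^ 2 = n := Real.sq_sqrt (by positivity)
    have h3 : 1 / √((n : ℝ) + 1) ≤ 2 * √((n : ℝ) + 1) - 2 * √(n : ℝ) := by
      rw [div_le_iff₀ h0]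
      nlinarith [sq_nonneg (√((n : ℝ) + 1) - √(n : ℝ))]
    linarith

theorem sum_range_primeLog_div_sqrt_le (n : ℕ) :
    ∑ i ∈ Finset.range n, primeLog i * (1 / √((i : ℝ) + 1)) ≤ 4 * √n := by
  have h := sum_mul_le_sum_mul_of_antitone (a := primeLog) (b := fun _ => 2)
    (g := fun i => 1 / √((i : ℝ) + 1)) (fun n => by positivity)
    (fun i j hij => by
      have : (i : ℝ) ≤ j := by exact_mod_cast hij
      dsimp only
      gcongr) (fun n => by simpa [mul_comm] using sum_range_primeLog_le n) n
  rw [← Finset.mul_sum] at h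
  linarith [sum_range_one_div_sqrt_le n]

theorem sum_Ico_one_div_mul_sqrt_le {m n : ℕ} (hm : 1 ≤ m) :
    ∑ i ∈ Finset.Ico m n, 1 / (((i : ℝ) + 1) * √((i : ℝ) + 1)) ≤ 2 / √m := by
  by_cases hmn : m ≤ n
  · have key : ∑ i ∈ Finset.Ico m n, 1 / (((i : ℝ) + 1) * √((i : ℝ) + 1)) ≤
        2 / √m - 2 / √n := by
      induction n, hmn using Nat.le_induction with
      | base => simp
      | succ n hn ih =>
        rw [Finset.sum_Ico_succ_top hn]
        push_cast
        have hn1 : (1 : ℝ) ≤ n := by exact_mod_cast hm.trans hn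
        have h0 : 0 < √((n : ℝ) + 1) := Real.sqrt_pos.mpr (by positivity)
        have h0' : 0 < √(n : ℝ) := Real.sqrt_pos.mpr (by linarith)
        have h1 : √((n : ℝ) + 1) ^ 2 = n + 1 := Real.sq_sqrt (by positivity)
        have h2 : √(n : ℝ) ^ 2 = n := Real.sq_sqrt (by positivity)
        have hle : √(n : ℝ) ≤ √((n : ℝ) + 1) := Real.sqrt_le_sqrt (by linarith)
        have h3 : 1 / (((n : ℝ) + 1) * √((n : ℝ) + 1)) ≤ 2 / √(n : ℝ) - 2 / √((n : ℝ) + 1) := by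
          have hab : √((n : ℝ) + 1) ^ 2 = √(n : ℝ) ^ 2 + 1 := by rw [h1, h2]
          nth_rewrite 1 [← h1]
          set a := √((n : ℝ) + 1)
          set b := √(n : ℝ)
          rw [div_sub_div _ _ h0'.ne' h0.ne', div_le_div_iff₀ (by positivity) (by positivity)]
          -- Here a² - b² = 1 and b ≤ a, so 1 = (a - b)(a + b) ≤ 2(a - b)a.
          have h4 : 1 ≤ 2 * (a - b) * a := by nlinarith [sq_nonneg (a - b)]
          have h5 : b * a ≤ a ^ 2 := by nlinarith
          calc 1 * (b * a) ≤ (2 * (a - b) * a) * a ^ 2 := by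
                refine mul_le_mul h4 h5 (by positivity) (by linarith)
            _ = _ := by ring
        linarith
    have : 0 ≤ 2 / √(n : ℝ) := by positivity
    linarith
  · rw [Finset.Ico_eq_empty (by omega), Finset.sum_empty]
    positivity

theorem sum_Ico_primeLog_div_mul_sqrt_le {Y n : ℕ} (hY : 1 ≤ Y) :
    ∑ i ∈ Finset.Ico (Y + 1) n, primeLog i * (1 / (((i : ℝ) + 1) * √((i : ℝ) + 1))) ≤ 6 / √Y := by
  by_cases hn : Y + 1 ≤ n
  swap
  · rw [Finset.Ico_eq_empty (by omega), Finset.sum_empty]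
    positivity
  set g : ℕ → ℝ := fun i => 1 / (((i : ℝ) + 1) * √((i : ℝ) + 1)) with hg
  set a : ℕ → ℝ := fun i => if Y + 1 ≤ i then primeLog i else 0 with ha
  -- The mass 2(Y+1) at Y makes the partial sums of b equal 2n for n > Y, exactly Chebyshev's bound.
  -- Comparison then works for the tail without a lower bound on the primes up to Y.
  set b : ℕ → ℝ := fun i => if Y + 1 ≤ i then 2 else if i = Y then 2 * (Y + 1) else 0 with hb
  have ha0 : ∀ i, i ≤ Y → a i = 0 := fun i hi => if_neg (by omega)
  have ha1 : ∀ i, Y + 1 ≤ i → a i = primeLog i := fun i hi => if_pos hi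
  have hb0 : ∀ i, i < Y → b i = 0 := fun i hi => by
    rw [hb]
    dsimp only
    rw [if_neg (by omega), if_neg (by omega)]
  have hbY : b Y = 2 * (Y + 1) := by
    rw [hb]
    dsimp only
    rw [if_neg (by omega), if_pos rfl]
  have hb1 : ∀ i, Y + 1 ≤ i → b i = 2 := fun i hi => if_pos hi
  have hsplit : ∀ f : ℕ → ℝ, ∀ n, Y + 1 ≤ n → (∀ i, i < Y → f i = 0) →
      ∑ i ∈ Finset.range n, f i = f Y + ∑ i ∈ Finset.Ico (Y + 1) n, f i := by
    intro f n hn hf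
    rw [← Finset.sum_range_add_sum_Ico f hn, Finset.sum_range_succ,
      Finset.sum_eq_zero fun i hi => hf i (Finset.mem_range.mp hi), zero_add]
  have hsum : ∀ n, ∑ i ∈ Finset.range n, a i ≤ ∑ i ∈ Finset.range n, b i := by
    intro n
    by_cases hn : Y + 1 ≤ n
    · have h1 : ∑ i ∈ Finset.range n, a i ≤ ∑ i ∈ Finset.range n, primeLog i := by
        refine Finset.sum_le_sum fun i _ => ?_
        rw [ha]
        dsimp only
        split_ifs
        · exact le_rfl
        · exact primeLog_nonneg i
      have h2 : ∑ i ∈ Finset.range n, b i = 2 * n := by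
        rw [hsplit b n hn hb0, hbY, Finset.sum_congr rfl (g := fun _ => (2 : ℝ)) fun i hi =>
          hb1 i (Finset.mem_Ico.mp hi).1]
        simp only [Finset.sum_const, Nat.card_Ico, nsmul_eq_mul]
        rw [Nat.cast_sub hn]
        push_cast
        ring
      rw [h2]
      exact h1.trans (sum_range_primeLog_le n)
    · refine Finset.sum_le_sum fun i hi => ?_
      have hi' := Finset.mem_range.mp hi
      rw [ha0 i (by omega), hb]
      dsimp only
      split_ifs <;> positivity
  have h := sum_mul_le_sum_mul_of_antitone (a := a) (b := b) (g := g)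
    (fun n => by positivity) (fun i j hij => by
      have : (i : ℝ) ≤ j := by exact_mod_cast hij
      rw [hg]
      dsimp only
      gcongr) hsum n
  rw [hsplit _ n hn fun i hi => by rw [ha0 i hi.le, zero_mul],
    hsplit _ n hn fun i hi => by rw [hb0 i hi, zero_mul],
    Finset.sum_congr rfl (g := fun i => primeLog i * g i) fun i hi => by
      rw [ha1 i (Finset.mem_Ico.mp hi).1],
    Finset.sum_congr (s₁ := Finset.Ico (Y + 1) n) rfl (f := fun i => b i * g i)
      (g := fun i => 2 * g i) fun i hi => by rw [hb1 i (Finset.mem_Ico.mp hi).1],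
    ← Finset.mul_sum] at h
  have hYpos : (0 : ℝ) < Y := by exact_mod_cast hY
  have hsY : 0 < √(Y : ℝ) := Real.sqrt_pos.mpr hYpos
  have h1 : b Y * g Y ≤ 2 / √Y := by
    rw [hbY, hg]
    dsimp only
    have : 2 * ((Y : ℝ) + 1) * (1 / (((Y : ℝ) + 1) * √((Y : ℝ) + 1))) = 2 / √((Y : ℝ) + 1) := by
      field_simp
    rw [this]
    gcongr
    linarith
  have h2 : ∑ i ∈ Finset.Ico (Y + 1) n, g i ≤ 2 / √Y := by
    refine (sum_Ico_one_div_mul_sqrt_le (by omega)).trans ?_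
    gcongr
    exact_mod_cast Nat.le_succ Y
  have h3 : a Y * g Y = 0 := by rw [ha0 Y le_rfl, zero_mul]
  calc _ ≤ b Y * g Y + 2 * ∑ i ∈ Finset.Ico (Y + 1) n, g i := by linarith
    _ ≤ 2 / √Y + 2 * (2 / √Y) := by gcongr
    _ = _ := by ring

theorem one_add_log_pow_le (N : ℕ) {u : ℝ} (hu : 1 ≤ u) :
    (1 + Real.log u) ^ N ≤ (2 * N + 3) ^ N * √u := by
  -- With this exponent log u ≤ u^ε/ε raised to the power N costs u^(εN), and εN ≤ 1/2.
  set ε : ℝ := 1 / (2 * (N + 1)) with hε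
  have hN : (0 : ℝ) ≤ N := Nat.cast_nonneg N
  have hε0 : 0 < ε := by positivity
  have h1 : Real.log u ≤ u ^ ε / ε := Real.log_le_rpow_div (by linarith) hε0
  have h2 : 1 ≤ u ^ ε := Real.one_le_rpow hu hε0.le
  have h3 : 1 + Real.log u ≤ (2 * N + 3) * u ^ ε := by
    have : u ^ ε / ε = (2 * (N + 1)) * u ^ ε := by
      rw [hε]
      field_simp
    linarith
  have h4 : 0 ≤ Real.log u := Real.log_nonneg hu
  calc _ ≤ ((2 * N + 3) * u ^ ε) ^ N := pow_le_pow_left₀ (by linarith) h3 N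
    _ = (2 * N + 3) ^ N * u ^ (ε * N) := by
      rw [mul_pow, ← Real.rpow_mul_natCast (by linarith)]
    _ ≤ (2 * N + 3) ^ N * u ^ (1 / 2 : ℝ) := by
      gcongr
      rw [hε, one_div_mul_eq_div, div_le_div_iff₀ (by positivity) (by norm_num)]
      linarith
    _ = _ := by rw [Real.sqrt_eq_rpow]

theorem mem_primesUpTo {n p : ℕ} : p ∈ primesUpTo n ↔ p ≤ n ∧ p.Prime := by
  simp [primesUpTo]

theorem sum_primesUpTo_eq (n : ℕ) (f : ℕ → ℝ) :
    ∑ p ∈ primesUpTo n, Real.log p * f p = ∑ i ∈ Finset.range (n + 1), primeLog i * f i := by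
  rw [primesUpTo, Finset.sum_filter]
  refine Finset.sum_congr rfl fun i _ => ?_
  unfold primeLog
  split_ifs <;> simp

/-- The contribution of the small primes to the error. -/
theorem sum_primesUpTo_log_pow_mul_primeRoot_le (N : ℕ) {k : ℕ} (hk : 2 ≤ k) :
    ∑ p ∈ primesUpTo (k ^ 2), Real.log p ^ (N + 1) * primeRoot p ≤
      2 ^ N * 16 * (k * Real.log k ^ N) := by
  have hk0 : (0 : ℝ) < k := by exact_mod_cast (by omega : 0 < k)
  -- Since p ≤ k², N of the logarithms are bounded by 2 log k; the last one is kept for Chebyshev's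
  -- bound.
  have hterm : ∀ p ∈ primesUpTo (k ^ 2), Real.log p ^ (N + 1) * primeRoot p ≤
      (2 * Real.log k) ^ N * 2 * (Real.log p * (1 / √((p : ℝ) + 1))) := by
    intro p hp
    obtain ⟨hpk, hpp⟩ := mem_primesUpTo.mp hp
    have hp1 : (1 : ℝ) ≤ p := by exact_mod_cast hpp.one_lt.le
    have hlog : 0 ≤ Real.log p := Real.log_nonneg hp1
    have h1 : Real.log p ≤ 2 * Real.log k := by
      rw [← Real.log_rpow hk0, Real.rpow_ofNat]
      exact Real.log_le_log (by linarith) (by exact_mod_cast hpk)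
    have h2 : primeRoot p ≤ 2 * (1 / √((p : ℝ) + 1)) := by
      rw [primeRoot, Real.rpow_neg (by linarith), ← Real.sqrt_eq_rpow, ← one_div, mul_one_div,
        div_le_div_iff₀ (Real.sqrt_pos.mpr (by linarith)) (Real.sqrt_pos.mpr (by linarith)), one_mul,
        Real.sqrt_le_left (by positivity), mul_pow, Real.sq_sqrt (by linarith)]
      linarith
    calc Real.log p ^ (N + 1) * primeRoot p = Real.log p ^ N * (Real.log p * primeRoot p) := by ring
      _ ≤ (2 * Real.log k) ^ N * (Real.log p * (2 * (1 / √((p : ℝ) + 1)))) := by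
        have := primeRoot_nonneg p
        gcongr
      _ = _ := by ring
  have hlogk : 0 ≤ Real.log k := Real.log_natCast_nonneg k
  refine (Finset.sum_le_sum hterm).trans ?_
  rw [← Finset.mul_sum, sum_primesUpTo_eq _ fun p => 1 / √((p : ℝ) + 1)]
  have h3 := sum_range_primeLog_div_sqrt_le (k ^ 2 + 1)
  have h4 : √((k ^ 2 + 1 : ℕ) : ℝ) ≤ 2 * k := by
    rw [Real.sqrt_le_left (by positivity)]
    push_cast
    have : (2 : ℝ) ≤ k := by exact_mod_cast hk
    nlinarith
  calc _ ≤ (2 * Real.log k) ^ N * 2 * (4 * (2 * k)) := by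
        gcongr
        exact h3.trans (by gcongr)
    _ = _ := by ring

/-- The contribution of the large primes to the error. -/
theorem sum_primeLog_pow_div_sq_le (N : ℕ) {k : ℕ} (hk : 2 ≤ k) (n : ℕ) :
    ∑ i ∈ Finset.Ico (k ^ 2 + 1) n, primeLog i ^ (N + 1) / (i : ℝ) ^ 2 ≤
      24 * (2 * (2 * N + 3)) ^ N * (Real.log k ^ N / k ^ 2) := by
  have hk1 : (2 : ℝ) ≤ k := by exact_mod_cast hk
  have hk0 : (0 : ℝ) < k := by linarith
  have hlogk0 : 1 / 2 ≤ Real.log k := by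
    have h1 := Real.log_le_log (by norm_num) hk1
    have := Real.log_two_gt_d9
    linarith
  have hterm : ∀ i ∈ Finset.Ico (k ^ 2 + 1) n, primeLog i ^ (N + 1) / (i : ℝ) ^ 2 ≤
      (2 * Real.log k) ^ N * (2 * N + 3) ^ N / k * 4 *
        (primeLog i * (1 / (((i : ℝ) + 1) * √((i : ℝ) + 1)))) := by
    intro i hi
    by_cases hp : i.Prime
    swap
    · simp [primeLog, hp]
    have hik : ((k : ℝ) ^ 2) ≤ i := by
      have := (Finset.mem_Ico.mp hi).1
      exact_mod_cast (by omega : k ^ 2 ≤ i)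
    have hi1 : (1 : ℝ) ≤ i := by nlinarith
    have hi0 : (0 : ℝ) < i := by linarith
    rw [show primeLog i = Real.log i by simp [primeLog, hp]]
    have hu : 1 ≤ (i : ℝ) / k ^ 2 := by
      rw [le_div_iff₀ (by positivity)]
      linarith
    -- Measuring i against k² gives the bound log^N k instead of a power of k; 2 log k ≥ 1 lets the
    -- sum be written as a product. The excess (1 + log(i/k²))^N costs at most √(i/k²), which i^(-2)
    -- can spare.
    have hloge : Real.log i ≤ 2 * Real.log k * (1 + Real.log (i / k ^ 2)) := by
      have e : Real.log (i / k ^ 2) = Real.log i - 2 * Real.log k := by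
        rw [Real.log_div hi0.ne' (by positivity), Real.log_pow]
        push_cast
        ring
      have h0 : 0 ≤ Real.log (i / k ^ 2) := Real.log_nonneg hu
      nlinarith
    have hsq : √((i : ℝ) / k ^ 2) = √i / k := by
      rw [Real.sqrt_div hi0.le, Real.sqrt_sq hk0.le]
    have hpow : Real.log i ^ N ≤ (2 * Real.log k) ^ N * ((2 * N + 3) ^ N * (√i / k)) := by
      rw [← hsq]
      calc _ ≤ (2 * Real.log k * (1 + Real.log (i / k ^ 2))) ^ N :=
            pow_le_pow_left₀ (Real.log_nonneg hi1) hloge N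
        _ = (2 * Real.log k) ^ N * (1 + Real.log (i / k ^ 2)) ^ N := mul_pow _ _ _
        _ ≤ _ := by
          gcongr
          exact one_add_log_pow_le N hu
    have hroot : √(i : ℝ) / (i : ℝ) ^ 2 ≤ 4 * (1 / (((i : ℝ) + 1) * √((i : ℝ) + 1))) := by
      have hs : 0 < √(i : ℝ) := Real.sqrt_pos.mpr hi0
      have hs1 : 0 < √((i : ℝ) + 1) := Real.sqrt_pos.mpr (by linarith)
      rw [mul_one_div, div_le_div_iff₀ (by positivity) (by positivity)]
      have h5 : √((i : ℝ) + 1) ≤ 2 * √i := by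
        rw [Real.sqrt_le_left (by positivity), mul_pow, Real.sq_sqrt hi0.le]
        linarith
      have h6 : √(i : ℝ) * √i = i := Real.mul_self_sqrt hi0.le
      calc √(i : ℝ) * (((i : ℝ) + 1) * √((i : ℝ) + 1)) ≤ √i * ((2 * i) * (2 * √i)) := by
            gcongr
            linarith
        _ = 4 * (√(i : ℝ) * √i) * i := by ring
        _ = _ := by rw [h6]; ring
    have hlog0 : 0 ≤ Real.log i := Real.log_nonneg hi1
    calc Real.log i ^ (N + 1) / (i : ℝ) ^ 2 = Real.log i ^ N * (Real.log i * (1 / (i : ℝ) ^ 2)) := by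
          rw [pow_succ]; ring
      _ ≤ (2 * Real.log k) ^ N * ((2 * N + 3) ^ N * (√i / k)) * (Real.log i * (1 / (i : ℝ) ^ 2)) := by
          gcongr
      _ = (2 * Real.log k) ^ N * (2 * N + 3) ^ N / k * (Real.log i * (√(i : ℝ) / (i : ℝ) ^ 2)) := by
          ring
      _ ≤ (2 * Real.log k) ^ N * (2 * N + 3) ^ N / k *
          (Real.log i * (4 * (1 / (((i : ℝ) + 1) * √((i : ℝ) + 1))))) := by gcongr
      _ = _ := by ring
  refine (Finset.sum_le_sum hterm).trans ?_
  rw [← Finset.mul_sum]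
  have h := sum_Ico_primeLog_div_mul_sqrt_le (Y := k ^ 2) (n := n) (Nat.one_le_pow _ _ (by omega))
  push_cast at h
  rw [Real.sqrt_sq hk0.le] at h
  calc _ ≤ (2 * Real.log k) ^ N * (2 * N + 3) ^ N / k * 4 * (6 / k) := by gcongr
    _ = _ := by
      rw [mul_pow, mul_pow]
      field_simp
      ring

end ZetaMoment

/-! ### Mertens' estimate and the size of the main sums -/

namespace ZetaMoment

theorem log_factorial_eq (n : ℕ) : Real.log n.factorial =
    ∑ p ∈ primesUpTo n, Real.log p * (n.factorial.factorization p : ℝ) := by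
  have h : (n.factorial : ℝ) = ∏ p ∈ primesUpTo n, (p : ℝ) ^ n.factorial.factorization p := by
    conv_lhs => rw [← Nat.prod_factorization_pow_eq_self n.factorial_ne_zero]
    rw [Finsupp.prod_of_support_subset (s := primesUpTo n)]
    · push_cast
      rfl
    · intro p hp
      rw [Nat.support_factorization, Nat.mem_primeFactors] at hp
      exact mem_primesUpTo.mpr ⟨(hp.1.dvd_factorial).mp hp.2.1, hp.1⟩
    · intro p _
      exact pow_zero p
  rw [h, Real.log_prod]
  · refine Finset.sum_congr rfl fun p _ => ?_
    rw [Real.log_pow, mul_comm]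
  · intro p hp
    exact pow_ne_zero _ (Nat.cast_ne_zero.mpr (mem_primesUpTo.mp hp).2.ne_zero)

theorem div_le_factorization_factorial {n p : ℕ} (hp : p.Prime) :
    n / p ≤ n.factorial.factorization p := by
  -- The bound + 2 keeps the exponent 1 in the range even when n < p.
  rw [Nat.factorization_factorial hp (b := Nat.log p n + 2) (by omega)]
  have h := Finset.single_le_sum (f := fun i => n / p ^ i) (fun i _ => Nat.zero_le _)
    (show 1 ∈ Finset.Ico 1 (Nat.log p n + 2) by simp)
  simpa using h

theorem factorization_factorial_le {n p : ℕ} (hp : p.Prime) :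
    (n.factorial.factorization p : ℝ) ≤ n / ((p : ℝ) - 1) := by
  have h := Nat.sub_one_mul_factorization_factorial (n := n) hp
  have h1 : (1 : ℝ) < p := by exact_mod_cast hp.one_lt
  rw [le_div_iff₀ (by linarith)]
  have h2 : (p - 1) * n.factorial.factorization p ≤ n := by
    rw [h]
    exact Nat.sub_le _ _
  have h3 : (((p - 1 : ℕ) : ℝ)) * n.factorial.factorization p ≤ n := by exact_mod_cast h2
  rw [Nat.cast_sub hp.one_lt.le, Nat.cast_one] at h3
  linarith

/-- Legendre's formula gives at least n/p - 1 factors p in n!, and log n! ≤ n log n. The rounding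
loss ∑ log p is O(n) by Chebyshev. -/
theorem sum_log_div_le {n : ℕ} (hn : 1 ≤ n) :
    ∑ p ∈ primesUpTo n, Real.log p / p ≤ Real.log n + 4 := by
  have hn0 : (0 : ℝ) < n := by exact_mod_cast hn
  have h1 : ∑ p ∈ primesUpTo n, Real.log p * ((n : ℝ) / p - 1) ≤ Real.log n.factorial := by
    rw [log_factorial_eq]
    refine Finset.sum_le_sum fun p hp => ?_
    have hpp := (mem_primesUpTo.mp hp).2
    refine mul_le_mul_of_nonneg_left ?_ (Real.log_natCast_nonneg p)
    have hp0 : (0 : ℝ) < p := by exact_mod_cast hpp.pos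
    have h2 : ((n / p : ℕ) : ℝ) ≤ n.factorial.factorization p := by
      exact_mod_cast div_le_factorization_factorial hpp
    have h3 : (n : ℝ) / p < ((n / p : ℕ) : ℝ) + 1 := by
      rw [div_lt_iff₀ hp0]
      exact_mod_cast Nat.lt_mul_of_div_lt (Nat.lt_succ_self (n / p)) hpp.pos
    linarith
  have h2 : Real.log n.factorial ≤ n * Real.log n := by
    rw [← Real.log_pow]
    refine Real.log_le_log (by exact_mod_cast n.factorial_pos) ?_
    exact_mod_cast Nat.factorial_le_pow n
  have h3 : ∑ p ∈ primesUpTo n, Real.log p ≤ 4 * n := by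
    have e := sum_primesUpTo_eq n fun _ => 1
    simp only [mul_one] at e
    rw [e]
    refine (sum_range_primeLog_le (n + 1)).trans ?_
    have : (1 : ℝ) ≤ n := by exact_mod_cast hn
    push_cast
    linarith
  have h4 : ∑ p ∈ primesUpTo n, Real.log p * ((n : ℝ) / p - 1) =
      n * ∑ p ∈ primesUpTo n, Real.log p / p - ∑ p ∈ primesUpTo n, Real.log p := by
    rw [Finset.mul_sum, ← Finset.sum_sub_distrib]
    refine Finset.sum_congr rfl fun p _ => ?_
    ring
  have h5 : n * ∑ p ∈ primesUpTo n, Real.log p / p ≤ n * (Real.log n + 4) := by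
    linarith
  exact le_of_mul_le_mul_left h5 hn0

theorem summable_log_pow_div_sq (N : ℕ) :
    Summable fun n : ℕ => Real.log n ^ N / (n : ℝ) ^ 2 := by
  have h : Summable fun n : ℕ => ((2 * N + 3) ^ N : ℝ) * (1 / (n : ℝ) ^ (3 / 2 : ℝ)) :=
    (Real.summable_one_div_nat_rpow.mpr (by norm_num)).mul_left _
  refine Summable.of_nonneg_of_le (fun n => ?_) (fun n => ?_) h
  · have := Real.log_natCast_nonneg n
    positivity
  · rcases Nat.eq_zero_or_pos n with rfl | hn
    · simp
    have hn1 : (1 : ℝ) ≤ n := by exact_mod_cast hn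
    have hn0 : (0 : ℝ) < n := by linarith
    have hl := Real.log_nonneg hn1
    have e : √(n : ℝ) / (n : ℝ) ^ 2 = 1 / (n : ℝ) ^ (3 / 2 : ℝ) := by
      rw [Real.sqrt_eq_rpow, ← Real.rpow_natCast, ← Real.rpow_sub hn0,
        one_div ((n : ℝ) ^ (3 / 2 : ℝ)), ← Real.rpow_neg hn0.le]
      norm_num
    calc Real.log n ^ N / (n : ℝ) ^ 2 ≤ (1 + Real.log n) ^ N / (n : ℝ) ^ 2 := by
          gcongr
          linarith
      _ ≤ ((2 * N + 3) ^ N * √n) / (n : ℝ) ^ 2 := by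
          gcongr
          exact one_add_log_pow_le N hn1
      _ = _ := by rw [mul_div_assoc, e]

theorem exists_sum_log_pow_div_sq_le (N : ℕ) : ∃ C : ℝ, 0 ≤ C ∧ ∀ n : ℕ,
    ∑ p ∈ primesUpTo n, Real.log p ^ N / (p : ℝ) ^ 2 ≤ C := by
  have h0 : ∀ n : ℕ, 0 ≤ Real.log n ^ N / (n : ℝ) ^ 2 := fun n => by
    have := Real.log_natCast_nonneg n
    positivity
  exact ⟨_, tsum_nonneg h0, fun n => (summable_log_pow_div_sq N).sum_le_tsum _ fun i _ => h0 i⟩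

/-- Now n! contains at most n/(p-1) factors p, while n^n/n! ≤ e^n gives log n! ≥ n log n - n. The
excess 1/(p-1) - 1/p ≤ 2/p² is summable against log p. -/
theorem exists_le_sum_log_div : ∃ C : ℝ, ∀ n : ℕ, 1 ≤ n →
    Real.log n - C ≤ ∑ p ∈ primesUpTo n, Real.log p / p := by
  obtain ⟨C, _, hC⟩ := exists_sum_log_pow_div_sq_le 1
  refine ⟨1 + 2 * C, fun n hn => ?_⟩
  have hn0 : (0 : ℝ) < n := by exact_mod_cast hn
  have h1 : n * Real.log n - n ≤ Real.log n.factorial := by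
    have h := Real.pow_div_factorial_le_exp n hn0.le n
    have hf : (0 : ℝ) < n.factorial := by exact_mod_cast n.factorial_pos
    have h2 := Real.log_le_log (by positivity) h
    rw [Real.log_exp, Real.log_div (by positivity) hf.ne', Real.log_pow] at h2
    linarith
  have h2 : Real.log n.factorial ≤ ∑ p ∈ primesUpTo n,
      (n * (Real.log p / p) + n * (2 * (Real.log p ^ 1 / (p : ℝ) ^ 2))) := by
    rw [log_factorial_eq]
    refine Finset.sum_le_sum fun p hp => ?_
    have hpp := (mem_primesUpTo.mp hp).2
    have hp2 : (2 : ℝ) ≤ p := by exact_mod_cast hpp.two_le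
    have hl := Real.log_natCast_nonneg p
    have h3 : 1 / ((p : ℝ) - 1) ≤ 1 / p + 2 / (p : ℝ) ^ 2 := by
      rw [div_add_div _ _ (by positivity) (by positivity),
        div_le_div_iff₀ (by linarith) (by positivity)]
      nlinarith
    calc Real.log p * (n.factorial.factorization p : ℝ) ≤ Real.log p * (n / ((p : ℝ) - 1)) :=
          mul_le_mul_of_nonneg_left (factorization_factorial_le hpp) hl
      _ = Real.log p * n * (1 / ((p : ℝ) - 1)) := by ring
      _ ≤ Real.log p * n * (1 / p + 2 / (p : ℝ) ^ 2) := by gcongr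
      _ = _ := by ring
  rw [Finset.sum_add_distrib, ← Finset.mul_sum, ← Finset.mul_sum, ← Finset.mul_sum] at h2
  have h3 := hC n
  have h4 : n * (Real.log n - (1 + 2 * C)) ≤ n * ∑ p ∈ primesUpTo n, Real.log p / p := by
    have := mul_le_mul_of_nonneg_left h3 hn0.le
    linarith
  exact le_of_mul_le_mul_left h4 hn0

/-- The main sum without the prime powers. -/
noncomputable def mainSum (N k : ℕ) : ℝ := ∑ p ∈ primesUpTo (k ^ 2), Real.log p ^ N / (p : ℝ)

/-- The main sum with the prime powers. -/
noncomputable def mainSumPow (N k : ℕ) : ℝ := ∑ p ∈ primesUpTo (k ^ 2),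
  Real.log p ^ N * ∑' n : ℕ, ((n : ℝ) + 1) ^ (N - 1) / (p : ℝ) ^ (n + 1)

theorem primesUpTo_subset {m n : ℕ} (h : m ≤ n) : primesUpTo m ⊆ primesUpTo n := by
  intro p hp
  rw [mem_primesUpTo] at hp ⊢
  exact ⟨hp.1.trans h, hp.2⟩

/-- Primes in (k, k²] suffice: there log p ≥ log k, and the two halves of Mertens' estimate leave ∑
log p / p ≥ log k - O(1). -/
theorem exists_le_mainSum (N : ℕ) : ∃ K : ℕ, ∀ k : ℕ, K ≤ k →
    1 / 2 * Real.log k ^ (N + 1) ≤ mainSum (N + 1) k := by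
  obtain ⟨C, hC⟩ := exists_le_sum_log_div
  -- Beyond this threshold the loss C + 4 of the two Mertens bounds is at most half of log k.
  obtain ⟨K, hK⟩ := exists_nat_ge (Real.exp (2 * (C + 4)))
  refine ⟨max K 1, fun k hk => ?_⟩
  have hk1 : 1 ≤ k := (le_max_right _ _).trans hk
  have hk0 : (0 : ℝ) < k := by exact_mod_cast hk1
  have hKk : Real.exp (2 * (C + 4)) ≤ k := hK.trans (by exact_mod_cast (le_max_left _ _).trans hk)
  have hlogk : 2 * (C + 4) ≤ Real.log k := by
    rw [Real.le_log_iff_exp_le hk0]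
    exact hKk
  have hl0 : 0 ≤ Real.log k := Real.log_natCast_nonneg k
  have hsub : primesUpTo k ⊆ primesUpTo (k ^ 2) := primesUpTo_subset (Nat.le_self_pow (by norm_num) k)
  have h1 := hC (k ^ 2) (Nat.one_le_pow _ _ hk1)
  have h2 := sum_log_div_le hk1
  rw [← Finset.sum_sdiff hsub] at h1
  push_cast at h1
  rw [Real.log_pow] at h1
  push_cast at h1
  have h3 : 1 / 2 * Real.log k ≤ ∑ p ∈ primesUpTo (k ^ 2) \ primesUpTo k, Real.log p / p := by
    linarith
  have h4 : Real.log k ^ N * ∑ p ∈ primesUpTo (k ^ 2) \ primesUpTo k, Real.log p / p ≤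
      ∑ p ∈ primesUpTo (k ^ 2) \ primesUpTo k, Real.log p ^ (N + 1) / p := by
    rw [Finset.mul_sum]
    refine Finset.sum_le_sum fun p hp => ?_
    rw [Finset.mem_sdiff, mem_primesUpTo, mem_primesUpTo] at hp
    have hkp : k ≤ p := by
      by_contra hlt
      exact hp.2 ⟨by omega, hp.1.2⟩
    have hlp : Real.log k ≤ Real.log p := Real.log_le_log hk0 (by exact_mod_cast hkp)
    have hlp0 : 0 ≤ Real.log p / p := div_nonneg (Real.log_natCast_nonneg p) (Nat.cast_nonneg p)
    calc _ ≤ Real.log p ^ N * (Real.log p / p) := by gcongr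
      _ = _ := by ring
  have h5 : ∑ p ∈ primesUpTo (k ^ 2) \ primesUpTo k, Real.log p ^ (N + 1) / p ≤
      mainSum (N + 1) k := by
    refine Finset.sum_le_sum_of_subset_of_nonneg Finset.sdiff_subset fun p _ _ => ?_
    have := Real.log_natCast_nonneg p
    positivity
  calc _ = Real.log k ^ N * (1 / 2 * Real.log k) := by ring
    _ ≤ Real.log k ^ N * ∑ p ∈ primesUpTo (k ^ 2) \ primesUpTo k, Real.log p / p := by gcongr
    _ ≤ _ := h4.trans h5

/-- The prime powers beyond the first contribute O(log^(N+1) p / p²) uniformly, by comparison with p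
= 2. So the second asymptotic formula follows from the first. -/
theorem exists_mainSumPow_sub_le (N : ℕ) : ∃ C : ℝ, 0 ≤ C ∧ ∀ k : ℕ,
    0 ≤ mainSumPow (N + 1) k - mainSum (N + 1) k ∧
      mainSumPow (N + 1) k - mainSum (N + 1) k ≤ C := by
  obtain ⟨C, hC0, hC⟩ := exists_sum_log_pow_div_sq_le (N + 1)
  have hs : Summable fun n : ℕ => ((n : ℝ) + 2) ^ N * (1 / 2) ^ n := by
    have h := summable_pow_mul_geometric_of_norm_lt_one (R := ℝ) N (r := 1 / 2) (by norm_num)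
    have h2 := ((summable_nat_add_iff 2).mpr h).mul_left 4
    refine h2.congr fun n => ?_
    push_cast
    ring
  have hs0 : 0 ≤ ∑' n : ℕ, ((n : ℝ) + 2) ^ N * (1 / 2) ^ n := tsum_nonneg fun n => by positivity
  refine ⟨(∑' n : ℕ, ((n : ℝ) + 2) ^ N * (1 / 2) ^ n) * C, mul_nonneg hs0 hC0, fun k => ?_⟩
  have hterm : ∀ p ∈ primesUpTo (k ^ 2),
      0 ≤ Real.log p ^ (N + 1) * ∑' n : ℕ, ((n : ℝ) + 1) ^ (N + 1 - 1) / (p : ℝ) ^ (n + 1) -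
        Real.log p ^ (N + 1) / p ∧
      Real.log p ^ (N + 1) * ∑' n : ℕ, ((n : ℝ) + 1) ^ (N + 1 - 1) / (p : ℝ) ^ (n + 1) -
        Real.log p ^ (N + 1) / p ≤
      (∑' n : ℕ, ((n : ℝ) + 2) ^ N * (1 / 2) ^ n) * (Real.log p ^ (N + 1) / (p : ℝ) ^ 2) := by
    intro p hp
    have hpp := (mem_primesUpTo.mp hp).2
    have hp2 : (2 : ℝ) ≤ p := by exact_mod_cast hpp.two_le
    have hl := Real.log_natCast_nonneg p
    have hle : ∀ n : ℕ, (((n + 1 : ℕ) : ℝ) + 1) ^ N / (p : ℝ) ^ (n + 1 + 1) ≤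
        ((n : ℝ) + 2) ^ N * (1 / 2) ^ n * (1 / (p : ℝ) ^ 2) := by
      intro n
      have h1 : 1 / (p : ℝ) ^ n ≤ (1 / 2) ^ n := by
        rw [one_div_pow]
        gcongr
      calc _ = ((n : ℝ) + 2) ^ N * (1 / (p : ℝ) ^ n) * (1 / (p : ℝ) ^ 2) := by
            push_cast
            field_simp
            ring
        _ ≤ _ := by gcongr
    have htail : Summable fun n : ℕ => (((n + 1 : ℕ) : ℝ) + 1) ^ N / (p : ℝ) ^ (n + 1 + 1) :=
      Summable.of_nonneg_of_le (fun n => by positivity) hle (hs.mul_right _)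
    have hall : Summable fun n : ℕ => ((n : ℝ) + 1) ^ N / (p : ℝ) ^ (n + 1) :=
      (summable_nat_add_iff 1).mp htail
    have hb := htail.tsum_le_tsum hle (hs.mul_right _)
    rw [tsum_mul_right] at hb
    have hb0 : 0 ≤ ∑' n : ℕ, (((n + 1 : ℕ) : ℝ) + 1) ^ N / (p : ℝ) ^ (n + 1 + 1) :=
      tsum_nonneg fun n => by positivity
    have e : Real.log p ^ (N + 1) * ∑' n : ℕ, ((n : ℝ) + 1) ^ (N + 1 - 1) / (p : ℝ) ^ (n + 1) -
        Real.log p ^ (N + 1) / p = Real.log p ^ (N + 1) *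
          ∑' n : ℕ, (((n + 1 : ℕ) : ℝ) + 1) ^ N / (p : ℝ) ^ (n + 1 + 1) := by
      rw [Nat.add_sub_cancel, hall.tsum_eq_zero_add]
      simp
      ring
    rw [e]
    refine ⟨by positivity, ?_⟩
    calc _ ≤ Real.log p ^ (N + 1) *
          ((∑' n : ℕ, ((n : ℝ) + 2) ^ N * (1 / 2) ^ n) * (1 / (p : ℝ) ^ 2)) := by gcongr
      _ = _ := by ring
  rw [mainSumPow, mainSum, ← Finset.sum_sub_distrib]
  refine ⟨Finset.sum_nonneg fun p hp => (hterm p hp).1, ?_⟩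
  refine (Finset.sum_le_sum fun p hp => (hterm p hp).2).trans ?_
  rw [← Finset.mul_sum]
  exact mul_le_mul_of_nonneg_left (hC _) hs0

end ZetaMoment

/-! ### Assembly of the asymptotic formulas -/

namespace ZetaMoment

open Filter Topology Metric

theorem norm_primeCoeff_le' {k p : ℕ} (hp : 2 ≤ p) (hk : 1 ≤ k) (hkp : 10 * k ≤ p) (N : ℕ)
    (i : Fin (k + k)) :
    ‖primeCoeff k p (N + 1) i‖ ≤
      (N + 1).factorial * (6 * ((k : ℝ) ^ 3 / (p : ℝ) ^ 2)) * (2000 * Real.log p) ^ (N + 1) := by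
  induction i using Fin.addCases with
  | left i => exact norm_primeCoeff_le hp hk hkp N i
  | right i =>
    rw [primeCoeff_natAdd hp, norm_mul, norm_pow, norm_neg, norm_one, one_pow, one_mul]
    exact norm_primeCoeff_le hp hk hkp N i

theorem weight_single {n : ℕ} {α : Fin n → ℕ} {i : Fin n} (h : ∀ j, j ≠ i → α j = 0) :
    weight α = α i :=
  Finset.sum_eq_single i (fun j _ hj => h j hj) (by simp)

theorem sgn_castAdd {k : ℕ} {α : Fin (k + k) → ℕ} {i : Fin k}
    (h : ∀ j, j ≠ Fin.castAdd k i → α j = 0) : sgn k α = (-1) ^ (α (Fin.castAdd k i) + 1) := by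
  rw [sgn, if_pos, weight_single h]
  intro j
  refine h _ fun hj => ?_
  have := congrArg Fin.val hj
  simp at this
  omega

theorem sgn_natAdd {k : ℕ} {α : Fin (k + k) → ℕ} {i : Fin k} (h : α (Fin.natAdd k i) ≠ 0) :
    sgn k α = -1 := by
  rw [sgn, if_neg]
  exact fun hj => h (hj i)

theorem abs_sgn (k : ℕ) (α : Fin (k + k) → ℕ) : |sgn k α| = 1 := by
  rw [sgn]
  split_ifs <;> simp

theorem norm_primeCoeff_sub_sgn_le {k p : ℕ} (hp : 2 ≤ p) (hk : 1 ≤ k) (N : ℕ)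
    {α : Fin (k + k) → ℕ} {i : Fin (k + k)} (h : ∀ j, j ≠ i → α j = 0) (hi : α i = N + 1) :
    ‖primeCoeff k p (N + 1) i - ((sgn k α * k * (Real.log p ^ (N + 1) *
      ∑' n : ℕ, ((n : ℝ) + 1) ^ N / (p : ℝ) ^ (n + 1)) : ℝ) : ℂ)‖ ≤
      (N + 1).factorial * primeRoot p * (2000 * Real.log p) ^ (N + 1) := by
  induction i using Fin.addCases with
  | left i =>
    rw [sgn_castAdd h, hi, pow_succ, pow_succ, mul_assoc _ (-1 : ℝ) (-1), neg_one_mul, neg_neg,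
      mul_one]
    exact norm_primeCoeff_sub_le hp hk N i
  | right i =>
    rw [primeCoeff_natAdd hp, sgn_natAdd (i := i) (by rw [hi]; exact Nat.succ_ne_zero N)]
    have bound := norm_primeCoeff_sub_le hp hk N i
    generalize Real.log p ^ (N + 1) *
      ∑' n : ℕ, ((n : ℝ) + 1) ^ N / (p : ℝ) ^ (n + 1) = M at bound ⊢
    have e : (-1 : ℂ) ^ (N + 1) * primeCoeff k p (N + 1) (Fin.castAdd k i) -
        ((-1 * k * M : ℝ) : ℂ) =
        (-1 : ℂ) ^ (N + 1) * (primeCoeff k p (N + 1) (Fin.castAdd k i) -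
          (((-1) ^ N * k * M : ℝ) : ℂ)) := by
      have h1 : (-1 : ℂ) ^ (N + 1) * (-1) ^ N = -1 := by
        rw [← pow_add, show N + 1 + N = 2 * N + 1 by ring, pow_succ, pow_mul]
        simp
      push_cast
      linear_combination ((k : ℂ) * M) * h1
    rw [e, norm_mul, norm_pow, norm_neg, norm_one, one_pow, one_mul]
    exact bound

/-- The constant of the error term in the approximation of the coefficients. -/
noncomputable def errorConst (N : ℕ) : ℝ :=
  2000 ^ (N + 1) * (2 ^ N * 16) + 6 * 2000 ^ (N + 1) * (24 * (2 * (2 * N + 3)) ^ N)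

theorem norm_aCoeff_sub_mainSumPow_le (N : ℕ) {k : ℕ} (hk : 10 ≤ k)
    {α : Fin (k + k) → ℕ} {i : Fin (k + k)} (h : ∀ j, j ≠ i → α j = 0) (hi : α i = N + 1) :
    ‖aCoeff k α - ((sgn k α * (k / ((N + 1).factorial : ℝ)) * mainSumPow (N + 1) k : ℝ) : ℂ)‖ ≤
      errorConst N * (k * Real.log k ^ N) := by
  have hk0 : (0 : ℝ) < k := by exact_mod_cast (by omega : 0 < k)
  have hf : (0 : ℝ) < (N + 1).factorial := by exact_mod_cast (N + 1).factorial_pos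
  have hfne : ((N + 1).factorial : ℂ) ≠ 0 := by exact_mod_cast (N + 1).factorial_ne_zero
  have hsum := hasSum_aCoeff_single h
  rw [hi] at hsum
  set F : ℕ → ℂ := fun p => ((N + 1).factorial : ℂ)⁻¹ * primeCoeff k p (N + 1) i with hF
  have hsumF : HasSum ({p : ℕ | p.Prime}.indicator F) (aCoeff k α) :=
    (hasSum_subtype_iff_indicator (s := {p : ℕ | p.Prime}) (f := F)).mp hsum
  have hlim := hsumF.tendsto_sum_nat.sub_const
    ((sgn k α * (k / ((N + 1).factorial : ℝ)) * mainSumPow (N + 1) k : ℝ) : ℂ)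
  -- The bound is proved for every partial sum past k² and passes to the limit.
  refine le_of_tendsto hlim.norm ?_
  filter_upwards [eventually_ge_atTop (k ^ 2 + 1)] with n hn
  rw [← Finset.sum_range_add_sum_Ico _ hn]
  have e1 : ∑ p ∈ Finset.range (k ^ 2 + 1), {p : ℕ | p.Prime}.indicator F p =
      ∑ p ∈ primesUpTo (k ^ 2), F p := by
    rw [primesUpTo, Finset.sum_filter]
    exact Finset.sum_congr rfl fun p _ => by simp [Set.indicator_apply]
  have e2 : ((sgn k α * (k / ((N + 1).factorial : ℝ)) * mainSumPow (N + 1) k : ℝ) : ℂ) =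
      ∑ p ∈ primesUpTo (k ^ 2), ((N + 1).factorial : ℂ)⁻¹ *
        ((sgn k α * k * (Real.log p ^ (N + 1) *
          ∑' n : ℕ, ((n : ℝ) + 1) ^ N / (p : ℝ) ^ (n + 1)) : ℝ) : ℂ) := by
    rw [← Finset.mul_sum, ← Complex.ofReal_sum, ← Finset.mul_sum, mainSumPow, Nat.add_sub_cancel]
    push_cast
    ring
  rw [e1, e2, add_sub_right_comm, ← Finset.sum_sub_distrib]
  have hsmall : ‖∑ p ∈ primesUpTo (k ^ 2), (F p - ((N + 1).factorial : ℂ)⁻¹ *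
        ((sgn k α * k * (Real.log p ^ (N + 1) *
          ∑' n : ℕ, ((n : ℝ) + 1) ^ N / (p : ℝ) ^ (n + 1)) : ℝ) : ℂ))‖ ≤
      2000 ^ (N + 1) * (2 ^ N * 16 * (k * Real.log k ^ N)) := by
    refine (norm_sum_le _ _).trans ((Finset.sum_le_sum (g := fun p : ℕ => 2000 ^ (N + 1) *
      (Real.log p ^ (N + 1) * primeRoot p)) fun p hp => ?_).trans ?_)
    · have hpp := (mem_primesUpTo.mp hp).2
      rw [hF]
      dsimp only
      rw [← mul_sub, norm_mul, norm_inv, Complex.norm_natCast, inv_mul_le_iff₀ hf]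
      refine (norm_primeCoeff_sub_sgn_le hpp.two_le (by omega) N h hi).trans_eq ?_
      ring
    · rw [← Finset.mul_sum]
      exact mul_le_mul_of_nonneg_left
        (sum_primesUpTo_log_pow_mul_primeRoot_le N (by omega)) (by positivity)
  have hlarge : ‖∑ p ∈ Finset.Ico (k ^ 2 + 1) n, {p : ℕ | p.Prime}.indicator F p‖ ≤
      6 * 2000 ^ (N + 1) * k ^ 3 *
        (24 * (2 * (2 * N + 3)) ^ N * (Real.log k ^ N / k ^ 2)) := by
    refine (norm_sum_le _ _).trans ((Finset.sum_le_sum (g := fun p : ℕ => 6 * 2000 ^ (N + 1) *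
      (k : ℝ) ^ 3 * (primeLog p ^ (N + 1) / (p : ℝ) ^ 2)) fun p hp => ?_).trans ?_)
    · by_cases hpp : p.Prime
      · rw [Set.indicator_of_mem (show p ∈ {p : ℕ | p.Prime} from hpp), hF]
        dsimp only
        rw [norm_mul, norm_inv, Complex.norm_natCast, inv_mul_le_iff₀ hf]
        -- From p > k² and k ≥ 10, so the large-prime bound applies throughout this range.
        have hkp : 10 * k ≤ p := by
          have := (Finset.mem_Ico.mp hp).1
          nlinarith
        refine (norm_primeCoeff_le' hpp.two_le (by omega) hkp N i).trans_eq ?_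
        rw [primeLog, if_pos hpp]
        ring
      · rw [Set.indicator_of_notMem (show p ∉ {p : ℕ | p.Prime} from hpp), norm_zero]
        have := primeLog_nonneg p
        positivity
    · rw [← Finset.mul_sum]
      exact mul_le_mul_of_nonneg_left (sum_primeLog_pow_div_sq_le N (by omega) n) (by positivity)
  refine (norm_add_le _ _).trans ((add_le_add hsmall hlarge).trans_eq ?_)
  rw [errorConst]
  field_simp

/-- The absolute error has one logarithm less than the main term, hence a relative error O(1/l). -/
theorem exists_relative_error {X : ℂ} {Y C c k l : ℝ} {N : ℕ} (hc : 0 < c) (hk : 0 < k)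
    (hl : 0 < l) (hX : ‖X - Y‖ ≤ C * (k * l ^ N)) (hY : c * (k * l ^ (N + 1)) ≤ |Y|) :
    ∃ ε : ℂ, ‖ε‖ ≤ C / c / l ∧ X = Y * (1 + ε) := by
  have hpos : 0 < c * (k * l ^ (N + 1)) := by positivity
  have hYne : Y ≠ 0 := abs_pos.mp (hpos.trans_le hY)
  have hYne' : (Y : ℂ) ≠ 0 := Complex.ofReal_ne_zero.mpr hYne
  refine ⟨(X - Y) / Y, ?_, by field_simp; ring⟩
  have hC : 0 ≤ C := by
    by_contra! hneg
    have : C * (k * l ^ N) < 0 := mul_neg_of_neg_of_pos hneg (by positivity)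
    linarith [norm_nonneg (X - Y)]
  rw [norm_div, Complex.norm_real, Real.norm_eq_abs]
  calc _ ≤ C * (k * l ^ N) / (c * (k * l ^ (N + 1))) := by gcongr
    _ = _ := by
      rw [pow_succ]
      field_simp

theorem exists_single_of_numNonzero {n : ℕ} {α : Fin n → ℕ} (h : numNonzero α = 1) :
    ∃ i, α i ≠ 0 ∧ ∀ j, j ≠ i → α j = 0 := by
  obtain ⟨i, hi⟩ := Finset.card_eq_one.mp h
  have hmem : ∀ j, α j ≠ 0 ↔ j = i := by
    intro j
    have := Finset.ext_iff.mp hi j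
    simpa using this
  exact ⟨i, (hmem i).mpr rfl, fun j hj => by
    by_contra hne
    exact hj ((hmem j).mp hne)⟩

theorem aCoeff_asymptotic (N : ℕ) : ∃ C : ℝ, ∃ K : ℕ, ∀ k : ℕ, K ≤ k → ∀ α : Fin (k + k) → ℕ,
    numNonzero α = 1 → weight α = N →
      (∃ ε : ℂ, ‖ε‖ ≤ C / Real.log k ∧ aCoeff k α =
        ((sgn k α * (k / (N.factorial : ℝ)) * mainSumPow N k : ℝ) : ℂ) * (1 + ε)) ∧
      (∃ ε : ℂ, ‖ε‖ ≤ C / Real.log k ∧ aCoeff k α =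
        ((sgn k α * (k / (N.factorial : ℝ)) * mainSum N k : ℝ) : ℂ) * (1 + ε)) := by
  cases N with
  | zero =>
    -- No index has a non-zero entry and weight zero, so the truncated exponent N - 1 never matters
    -- at N = 0.
    refine ⟨0, 0, fun k _ α h1 h2 => ?_⟩
    obtain ⟨i, hi, h⟩ := exists_single_of_numNonzero h1
    rw [weight_single h] at h2
    exact absurd h2 hi
  | succ N =>
    obtain ⟨C₁, hC₁0, hC₁⟩ := exists_mainSumPow_sub_le N
    obtain ⟨K, hK⟩ := exists_le_mainSum N
    have hf : (0 : ℝ) < (N + 1).factorial := by exact_mod_cast (N + 1).factorial_pos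
    -- The 1/2 is the constant of `exists_le_mainSum`, the factorial that of the Taylor coefficient.
    set c : ℝ := 1 / 2 / (N + 1).factorial with hcdef
    have hc : 0 < c := by positivity
    set D : ℝ := errorConst N + C₁ / (N + 1).factorial with hD
    refine ⟨D / c, max K 10, fun k hk α h1 h2 => ?_⟩
    have hk10 : 10 ≤ k := (le_max_right _ _).trans hk
    have hk0 : (0 : ℝ) < k := by exact_mod_cast (by omega : 0 < k)
    have hl1 : 1 ≤ Real.log k := by
      rw [Real.le_log_iff_exp_le hk0]
      have := Real.exp_one_lt_d9
      have h3 : (10 : ℝ) ≤ k := by exact_mod_cast hk10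
      linarith
    have hl : 0 < Real.log k := by linarith
    obtain ⟨i, hi, h⟩ := exists_single_of_numNonzero h1
    rw [weight_single h] at h2
    have hmain := norm_aCoeff_sub_mainSumPow_le N hk10 h h2
    have hlow := hK k ((le_max_left _ _).trans hk)
    obtain ⟨hd0, hd1⟩ := hC₁ k
    have hone : (1 : ℝ) ≤ Real.log k ^ N := one_le_pow₀ hl1
    have habs : ∀ S : ℝ, 1 / 2 * Real.log k ^ (N + 1) ≤ S →
        c * (k * Real.log k ^ (N + 1)) ≤ |sgn k α * (k / ((N + 1).factorial : ℝ)) * S| := by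
      intro S hS
      have hS0 : 0 ≤ S := le_trans (by positivity) hS
      rw [abs_mul, abs_mul, abs_sgn, one_mul, abs_of_nonneg (by positivity), abs_of_nonneg hS0]
      calc _ = k / ((N + 1).factorial : ℝ) * (1 / 2 * Real.log k ^ (N + 1)) := by
            rw [hcdef]
            ring
        _ ≤ _ := by gcongr
    have hle : errorConst N * (k * Real.log k ^ N) ≤ D * (k * Real.log k ^ N) := by
      rw [hD]
      have : 0 ≤ C₁ / ((N + 1).factorial : ℝ) := by positivity
      gcongr
      linarith
    refine ⟨exists_relative_error hc hk0 hl (hmain.trans hle) (habs _ (by linarith)),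
      exists_relative_error hc hk0 hl ?_ (habs _ hlow)⟩
    have e : aCoeff k α - ((sgn k α * (k / ((N + 1).factorial : ℝ)) * mainSum (N + 1) k : ℝ) : ℂ) =
        (aCoeff k α - ((sgn k α * (k / ((N + 1).factorial : ℝ)) * mainSumPow (N + 1) k : ℝ) : ℂ)) +
        ((sgn k α * (k / ((N + 1).factorial : ℝ)) *
          (mainSumPow (N + 1) k - mainSum (N + 1) k) : ℝ) : ℂ) := by
      push_cast
      ring
    rw [e]
    refine (norm_add_le _ _).trans ?_
    have h2' : ‖((sgn k α * (k / ((N + 1).factorial : ℝ)) *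
        (mainSumPow (N + 1) k - mainSum (N + 1) k) : ℝ) : ℂ)‖ ≤
        C₁ / (N + 1).factorial * (k * Real.log k ^ N) := by
      rw [Complex.norm_real, Real.norm_eq_abs, abs_mul, abs_mul, abs_sgn, one_mul,
        abs_of_nonneg (by positivity), abs_of_nonneg hd0]
      calc _ ≤ k / ((N + 1).factorial : ℝ) * C₁ := by gcongr
        _ = C₁ / (N + 1).factorial * (k * 1) := by ring
        _ ≤ _ := by gcongr
    refine (add_le_add hmain h2').trans_eq ?_
    rw [hD]
    ring

theorem firstIndex_eq_zero {k : ℕ} (hk : 1 ≤ k) (j : Fin (k + k))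
    (hj : j ≠ Fin.castAdd k ⟨0, hk⟩) : firstIndex k j = 0 := by
  rw [firstIndex, if_neg]
  intro h
  exact hj (Fin.ext (by simpa using h))

theorem firstIndex_apply {k : ℕ} (hk : 1 ≤ k) : firstIndex k (Fin.castAdd k ⟨0, hk⟩) = 1 := by
  simp [firstIndex]

theorem hasSum_bTerm {k : ℕ} (hk : 1 ≤ k) :
    HasSum (fun p : Nat.Primes => (bTerm k p : ℂ)) (aCoeff k (firstIndex k)) := by
  have h := hasSum_aCoeff_single (firstIndex_eq_zero hk)
  rw [firstIndex_apply hk] at h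
  refine h.congr_fun fun p => ?_
  rw [← primeCoeff_one_eq_bTerm p.2.two_le hk ⟨0, hk⟩, Nat.factorial_one, Nat.cast_one, inv_one,
    one_mul]
  rfl

theorem summable_bTerm {k : ℕ} (hk : 1 ≤ k) : Summable fun p : Nat.Primes => bTerm k p :=
  Complex.summable_ofReal.mp (hasSum_bTerm hk).summable

theorem ofReal_B {k : ℕ} (hk : 1 ≤ k) : (B k : ℂ) = aCoeff k (firstIndex k) := by
  rw [B, Complex.ofReal_tsum]
  exact (hasSum_bTerm hk).tsum_eq

/-- The coefficient estimate with |α| = 1 has error O(k), and Mertens' estimate at k² gives log(k²)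
+ O(1); this is the origin of the 2 in 2k log k. -/
theorem exists_abs_B_sub_le : ∃ C : ℝ, ∀ᶠ k : ℕ in atTop,
    |B k - 2 * (k * Real.log k)| ≤ C * k := by
  obtain ⟨C₁, hC₁0, hC₁⟩ := exists_mainSumPow_sub_le 0
  obtain ⟨C₂, hC₂⟩ := exists_le_sum_log_div
  refine ⟨errorConst 0 + C₁ + max C₂ 4, ?_⟩
  filter_upwards [eventually_ge_atTop 10] with k hk
  have hk1 : 1 ≤ k := by omega
  have hk0 : (0 : ℝ) < k := by exact_mod_cast hk1
  have h := norm_aCoeff_sub_mainSumPow_le 0 hk (firstIndex_eq_zero hk1) (firstIndex_apply hk1)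
  rw [sgn_castAdd (firstIndex_eq_zero hk1), firstIndex_apply hk1, ← ofReal_B hk1,
    ← Complex.ofReal_sub, Complex.norm_real, Real.norm_eq_abs] at h
  norm_num at h
  obtain ⟨hd0, hd1⟩ := hC₁ k
  have h1 := hC₂ (k ^ 2) (Nat.one_le_pow _ _ hk1)
  have h2 := sum_log_div_le (Nat.one_le_pow 2 _ hk1)
  have e : mainSum (0 + 1) k = ∑ p ∈ primesUpTo (k ^ 2), Real.log p / p := by simp [mainSum]
  rw [← e] at h1 h2
  push_cast at h1 h2
  rw [Real.log_pow] at h1 h2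
  push_cast at h1 h2
  simp only [zero_add] at hd0 hd1 h1 h2
  have h3 : |mainSumPow 1 k - 2 * Real.log k| ≤ C₁ + max C₂ 4 := by
    rw [abs_le]
    constructor
    · linarith [le_max_left C₂ 4]
    · linarith [le_max_right C₂ 4]
  have e2 : B k - 2 * (k * Real.log k) =
      (B k - k * mainSumPow 1 k) + k * (mainSumPow 1 k - 2 * Real.log k) := by ring
  rw [e2]
  refine (abs_add_le _ _).trans ?_
  rw [abs_mul, abs_of_pos hk0]
  have h4 := mul_le_mul_of_nonneg_left h3 hk0.le
  linarith

theorem isEquivalent_mul_log {f : ℕ → ℝ} {a C : ℝ} (ha : a ≠ 0)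
    (h : ∀ᶠ k : ℕ in atTop, |f k - a * (k * Real.log k)| ≤ C * k) :
    Asymptotics.IsEquivalent atTop f fun k : ℕ => a * (k : ℝ) * Real.log k := by
  have h1 : (fun k : ℕ => f k - a * (k : ℝ) * Real.log k) =O[atTop] fun k : ℕ => (k : ℝ) := by
    refine Asymptotics.IsBigO.of_bound C ?_
    filter_upwards [h] with k hk
    rw [Real.norm_eq_abs, Real.norm_of_nonneg (Nat.cast_nonneg k), mul_assoc]
    exact hk
  have h2 : (fun k : ℕ => (k : ℝ)) =o[atTop] fun k : ℕ => a * (k : ℝ) * Real.log k := by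
    have hlog : (fun _ : ℕ => (1 : ℝ)) =o[atTop] fun k : ℕ => Real.log k := by
      rw [Asymptotics.isLittleO_const_left]
      right
      exact tendsto_norm_atTop_atTop.comp
        (Real.tendsto_log_atTop.comp tendsto_natCast_atTop_atTop)
    have := ((Asymptotics.isBigO_refl (fun k : ℕ => (k : ℝ)) atTop).mul_isLittleO
      hlog).const_mul_right ha
    simpa [mul_assoc] using this
  exact h1.trans_isLittleO h2

theorem B_isEquivalent :
    Asymptotics.IsEquivalent atTop B fun k : ℕ => 2 * (k : ℝ) * Real.log k := by
  obtain ⟨C, hC⟩ := exists_abs_B_sub_le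
  exact isEquivalent_mul_log two_ne_zero hC

theorem tau_isEquivalent :
    Asymptotics.IsEquivalent atTop tau fun k : ℕ => 4 * (k : ℝ) * Real.log k := by
  obtain ⟨C, hC⟩ := exists_abs_B_sub_le
  refine isEquivalent_mul_log (C := 2 * C + 2 * |Real.eulerMascheroniConstant|) four_ne_zero ?_
  filter_upwards [hC] with k hk
  have e : tau k - 4 * (k * Real.log k) =
      2 * (B k - 2 * (k * Real.log k)) + 2 * Real.eulerMascheroniConstant * k := by
    rw [tau]
    ring
  rw [e]
  refine (abs_add_le _ _).trans ?_
  rw [abs_mul, abs_mul, abs_mul, abs_two, abs_of_nonneg (Nat.cast_nonneg (α := ℝ) k)]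
  linarith

end ZetaMoment

theorem mainTheorem4 :
    -- For every `k ≥ 1` the Euler product converges near the origin, is holomorphic there, and has a
    -- logarithm there; so the Taylor coefficients of its logarithm make sense.
    (∀ k : ℕ, 1 ≤ k →
      (∀ᶠ z in nhds (0 : Fin (k + k) → ℂ),
        Multipliable (fun p : Nat.Primes => ZetaMoment.eulerFactor k z (p : ℕ))) ∧
      (∀ᶠ z in nhds (0 : Fin (k + k) → ℂ), DifferentiableAt ℂ (ZetaMoment.arithFactor k) z) ∧
      ZetaMoment.arithFactor k 0 ∈ Complex.slitPlane) ∧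
    -- The two asymptotic formulas, with constants that depend only on the weight `N = |α|`.
    (∀ N : ℕ, ∃ C : ℝ, ∃ K : ℕ, ∀ k : ℕ, K ≤ k → ∀ α : Fin (k + k) → ℕ,
      ZetaMoment.numNonzero α = 1 → ZetaMoment.weight α = N →
      (∃ ε : ℂ, ‖ε‖ ≤ C / Real.log k ∧
        ZetaMoment.aCoeff k α =
          ((ZetaMoment.sgn k α * (k / (N.factorial : ℝ)) *
            ∑ p ∈ ZetaMoment.primesUpTo (k ^ 2), Real.log p ^ N *
              ∑' n : ℕ, ((n : ℝ) + 1) ^ (N - 1) / (p : ℝ) ^ (n + 1) : ℝ) : ℂ) * (1 + ε)) ∧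
      (∃ ε : ℂ, ‖ε‖ ≤ C / Real.log k ∧
        ZetaMoment.aCoeff k α =
          ((ZetaMoment.sgn k α * (k / (N.factorial : ℝ)) *
            ∑ p ∈ ZetaMoment.primesUpTo (k ^ 2), Real.log p ^ N / (p : ℝ) : ℝ) : ℂ) *
              (1 + ε))) ∧
    -- The linear coefficient `B_k`, and `τ_k`.
    (∀ k : ℕ, 1 ≤ k →
      Summable (fun p : Nat.Primes => ZetaMoment.bTerm k (p : ℕ)) ∧
      (ZetaMoment.B k : ℂ) = ZetaMoment.aCoeff k (ZetaMoment.firstIndex k)) ∧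
    Asymptotics.IsEquivalent Filter.atTop ZetaMoment.B (fun k : ℕ => 2 * (k : ℝ) * Real.log k) ∧
    Asymptotics.IsEquivalent Filter.atTop ZetaMoment.tau
      (fun k : ℕ => 4 * (k : ℝ) * Real.log k) := by
  refine ⟨fun k _ => ?_, fun N => ?_, fun k hk => ⟨ZetaMoment.summable_bTerm hk,
    ZetaMoment.ofReal_B hk⟩, ZetaMoment.B_isEquivalent, ZetaMoment.tau_isEquivalent⟩
  · obtain ⟨h1, h2, h3, _⟩ := ZetaMoment.arithFactor_regular k
    exact ⟨h1, h2, h3⟩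
  · exact ZetaMoment.aCoeff_asymptotic N
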